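/- **Setting.** Let $\mathbf F=\mathbb C((q))$, $\mathbf A=\mathbb C[[q]]$, $n\ge 2$, $P^\vee=\bigoplus_{j=1}^n\mathbb Zk_j$, $P=\bigoplus_{j=1}^n\mathbb Z\epsilon_j$ with $\langle k_i,\epsilon_j\rangle=\delta_{ij}$, $P^{\ge0}=\bigoplus_j\mathbb Z_{\ge0}\epsilon_j$, $\alpha_i=\epsilon_i-\epsilon_{i+1}$, $h_i=k_i-k_{i+1}$. Let $U=U_q(\mathfrak q(n))$ be the quantum queer superalgebra over $\mathbf F$: it has even generators $e_i,f_i$ $(1\le i\le n-1)$, $q^h$ $(h\in P^\vee)$ and odd generators $e_{\bar i},f_{\bar i}$ $(1\le i\le n-1)$, $k_{\bar j}$ $(1\le j\le n)$, with defining relations $q^0=1$, $q^{h}q^{h'}=q^{h+h'}$, $q^he_iq^{-h}=q^{\alpha_i(h)}e_i$, $q^hf_iq^{-h}=q^{-\alpha_i(h)}f_i$, $q^hk_{\bar j}=k_{\bar j}q^h$; $e_if_j-f_je_i=\delta_{ij}\frac{q^{h_i}-q^{-h_i}}{q-q^{-1}}$; $e_ie_j=e_je_i$, $f_if_j=f_jf_i$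 for $|i-j|>1$; $x_i^2x_j-(q+q^{-1})x_ix_jx_i+x_jx_i^2=0$ and $x_i^2x_{\bar j}-(q+q^{-1})x_ix_{\bar j}x_i+x_{\bar j}x_i^2=0$ for $|i-j|=1$, $x\in\{e,f\}$; $k_{\bar i}^2=\frac{q^{2k_i}-q^{-2k_i}}{q^2-q^{-2}}$, $k_{\bar i}k_{\bar j}+k_{\bar j}k_{\bar i}=0$ for $i\ne j$; $k_{\bar i}e_i-qe_ik_{\bar i}=e_{\bar i}q^{-k_i}$, $k_{\bar i}f_i-qf_ik_{\bar i}=-f_{\bar i}q^{k_i}$; $e_if_{\bar j}-f_{\bar j}e_i=\delta_{ij}(k_{\bar i}q^{-k_{i+1}}-k_{\overline{i+1}}q^{-k_i})$, $e_{\bar i}f_j-f_je_{\bar i}=\delta_{ij}(k_{\bar i}q^{k_{i+1}}-k_{\overline{i+1}}q^{k_i})$; $e_ie_{\bar i}=e_{\bar i}e_i$, $f_if_{\bar i}=f_{\bar i}f_i$; $e_ie_{i+1}-qe_{i+1}e_i=e_{\bar i}e_{\overline{i+1}}+qe_{\overline{i+1}}e_{\bar i}$, $qf_{i+1}f_i-f_if_{i+1}=f_{\bar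 i}f_{\overline{i+1}}+qf_{\overline{i+1}}f_{\bar i}$. The algebra $U$ is generated by $q^h,e_i,f_i,k_{\bar1}$. It acts on a tensor product of supermodules through the comultiplication $$\Delta(q^h)=q^h\otimes q^h,\quad \Delta(e_i)=e_i\otimes q^{-h_i}+1\otimes e_i,\quad \Delta(f_i)=f_i\otimes1+q^{h_i}\otimes f_i,\quad \Delta(k_{\bar1})=k_{\bar1}\otimes q^{k_1}+q^{-k_1}\otimes k_{\bar1},$$ with the sign rule $(x\otimes y)(u\otimes v)=(-1)^{|y||u|}xu\otimes yv$. All modules, and all subspaces and $\mathbf A$-submodules $L$, $l_b$ below, are $\mathbb Z/2$-graded. $\mathcal O^{\ge0}_{int}$ is the category of finite-dimensional $U$-supermodules $M=\bigoplus_{\mu\in P^{\ge0}}M_\mu$ ($q^h=q^{\mu(h)}$ on $M_\mu$) such that $k_{\bar i}M_\mu=0$ whenever $\langle k_i,\mu\rangle=0$. **Kashiwara operators.** If $u\in M_\lambda$ is written as $u=\sum_kf_i^{(k)}u_k$ with $u_k\in M_{\lambda+k\alpha_i}$, $e_iu_k=0$ and $u_k=0$ unless $0\le k\le\langle h_i,\lambda+k\alpha_i\rangle$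 (here $f_i^{(k)}=f_i^k/[k]!$), put $\tilde e_iu=\sum_{k\ge1}f_i^{(k-1)}u_k$ and $\tilde f_iu=\sum_{k\ge0}f_i^{(k+1)}u_k$. Put $\tilde k_{\bar1}=q^{k_1-1}k_{\bar1}$, $\tilde e_{\bar1}=-(e_1k_{\bar1}-qk_{\bar1}e_1)q^{k_1-1}$, $\tilde f_{\bar1}=-(k_{\bar1}f_1-qf_1k_{\bar1})q^{k_2-1}$. **Crystal bases.** A $\mathfrak{gl}(n)$-crystal is an abstract $\mathfrak{gl}(n)$-crystal $(B,\mathrm{wt},\varepsilon_i,\varphi_i,\tilde e_i,\tilde f_i)$ that is realized as a crystal basis of a finite-dimensional integrable $U_q(\mathfrak{gl}(n))$-module. A crystal basis of $M\in\mathcal O^{\ge0}_{int}$ is a triple $(L,B,(l_b)_{b\in B})$ such that (a) $L\subset M$ is a free $\mathbf A$-submodule with $\mathbf F\otimes_{\mathbf A}L\cong M$ and $L=\bigoplus_{\mu\in P^{\ge0}}(L\cap M_\mu)$, stable under $\tilde e_i,\tilde f_i$ $(1\le i\le n-1)$, $\tilde k_{\bar1},\tilde e_{\bar1},\tilde f_{\bar1}$;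 (b) $B$ is a $\mathfrak{gl}(n)$-crystal with maps $\tilde e_{\bar1},\tilde f_{\bar1}:B\to B\sqcup\{0\}$ such that $\mathrm{wt}(\tilde e_{\bar1}b)=\mathrm{wt}\,b+\alpha_1$ if $\tilde e_{\bar1}b\ne0$, $\mathrm{wt}(\tilde f_{\bar1}b)=\mathrm{wt}\,b-\alpha_1$ if $\tilde f_{\bar1}b\ne0$, and $\tilde f_{\bar1}b=b'$ if and only if $b=\tilde e_{\bar1}b'$ $(b,b'\in B)$; (c) the $l_b$ are nonzero $\mathbb C$-subspaces of $L/qL$ with $l_b\subset(L/qL)_{\mathrm{wt}\,b}$, $L/qL=\bigoplus_{b\in B}l_b$, $\tilde k_{\bar1}l_b\subset l_b$, and for $i=1,\dots,n-1,\bar1$: if $\tilde e_ib=0$ then $\tilde e_il_b=0$, and otherwise $\tilde e_i$ induces an isomorphism $l_b\cong l_{\tilde e_ib}$; likewise for $\tilde f_i$. **Theorem.** Let $M_1,M_2\in\mathcal O^{\ge0}_{int}$ have crystal bases $(L_j,B_j,l_{B_j})$, $j=1,2$. Then $M_1\otimes_{\mathbf F}M_2$ lies in $\mathcal O^{\ge0}_{int}$,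 and $(L_1\otimes_{\mathbf A}L_2,\;B_1\times B_2,\;(l_{b_1}\otimes l_{b_2})_{(b_1,b_2)})$ is a crystal basis of $M_1\otimes_{\mathbf F}M_2$, where, writing $b_1\otimes b_2$ for $(b_1,b_2)$, the crystal structure of $B_1\times B_2$ is given by $\mathrm{wt}(b_1\otimes b_2)=\mathrm{wt}\,b_1+\mathrm{wt}\,b_2$, $\varepsilon_i(b_1\otimes b_2)=\max(\varepsilon_i(b_1),\varepsilon_i(b_2)-\langle h_i,\mathrm{wt}\,b_1\rangle)$, $\varphi_i(b_1\otimes b_2)=\max(\varphi_i(b_2),\varphi_i(b_1)+\langle h_i,\mathrm{wt}\,b_2\rangle)$ and $$\tilde e_i(b_1\otimes b_2)=\begin{cases}\tilde e_ib_1\otimes b_2&\varphi_i(b_1)\ge\varepsilon_i(b_2),\\ b_1\otimes\tilde e_ib_2&\varphi_i(b_1)<\varepsilon_i(b_2),\end{cases}\qquad \tilde f_i(b_1\otimes b_2)=\begin{cases}\tilde f_ib_1\otimes b_2&\varphi_i(b_1)>\varepsilon_i(b_2),\\ b_1\otimes\tilde f_ib_2&\varphi_i(b_1)\le\varepsilon_i(b_2)\end{cases}$$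 for $1\le i\le n-1$, while for $\tilde x\in\{\tilde e_{\bar1},\tilde f_{\bar1}\}$ $$\tilde x(b_1\otimes b_2)=\begin{cases}\tilde xb_1\otimes b_2&\text{if }\langle k_1,\mathrm{wt}\,b_2\rangle=\langle k_2,\mathrm{wt}\,b_2\rangle=0,\\ b_1\otimes\tilde xb_2&\text{otherwise.}\end{cases}$$ -/

import Mathlib

open scoped TensorProduct

noncomputable section

namespace QueerCrystal

/-- The base field `𝐅 = ℂ((q))`. -/
abbrev Fq : Type := LaurentSeries ℂ

/-- The subring `𝐀 = ℂ[[q]]`. -/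
abbrev Aq : Type := PowerSeries ℂ

/-- The indeterminate `q` as an element of `𝐅`. -/
def q : Fq := HahnSeries.single 1 1

/-- The `q`-integer `[k]`. -/
def qInt (k : ℕ) : Fq := (q ^ (k : ℤ) - q ^ (-(k : ℤ))) / (q - q⁻¹)

/-- The `q`-factorial `[k]! = [k][k-1]⋯[1]`. -/
def qFact (k : ℕ) : Fq := ∏ j ∈ Finset.range k, qInt (j + 1)

/-! Throughout `n = r + 1` with `r ≥ 1`, so that `n ≥ 2`.  The index set `{1, …, n}` is
`Fin (r + 1)` and the index set `I = {1, …, n - 1}` is `Fin r`: for `i : Fin r` the indices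
`i` and `i + 1` of `{1, …, n}` are `i.castSucc` and `i.succ`. -/

/-- The lattice `P^∨ = ℤ k_1 ⊕ ⋯ ⊕ ℤ k_n`, and also the weight lattice
`P = ℤ ε_1 ⊕ ⋯ ⊕ ℤ ε_n`; the pairing `⟨h, μ⟩` is the dot product. -/
abbrev Lat (r : ℕ) : Type := Fin (r + 1) → ℤ

/-- The pairing `⟨h, μ⟩ = μ(h)`. -/
def pair {r : ℕ} (h μ : Lat r) : ℤ := h ⬝ᵥ μ

/-- The basis element `k_j` of `P^∨`. -/
def kk {r : ℕ} (j : Fin (r + 1)) : Lat r := Pi.single j 1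

/-- The simple coroot `h_i = k_i - k_{i+1}`. -/
def hh {r : ℕ} (i : Fin r) : Lat r := kk i.castSucc - kk i.succ

/-- The simple root `α_i = ε_i - ε_{i+1}`. -/
def alpha {r : ℕ} (i : Fin r) : Lat r := Pi.single i.castSucc 1 - Pi.single i.succ 1

/-! ### The quantum queer superalgebra `U_q(𝔮(n))` and `U_q(𝔤𝔩(n))` -/

/-- The generators `e_i, f_i, e_{ī}, f_{ī}, q^h, k_{j̄}`. -/
inductive QGen (r : ℕ) : Type
  | e (i : Fin r) : QGen r
  | f (i : Fin r) : QGen r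
  | ebar (i : Fin r) : QGen r
  | fbar (i : Fin r) : QGen r
  | qpow (h : Lat r) : QGen r
  | kbar (j : Fin (r + 1)) : QGen r

namespace QGen

variable {r : ℕ}

/-- `e_i` in the free algebra. -/
def E (i : Fin r) : FreeAlgebra Fq (QGen r) := FreeAlgebra.ι Fq (e i)
/-- `f_i` in the free algebra. -/
def F (i : Fin r) : FreeAlgebra Fq (QGen r) := FreeAlgebra.ι Fq (f i)
/-- `e_{ī}` in the free algebra. -/
def Eb (i : Fin r) : FreeAlgebra Fq (QGen r) := FreeAlgebra.ι Fq (ebar i)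
/-- `f_{ī}` in the free algebra. -/
def Fb (i : Fin r) : FreeAlgebra Fq (QGen r) := FreeAlgebra.ι Fq (fbar i)
/-- `q^h` in the free algebra. -/
def Q (h : Lat r) : FreeAlgebra Fq (QGen r) := FreeAlgebra.ι Fq (qpow h)
/-- `k_{j̄}` in the free algebra. -/
def Kb (j : Fin (r + 1)) : FreeAlgebra Fq (QGen r) := FreeAlgebra.ι Fq (kbar j)

end QGen

open QGen in
/-- The defining relations of `U_q(𝔮(n))`. -/
inductive QRel (r : ℕ) : FreeAlgebra Fq (QGen r) → FreeAlgebra Fq (QGen r) → Prop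
  | q_zero : QRel r (Q 0) 1
  | q_add (h₁ h₂ : Lat r) : QRel r (Q h₁ * Q h₂) (Q (h₁ + h₂))
  | q_e (h : Lat r) (i : Fin r) :
      QRel r (Q h * E i * Q (-h)) (q ^ pair h (alpha i) • E i)
  | q_f (h : Lat r) (i : Fin r) :
      QRel r (Q h * F i * Q (-h)) (q ^ (-pair h (alpha i)) • F i)
  | q_kbar (h : Lat r) (j : Fin (r + 1)) : QRel r (Q h * Kb j) (Kb j * Q h)
  | e_f (i j : Fin r) :
      QRel r (E i * F j - F j * E i)
        (if i = j then (q - q⁻¹)⁻¹ • (Q (hh i) - Q (-hh i)) else 0)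
  | e_e (i j : Fin r) (hij : i.val + 1 < j.val ∨ j.val + 1 < i.val) :
      QRel r (E i * E j - E j * E i) 0
  | f_f (i j : Fin r) (hij : i.val + 1 < j.val ∨ j.val + 1 < i.val) :
      QRel r (F i * F j - F j * F i) 0
  | serre_e (i j : Fin r) (hij : i.val + 1 = j.val ∨ j.val + 1 = i.val) :
      QRel r (E i ^ 2 * E j - (q + q⁻¹) • (E i * E j * E i) + E j * E i ^ 2) 0
  | serre_f (i j : Fin r) (hij : i.val + 1 = j.val ∨ j.val + 1 = i.val) :
      QRel r (F i ^ 2 * F j - (q + q⁻¹) • (F i * F j * F i) + F j * F i ^ 2) 0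
  | kbar_sq (j : Fin (r + 1)) :
      QRel r (Kb j ^ 2)
        ((q ^ 2 - (q ^ 2)⁻¹)⁻¹ • (Q ((2 : ℤ) • kk j) - Q (-((2 : ℤ) • kk j))))
  | kbar_kbar (i j : Fin (r + 1)) (hij : i ≠ j) : QRel r (Kb i * Kb j + Kb j * Kb i) 0
  | kbar_e (i : Fin r) :
      QRel r (Kb i.castSucc * E i - q • (E i * Kb i.castSucc)) (Eb i * Q (-kk i.castSucc))
  | kbar_f (i : Fin r) :
      QRel r (Kb i.castSucc * F i - q • (F i * Kb i.castSucc)) (-(Fb i * Q (kk i.castSucc)))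
  | e_fbar (i j : Fin r) :
      QRel r (E i * Fb j - Fb j * E i)
        (if i = j then Kb i.castSucc * Q (-kk i.succ) - Kb i.succ * Q (-kk i.castSucc) else 0)
  | ebar_f (i j : Fin r) :
      QRel r (Eb i * F j - F j * Eb i)
        (if i = j then Kb i.castSucc * Q (kk i.succ) - Kb i.succ * Q (kk i.castSucc) else 0)
  | e_ebar (i : Fin r) : QRel r (E i * Eb i - Eb i * E i) 0
  | f_fbar (i : Fin r) : QRel r (F i * Fb i - Fb i * F i) 0
  | e_e_succ (i j : Fin r) (hij : i.val + 1 = j.val) :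
      QRel r (E i * E j - q • (E j * E i)) (Eb i * Eb j + q • (Eb j * Eb i))
  | f_f_succ (i j : Fin r) (hij : i.val + 1 = j.val) :
      QRel r (q • (F j * F i) - F i * F j) (Fb i * Fb j + q • (Fb j * Fb i))
  | serre_ebar (i j : Fin r) (hij : i.val + 1 = j.val ∨ j.val + 1 = i.val) :
      QRel r (E i ^ 2 * Eb j - (q + q⁻¹) • (E i * Eb j * E i) + Eb j * E i ^ 2) 0
  | serre_fbar (i j : Fin r) (hij : i.val + 1 = j.val ∨ j.val + 1 = i.val) :
      QRel r (F i ^ 2 * Fb j - (q + q⁻¹) • (F i * Fb j * F i) + Fb j * F i ^ 2) 0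

/-- The quantum queer superalgebra `U_q(𝔮(n))`, `n = r + 1`. -/
abbrev Uq (r : ℕ) : Type := RingQuot (QRel r)

/-- The class of a generator in `U_q(𝔮(n))`. -/
def Uq.gen {r : ℕ} (g : QGen r) : Uq r := RingQuot.mkAlgHom Fq (QRel r) (FreeAlgebra.ι Fq g)

/-- The generators of `U_q(𝔤𝔩(n))`. -/
inductive GlGen (r : ℕ) : Type
  | e (i : Fin r) : GlGen r
  | f (i : Fin r) : GlGen r
  | qpow (h : Lat r) : GlGen r

namespace GlGen

variable {r : ℕ}

/-- `e_i` in the free algebra. -/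
def E (i : Fin r) : FreeAlgebra Fq (GlGen r) := FreeAlgebra.ι Fq (e i)
/-- `f_i` in the free algebra. -/
def F (i : Fin r) : FreeAlgebra Fq (GlGen r) := FreeAlgebra.ι Fq (f i)
/-- `q^h` in the free algebra. -/
def Q (h : Lat r) : FreeAlgebra Fq (GlGen r) := FreeAlgebra.ι Fq (qpow h)

end GlGen

open GlGen in
/-- The defining relations of `U_q(𝔤𝔩(n))`. -/
inductive GlRel (r : ℕ) : FreeAlgebra Fq (GlGen r) → FreeAlgebra Fq (GlGen r) → Prop
  | q_zero : GlRel r (Q 0) 1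
  | q_add (h₁ h₂ : Lat r) : GlRel r (Q h₁ * Q h₂) (Q (h₁ + h₂))
  | q_e (h : Lat r) (i : Fin r) :
      GlRel r (Q h * E i * Q (-h)) (q ^ pair h (alpha i) • E i)
  | q_f (h : Lat r) (i : Fin r) :
      GlRel r (Q h * F i * Q (-h)) (q ^ (-pair h (alpha i)) • F i)
  | e_f (i j : Fin r) :
      GlRel r (E i * F j - F j * E i)
        (if i = j then (q - q⁻¹)⁻¹ • (Q (hh i) - Q (-hh i)) else 0)
  | e_e (i j : Fin r) (hij : i.val + 1 < j.val ∨ j.val + 1 < i.val) :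
      GlRel r (E i * E j - E j * E i) 0
  | f_f (i j : Fin r) (hij : i.val + 1 < j.val ∨ j.val + 1 < i.val) :
      GlRel r (F i * F j - F j * F i) 0
  | serre_e (i j : Fin r) (hij : i.val + 1 = j.val ∨ j.val + 1 = i.val) :
      GlRel r (E i ^ 2 * E j - (q + q⁻¹) • (E i * E j * E i) + E j * E i ^ 2) 0
  | serre_f (i j : Fin r) (hij : i.val + 1 = j.val ∨ j.val + 1 = i.val) :
      GlRel r (F i ^ 2 * F j - (q + q⁻¹) • (F i * F j * F i) + F j * F i ^ 2) 0

/-- The quantum group `U_q(𝔤𝔩(n))`, `n = r + 1`. -/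
abbrev UqGl (r : ℕ) : Type := RingQuot (GlRel r)

/-- The class of a generator in `U_q(𝔤𝔩(n))`. -/
def UqGl.gen {r : ℕ} (g : GlGen r) : UqGl r :=
  RingQuot.mkAlgHom Fq (GlRel r) (FreeAlgebra.ι Fq g)

/-! ### Operators and modules -/

/-- The family `V` of submodules decomposes the module as a direct sum. -/
def IsDirectSum {R M ι : Type*} [Semiring R] [AddCommMonoid M] [Module R M]
    (V : ι → Submodule R M) : Prop :=
  iSupIndep V ∧ ⨆ i, V i = ⊤

/-- Operators by which `q^h`, `e_i`, `f_i` act on a vector space `M`. -/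
structure GlOps (r : ℕ) (M : Type*) [AddCommGroup M] [Module Fq M] where
  /-- the action of `q^h` -/
  K : Lat r → Module.End Fq M
  /-- the action of `e_i` -/
  e : Fin r → Module.End Fq M
  /-- the action of `f_i` -/
  f : Fin r → Module.End Fq M

/-- Operators by which `q^h`, `e_i`, `f_i`, `k_{1̄}` act on a super vector space `M`, together
with the parity operator `σ` of `M`.  The elements `q^h`, `e_i`, `f_i`, `k_{1̄}` generate
`U_q(𝔮(n))`, and they are the only ones that enter the Kashiwara operators. -/
structure QOps (r : ℕ) (M : Type*) [AddCommGroup M] [Module Fq M] extends GlOps r M where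
  /-- the action of `k_{1̄}` -/
  k1 : Module.End Fq M
  /-- the parity operator: `+1` on the even part, `-1` on the odd part -/
  σ : Module.End Fq M

/-- A `U_q(𝔮(n))`-supermodule structure on `M`.  The `ℤ/2`-grading is given by the parity
operator `σ`, an involution which is `1` on the even part and `-1` on the odd part. -/
structure SuperRep (r : ℕ) (M : Type*) [AddCommGroup M] [Module Fq M] where
  /-- the action of `U_q(𝔮(n))` -/
  ρ : Uq r →ₐ[Fq] Module.End Fq M
  /-- the parity operator -/
  σ : Module.End Fq M
  σ_sq : σ * σ = 1
  σ_q : ∀ h, σ * ρ (Uq.gen (.qpow h)) = ρ (Uq.gen (.qpow h)) * σ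
  σ_e : ∀ i, σ * ρ (Uq.gen (.e i)) = ρ (Uq.gen (.e i)) * σ
  σ_f : ∀ i, σ * ρ (Uq.gen (.f i)) = ρ (Uq.gen (.f i)) * σ
  σ_ebar : ∀ i, σ * ρ (Uq.gen (.ebar i)) = -(ρ (Uq.gen (.ebar i)) * σ)
  σ_fbar : ∀ i, σ * ρ (Uq.gen (.fbar i)) = -(ρ (Uq.gen (.fbar i)) * σ)
  σ_kbar : ∀ j, σ * ρ (Uq.gen (.kbar j)) = -(ρ (Uq.gen (.kbar j)) * σ)

section Modules

variable {r : ℕ} {M : Type*} [AddCommGroup M] [Module Fq M]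

/-- The weight space `M_μ`. -/
def GlOps.weightSpace (O : GlOps r M) (μ : Lat r) : Submodule Fq M :=
  ⨅ h : Lat r, LinearMap.ker (O.K h - q ^ pair h μ • (1 : Module.End Fq M))

/-- `M = ⊕_{μ ∈ P} M_μ`. -/
def GlOps.IsWeightModule (O : GlOps r M) : Prop := IsDirectSum O.weightSpace

/-- The operators of a `U_q(𝔤𝔩(n))`-module. -/
def glOps (ρ : UqGl r →ₐ[Fq] Module.End Fq M) : GlOps r M where
  K h := ρ (UqGl.gen (.qpow h))
  e i := ρ (UqGl.gen (.e i))
  f i := ρ (UqGl.gen (.f i))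

/-- The operators by which the generators `q^h`, `e_i`, `f_i`, `k_{1̄}` act. -/
def SuperRep.ops (R : SuperRep r M) : QOps r M where
  K h := R.ρ (Uq.gen (.qpow h))
  e i := R.ρ (Uq.gen (.e i))
  f i := R.ρ (Uq.gen (.f i))
  k1 := R.ρ (Uq.gen (.kbar 0))
  σ := R.σ

/-- Membership in the category `𝒪_int^{≥0}`. -/
structure SuperRep.InOint (R : SuperRep r M) : Prop where
  finite : Module.Finite Fq M
  weight : R.ops.IsWeightModule
  nonneg : ∀ μ, R.ops.weightSpace μ ≠ ⊥ → 0 ≤ μ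
  kbar : ∀ μ : Lat r, 0 ≤ μ → ∀ j, pair (kk j) μ = 0 →
    ∀ u ∈ R.ops.weightSpace μ, R.ρ (Uq.gen (.kbar j)) u = 0

end Modules

/-- The action of the generators on `M₁ ⊗ M₂` through the comultiplication
`Δ(q^h) = q^h ⊗ q^h`, `Δ(e_i) = e_i ⊗ q^{-h_i} + 1 ⊗ e_i`, `Δ(f_i) = f_i ⊗ 1 + q^{h_i} ⊗ f_i`,
`Δ(k_{1̄}) = k_{1̄} ⊗ q^{k_1} + q^{-k_1} ⊗ k_{1̄}`.  The odd operator `k_{1̄}` passes the first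
factor with the Koszul sign, which is the parity operator of the first factor. -/
def QOps.tensor {r : ℕ} {M₁ M₂ : Type*} [AddCommGroup M₁] [Module Fq M₁]
    [AddCommGroup M₂] [Module Fq M₂] (O₁ : QOps r M₁) (O₂ : QOps r M₂) :
    QOps r (M₁ ⊗[Fq] M₂) where
  K h := TensorProduct.map (O₁.K h) (O₂.K h)
  e i := TensorProduct.map (O₁.e i) (O₂.K (-hh i)) + TensorProduct.map 1 (O₂.e i)
  f i := TensorProduct.map (O₁.f i) 1 + TensorProduct.map (O₁.K (hh i)) (O₂.f i)
  k1 := TensorProduct.map O₁.k1 (O₂.K (kk 0))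
    + TensorProduct.map (O₁.K (-kk 0) * O₁.σ) O₂.k1
  σ := TensorProduct.map O₁.σ O₂.σ

/-! ### Kashiwara operators -/

section Kashiwara

variable {r : ℕ} {M : Type*} [AddCommGroup M] [Module Fq M]

/-- The divided power `T^{(k)} = T^k / [k]!`. -/
def divPow (T : Module.End Fq M) (k : ℕ) : Module.End Fq M := (qFact k)⁻¹ • T ^ k

/-- `(u_k)_k` are the components of an `i`-string decomposition `∑_k f_i^{(k)} u_k` of a vector
of weight `μ`: `u_k` has weight `μ + k α_i`, `e_i u_k = 0`, and `u_k` occurs only for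
`k ≤ ⟨h_i, μ + k α_i⟩`, that is, only where `f_i^{(k)}` does not kill it. -/
def GlOps.IsString (O : GlOps r M) (i : Fin r) (μ : Lat r) (u : ℕ →₀ M) : Prop :=
  ∀ k : ℕ, u k ∈ O.weightSpace (μ + (k : ℤ) • alpha i) ∧ O.e i (u k) = 0 ∧
    (u k ≠ 0 → (k : ℤ) ≤ pair (hh i) (μ + (k : ℤ) • alpha i))

/-- `T` maps `∑_{k ≥ 0} f_i^{(k)} u_k` to `∑_{k ≥ 1} f_i^{(k-1)} u_k`. -/
def GlOps.IsTildeE (O : GlOps r M) (i : Fin r) (T : Module.End Fq M) : Prop :=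
  ∀ μ u, O.IsString i μ u →
    T (u.sum fun k v => divPow (O.f i) k v) =
      u.sum fun k v => if k = 0 then 0 else divPow (O.f i) (k - 1) v

/-- `T` maps `∑_{k ≥ 0} f_i^{(k)} u_k` to `∑_{k ≥ 0} f_i^{(k+1)} u_k`. -/
def GlOps.IsTildeF (O : GlOps r M) (i : Fin r) (T : Module.End Fq M) : Prop :=
  ∀ μ u, O.IsString i μ u →
    T (u.sum fun k v => divPow (O.f i) k v) = u.sum fun k v => divPow (O.f i) (k + 1) v

open Classical in
/-- The even Kashiwara operator `ẽ_i`.  On a finite-dimensional weight module every weight vector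
has exactly one string decomposition, so that the operator exists and is unique. -/
def GlOps.tildeE (O : GlOps r M) (i : Fin r) : Module.End Fq M :=
  if h : ∃ T, O.IsTildeE i T then h.choose else 0

open Classical in
/-- The even Kashiwara operator `f̃_i`. -/
def GlOps.tildeF (O : GlOps r M) (i : Fin r) : Module.End Fq M :=
  if h : ∃ T, O.IsTildeF i T then h.choose else 0

/-- The odd Kashiwara operator `k̃_{1̄} = q^{k_1 - 1} k_{1̄}`. -/
def QOps.tildeK1 (O : QOps r M) : Module.End Fq M := q⁻¹ • (O.K (kk 0) * O.k1)

/-- The odd Kashiwara operator `ẽ_{1̄} = -(e_1 k_{1̄} - q k_{1̄} e_1) q^{k_1 - 1}`. -/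
def QOps.tildeE1 [NeZero r] (O : QOps r M) : Module.End Fq M :=
  -((O.e 0 * O.k1 - q • (O.k1 * O.e 0)) * (q⁻¹ • O.K (kk 0)))

/-- The odd Kashiwara operator `f̃_{1̄} = -(k_{1̄} f_1 - q f_1 k_{1̄}) q^{k_2 - 1}`. -/
def QOps.tildeF1 [NeZero r] (O : QOps r M) : Module.End Fq M :=
  -((O.k1 * O.f 0 - q • (O.f 0 * O.k1)) * (q⁻¹ • O.K (kk (0 : Fin r).succ)))

end Kashiwara

/-! ### Crystals -/

/-- The data of a crystal: `none` plays the role of `0` in `B ⊔ {0}`, and `⊥` that of `-∞`. -/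
structure GlCrystal (r : ℕ) (B : Type*) where
  wt : B → Lat r
  eps : Fin r → B → WithBot ℤ
  phi : Fin r → B → WithBot ℤ
  e : Fin r → B → Option B
  f : Fin r → B → Option B

/-- The data of a `𝔤𝔩(n)`-crystal together with maps `ẽ_{1̄}, f̃_{1̄} : B → B ⊔ {0}`. -/
structure QCrystal (r : ℕ) (B : Type*) extends GlCrystal r B where
  e1 : B → Option B
  f1 : B → Option B

/-- `m`-fold iteration of a map `B → B ⊔ {0}`, extended by `0 ↦ 0`. -/
def iter {B : Type*} (g : B → Option B) : ℕ → B → Option B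
  | 0, b => some b
  | m + 1, b => (iter g m b).bind g

/-- The axioms of an abstract `𝔤𝔩(n)`-crystal. -/
structure GlCrystal.IsAbstract {r : ℕ} {B : Type*} (C : GlCrystal r B) : Prop where
  wt_e : ∀ i b b', C.e i b = some b' → C.wt b' = C.wt b + alpha i
  wt_f : ∀ i b b', C.f i b = some b' → C.wt b' = C.wt b - alpha i
  phi_eq : ∀ i b, C.phi i b = C.eps i b + (pair (hh i) (C.wt b) : ℤ)
  f_iff_e : ∀ i b b', C.f i b = some b' ↔ C.e i b' = some b
  eps_e : ∀ i b b', C.e i b = some b' → C.eps i b' = C.eps i b + (-1 : ℤ)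
  phi_e : ∀ i b b', C.e i b = some b' → C.phi i b' = C.phi i b + (1 : ℤ)
  eps_f : ∀ i b b', C.f i b = some b' → C.eps i b' = C.eps i b + (1 : ℤ)
  phi_f : ∀ i b b', C.f i b = some b' → C.phi i b' = C.phi i b + (-1 : ℤ)
  bot : ∀ i b, C.phi i b = ⊥ → C.e i b = none ∧ C.f i b = none

/-! ### Lattices and their reduction at `q = 0` -/

section Lattices

variable {r : ℕ} {M : Type*} [AddCommGroup M] [Module Fq M] [Module Aq M] [IsScalarTower Aq Fq M]

/-- The submodule `qL` of `L`. -/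
def qSub (L : Submodule Aq M) : Submodule Aq L :=
  LinearMap.range (LinearMap.lsmul Aq L PowerSeries.X)

/-- The quotient `L/qL`.  As `q` acts on it by `0` and `𝐀/q𝐀 = ℂ`, its `ℂ`-subspaces are its
`𝐀`-submodules, and `ℂ`-linear maps are `𝐀`-linear maps. -/
abbrev Red (L : Submodule Aq M) : Type _ := L ⧸ qSub L

/-- `L` is stable under the operator `T`. -/
def Stable (L : Submodule Aq M) (T : Module.End Fq M) : Prop := ∀ u ∈ L, T u ∈ L

/-- The operator on `L/qL` induced by an operator `T` under which `L` is stable. -/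
def redMap {L : Submodule Aq M} {T : Module.End Fq M} (hT : Stable L T) : Red L →ₗ[Aq] Red L :=
  Submodule.mapQ (qSub L) (qSub L) ((T.restrictScalars Aq).restrict hT) (by
    rintro _ ⟨y, rfl⟩
    exact ⟨(T.restrictScalars Aq).restrict hT y, by simp⟩)

/-- `L_μ = L ∩ M_μ`, as a submodule of `L`. -/
def latticeWeight (O : GlOps r M) (L : Submodule Aq M) (μ : Lat r) : Submodule Aq L :=
  ((O.weightSpace μ).restrictScalars Aq).comap L.subtype

/-- The weight space `(L/qL)_μ`, the image of `L_μ`. -/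
def redWeight (O : GlOps r M) (L : Submodule Aq M) (μ : Lat r) : Submodule Aq (Red L) :=
  (latticeWeight O L μ).map (qSub L).mkQ

/-- `L` is a free `𝐀`-lattice of `M` with `𝐅 ⊗_𝐀 L ≅ M` and `L = ⊕_{μ ∈ S} L_μ`, stable under the
even Kashiwara operators. -/
structure IsCrystalLattice (O : GlOps r M) (S : Set (Lat r)) (L : Submodule Aq M) : Prop where
  free : Module.Free Aq L
  base : IsBaseChange Fq L.subtype
  weight : IsDirectSum fun μ : S => latticeWeight O L μ
  e_stable : ∀ i, Stable L (O.tildeE i)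
  f_stable : ∀ i, Stable L (O.tildeF i)

/-- `(L, B)` is a crystal basis of a `U_q(𝔤𝔩(n))`-module, where `C` is the crystal structure of `B`
and `β` is the inclusion of `B` into `L/qL`. -/
structure IsGlCrystalBasis {B : Type*} (O : GlOps r M) (L : Submodule Aq M) (C : GlCrystal r B)
    (β : B → Red L) : Prop where
  lattice : IsCrystalLattice O Set.univ L
  /-- the elements of `B` form a `ℂ`-basis of `L/qL`: they are nonzero, and `L/qL` is the direct
  sum of the lines they span -/
  ne_zero : ∀ b, β b ≠ 0
  basis : IsDirectSum fun b => Submodule.span Aq {β b}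
  wt_mem : ∀ b, β b ∈ redWeight O L (C.wt b)
  map_e : ∀ i b, redMap (lattice.e_stable i) (β b) = (C.e i b).elim 0 β
  map_f : ∀ i b, redMap (lattice.f_stable i) (β b) = (C.f i b).elim 0 β
  eps_eq : ∀ i b, ∃ m : ℕ, C.eps i b = ((m : ℤ) : WithBot ℤ) ∧
    IsGreatest {k : ℕ | iter (C.e i) k b ≠ none} m
  phi_eq : ∀ i b, ∃ m : ℕ, C.phi i b = ((m : ℤ) : WithBot ℤ) ∧
    IsGreatest {k : ℕ | iter (C.f i) k b ≠ none} m

/-- A `𝔤𝔩(n)`-crystal: an abstract `𝔤𝔩(n)`-crystal that is realized as a crystal basis of a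
finite-dimensional integrable `U_q(𝔤𝔩(n))`-module.  (A finite-dimensional weight module is
integrable, as `e_i` and `f_i` are then nilpotent; as a vector space it may be taken to be
`𝐅^d`.) -/
def GlCrystal.IsGlCrystal {B : Type*} (C : GlCrystal r B) : Prop :=
  C.IsAbstract ∧
    ∃ (d : ℕ) (ρ : UqGl r →ₐ[Fq] Module.End Fq (Fin d → Fq)) (L : Submodule Aq (Fin d → Fq))
      (β : B → Red L), (glOps ρ).IsWeightModule ∧ IsGlCrystalBasis (glOps ρ) L C β

/-- If `b' = 0`, then `T` is zero on `l_b`; otherwise `T` induces an isomorphism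
`l_b ≅ l_{b'}`. -/
def InducesArrow {B : Type*} {L : Submodule Aq M} {T : Module.End Fq M} (hT : Stable L T)
    (l : B → Submodule Aq (Red L)) (b : B) (b' : Option B) : Prop :=
  match b' with
  | none => ∀ x ∈ l b, redMap hT x = 0
  | some b' => Set.BijOn (redMap hT) (l b) (l b')

/-- `(L, B, (l_b)_{b ∈ B})` is a crystal basis of the module on which the generators act by `O`,
where `C` is the crystal structure of `B`.  As everywhere in the theory of supermodules, subspaces
are understood to be `ℤ/2`-graded, i.e. stable under the parity operator. -/
structure IsCrystalBasis [NeZero r] {B : Type*} (O : QOps r M) (L : Submodule Aq M)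
    (C : QCrystal r B) (l : B → Submodule Aq (Red L)) : Prop where
  lattice : IsCrystalLattice O.toGlOps {μ | 0 ≤ μ} L
  k1_stable : Stable L O.tildeK1
  e1_stable : Stable L O.tildeE1
  f1_stable : Stable L O.tildeF1
  parity_stable : Stable L O.σ
  glCrystal : C.toGlCrystal.IsGlCrystal
  wt_e1 : ∀ b b', C.e1 b = some b' → C.wt b' = C.wt b + alpha 0
  wt_f1 : ∀ b b', C.f1 b = some b' → C.wt b' = C.wt b - alpha 0
  f1_iff_e1 : ∀ b b', C.f1 b = some b' ↔ C.e1 b' = some b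
  ne_bot : ∀ b, l b ≠ ⊥
  le_weight : ∀ b, l b ≤ redWeight O.toGlOps L (C.wt b)
  directSum : IsDirectSum l
  parity_mem : ∀ b, ∀ x ∈ l b, redMap parity_stable x ∈ l b
  k1_mem : ∀ b, ∀ x ∈ l b, redMap k1_stable x ∈ l b
  arrow_e : ∀ i b, InducesArrow (lattice.e_stable i) l b (C.e i b)
  arrow_f : ∀ i b, InducesArrow (lattice.f_stable i) l b (C.f i b)
  arrow_e1 : ∀ b, InducesArrow e1_stable l b (C.e1 b)
  arrow_f1 : ∀ b, InducesArrow f1_stable l b (C.f1 b)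

end Lattices

/-! ### Tensor products -/

open Classical in
/-- The tensor product of crystals: the usual signature rule. -/
def GlCrystal.tensor {r : ℕ} {B₁ B₂ : Type*} (C₁ : GlCrystal r B₁) (C₂ : GlCrystal r B₂) :
    GlCrystal r (B₁ × B₂) where
  wt b := C₁.wt b.1 + C₂.wt b.2
  eps i b := max (C₁.eps i b.1) (C₂.eps i b.2 + (-pair (hh i) (C₁.wt b.1) : ℤ))
  phi i b := max (C₂.phi i b.2) (C₁.phi i b.1 + (pair (hh i) (C₂.wt b.2) : ℤ))
  e i b :=
    if C₁.phi i b.1 ≥ C₂.eps i b.2 then (C₁.e i b.1).map fun b₁ => (b₁, b.2)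
    else (C₂.e i b.2).map fun b₂ => (b.1, b₂)
  f i b :=
    if C₁.phi i b.1 > C₂.eps i b.2 then (C₁.f i b.1).map fun b₁ => (b₁, b.2)
    else (C₂.f i b.2).map fun b₂ => (b.1, b₂)

open Classical in
/-- The tensor product rule for crystals with odd arrows: `ẽ_{1̄}` and `f̃_{1̄}` act on the first
factor if `⟨k_1, wt b₂⟩ = ⟨k_2, wt b₂⟩ = 0`, and on the second factor otherwise. -/
def QCrystal.tensor {r : ℕ} [NeZero r] {B₁ B₂ : Type*} (C₁ : QCrystal r B₁)
    (C₂ : QCrystal r B₂) : QCrystal r (B₁ × B₂) where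
  toGlCrystal := C₁.toGlCrystal.tensor C₂.toGlCrystal
  e1 b :=
    if pair (kk 0) (C₂.wt b.2) = 0 ∧ pair (kk (0 : Fin r).succ) (C₂.wt b.2) = 0 then
      (C₁.e1 b.1).map fun b₁ => (b₁, b.2)
    else (C₂.e1 b.2).map fun b₂ => (b.1, b₂)
  f1 b :=
    if pair (kk 0) (C₂.wt b.2) = 0 ∧ pair (kk (0 : Fin r).succ) (C₂.wt b.2) = 0 then
      (C₁.f1 b.1).map fun b₁ => (b₁, b.2)
    else (C₂.f1 b.2).map fun b₂ => (b.1, b₂)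

section TensorLattice

variable {M₁ M₂ : Type*} [AddCommGroup M₁] [Module Fq M₁] [Module Aq M₁] [IsScalarTower Aq Fq M₁]
  [AddCommGroup M₂] [Module Fq M₂] [Module Aq M₂] [IsScalarTower Aq Fq M₂]

/-- `L₁ ⊗_𝐀 L₂` as an `𝐀`-submodule of `M₁ ⊗_𝐅 M₂`. -/
def tensorLattice (L₁ : Submodule Aq M₁) (L₂ : Submodule Aq M₂) :
    Submodule Aq (M₁ ⊗[Fq] M₂) :=
  Submodule.span Aq {w | ∃ u₁ ∈ L₁, ∃ u₂ ∈ L₂, w = u₁ ⊗ₜ[Fq] u₂}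

/-- The pure tensor `u₁ ⊗ u₂` as an element of `L₁ ⊗_𝐀 L₂`. -/
def tensorElt {L₁ : Submodule Aq M₁} {L₂ : Submodule Aq M₂} (u₁ : L₁) (u₂ : L₂) :
    tensorLattice L₁ L₂ :=
  ⟨(u₁ : M₁) ⊗ₜ[Fq] (u₂ : M₂), Submodule.subset_span ⟨u₁, u₁.2, u₂, u₂.2, rfl⟩⟩

/-- `l_{b₁ ⊗ b₂} = l_{b₁} ⊗ l_{b₂}` inside
`(L₁ ⊗ L₂)/q(L₁ ⊗ L₂) = (L₁/qL₁) ⊗ (L₂/qL₂)`. -/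
def tensorFiber {B₁ B₂ : Type*} {L₁ : Submodule Aq M₁} {L₂ : Submodule Aq M₂}
    (l₁ : B₁ → Submodule Aq (Red L₁)) (l₂ : B₂ → Submodule Aq (Red L₂)) (b : B₁ × B₂) :
    Submodule Aq (Red (tensorLattice L₁ L₂)) :=
  Submodule.span Aq {x | ∃ (u₁ : L₁) (u₂ : L₂), (qSub L₁).mkQ u₁ ∈ l₁ b.1 ∧
    (qSub L₂).mkQ u₂ ∈ l₂ b.2 ∧ x = (qSub (tensorLattice L₁ L₂)).mkQ (tensorElt u₁ u₂)}

end TensorLattice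

end QueerCrystal

end

/-! Everything is compared modulo `q`. For an even index `i` the operators `e_i, f_i` form a quantum
`sl₂`, so a weight vector is uniquely a sum of `f_i^{(k)} u_k` with highest weight vectors `u_k`,
and a lattice stable under `ẽ_i, f̃_i` contains the components of its vectors
(`TildeStable.string_mem`). This reduces the even rule to two strings, `t_{j,k} = f^{(j)} x ⊗
f^{(k)} y` with `0 ≤ j ≤ m`, `0 ≤ k ≤ n`. In degree `p ≤ min(m, n)` they span exactly one highest
weight vector up to scalar. Its coefficients are explicit, and their `q`-adic valuations show that
`f^{(s)}` of it is congruent to `t_{s,p}` as long as `s + p ≤ m`. From the corner `t_{m-p,p}` on,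
the string follows the second leg of a hook, the vectors `t_{m-p,k}` with `k ≥ p`. This is the same
computation with `e` and `f` interchanged, started from the lowest weight vector, and the two
normalisations agree modulo `q` because the legs meet at the corner (`TensorString.exists_hw`). The
hooks fill the rectangle, moving along them is the signature rule, and Nakayama's lemma turns the
congruences into stability of the lattice.

For crystals, an element of `l_b` with `ε_i(b) = c` is the class of `f_i^{(c)} x` for a highest
weight vector `x` of the lattice (`FiberCrystal.exists_highest`), so the case distinction for
strings becomes the one on `φ_i(b₁)` and `ε_i(b₂)`. The argument applies to the fibres `l_b` of a
queer crystal basis and equally to the lines spanned by an ordinary crystal basis; the latter shows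
that `B₁ × B₂` is again a `𝔤𝔩(n)`-crystal.

For the odd operators let `y` have weight `μ`. The coproduct gives exact formulas
(`QOps.tensor_tildeE1`, `QOps.tensor_tildeF1`), and since weights are nonnegative, string lengths
are bounded well enough to reduce them modulo `q`: `ẽ_{1̄}(x ⊗ y)` is `[μ₁ = μ₂ = 0] ẽ_{1̄} x ⊗ y -
[μ₁ = 0] k̃_{1̄} x ⊗ ẽ_1 y + σ x ⊗ ẽ_{1̄} y`, and for `f̃_{1̄}` the middle term is `-[μ₁ = 1]
k̃_{1̄} x ⊗ f̃_1 y`. Only the middle term disturbs the product rule. Where it matters, `ẽ_{1̄} =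
k̃_{1̄} ẽ_1`, respectively `f̃_{1̄} = f̃_1 k̃_{1̄}`, on `y`, so the operator is `1 ⊗ ẽ_1` or `1 ⊗
f̃_1` composed with `D = σ ⊗ k̃_{1̄} - k̃_{1̄} ⊗ 1`. As `σ` and `k̃_{1̄}` anticommute and `k̃_{1̄}²`
is `0` or `1` modulo `q`, `D²` is `1` or `2` on the fibres in question, and `D` is bijective there
(`IsTwist.bijOn`). The rule therefore holds for the subspaces `l_{b₁} ⊗ l_{b₂}`, although the image
of a pure tensor need not be pure.

Finally, weights add up in the tensor product, and the vanishing of `k_{1̄}` is visible in the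
coproduct. That of the other `k_{j̄}` follows by induction on `j` from the defining relations alone
(`SuperRep.kbar_eq_zero`). -/

open scoped TensorProduct

noncomputable section

set_option linter.unusedSectionVars false

namespace QueerCrystal

section

/-! ### `q`-integers and the `q`-adic filtration of `𝐅` -/

/-- The `q`-integer `[n]` of an integer `n`. -/
def qz (n : ℤ) : Fq := (q ^ n - q ^ (-n)) / (q - q⁻¹)

theorem algebraMap_X : algebraMap Aq Fq PowerSeries.X = q := by
  rw [LaurentSeries.coe_algebraMap, HahnSeries.ofPowerSeries_X]; rfl

theorem algebraMap_Aq_injective : Function.Injective (algebraMap Aq Fq) :=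
  IsFractionRing.injective Aq Fq

theorem q_ne_zero : q ≠ 0 := by
  rw [← algebraMap_X]
  exact (map_ne_zero_iff _ algebraMap_Aq_injective).2 PowerSeries.X_ne_zero

/-- `x ∈ q^k 𝐀`. -/
def ValGe (k : ℤ) (x : Fq) : Prop := ∃ a : Aq, x = q ^ k * algebraMap Aq Fq a

/-- `x ∈ q^k (1 + q𝐀)`. -/
def Lead (k : ℤ) (x : Fq) : Prop := ∃ a : Aq, x = q ^ k * (1 + q * algebraMap Aq Fq a)

theorem ValGe.zero (k : ℤ) : ValGe k 0 := ⟨0, by simp⟩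

theorem ValGe.add {k : ℤ} {x y : Fq} (hx : ValGe k x) (hy : ValGe k y) : ValGe k (x + y) := by
  obtain ⟨a, rfl⟩ := hx
  obtain ⟨b, rfl⟩ := hy
  exact ⟨a + b, by rw [map_add]; ring⟩

theorem ValGe.neg {k : ℤ} {x : Fq} (hx : ValGe k x) : ValGe k (-x) := by
  obtain ⟨a, rfl⟩ := hx
  exact ⟨-a, by rw [map_neg]; ring⟩

theorem ValGe.mul {k l : ℤ} {x y : Fq} (hx : ValGe k x) (hy : ValGe l y) :
    ValGe (k + l) (x * y) := by
  obtain ⟨a, rfl⟩ := hx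
  obtain ⟨b, rfl⟩ := hy
  exact ⟨a * b, by rw [map_mul, zpow_add₀ q_ne_zero]; ring⟩

theorem ValGe.mono {k l : ℤ} {x : Fq} (hx : ValGe l x) (h : k ≤ l) : ValGe k x := by
  obtain ⟨a, rfl⟩ := hx
  obtain ⟨d, hd⟩ := Int.le.dest h
  refine ⟨PowerSeries.X ^ d * a, ?_⟩
  rw [map_mul, map_pow, algebraMap_X, ← hd, zpow_add₀ q_ne_zero, zpow_natCast]; ring

theorem valGe_qpow (k : ℤ) : ValGe k (q ^ k) := ⟨1, by simp⟩

theorem valGe_algebraMap (a : Aq) : ValGe 0 (algebraMap Aq Fq a) := ⟨a, by simp⟩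

theorem ValGe.exists_eq {x : Fq} (hx : ValGe 0 x) : ∃ a : Aq, algebraMap Aq Fq a = x := by
  obtain ⟨a, rfl⟩ := hx
  exact ⟨a, by simp⟩

theorem ValGe.exists_eq_X_mul {x : Fq} (hx : ValGe 1 x) :
    ∃ a : Aq, algebraMap Aq Fq (PowerSeries.X * a) = x := by
  obtain ⟨a, rfl⟩ := hx
  exact ⟨a, by rw [map_mul, algebraMap_X, zpow_one]⟩

theorem lead_qpow (k : ℤ) : Lead k (q ^ k) := ⟨0, by simp⟩

theorem lead_one : Lead 0 1 := ⟨0, by simp⟩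

theorem Lead.mul {k l : ℤ} {x y : Fq} (hx : Lead k x) (hy : Lead l y) : Lead (k + l) (x * y) := by
  obtain ⟨a, rfl⟩ := hx
  obtain ⟨b, rfl⟩ := hy
  refine ⟨a + b + PowerSeries.X * (a * b), ?_⟩
  simp only [map_add, map_mul, algebraMap_X]
  rw [zpow_add₀ q_ne_zero]; ring

theorem Lead.valGe {k : ℤ} {x : Fq} (hx : Lead k x) : ValGe k x := by
  obtain ⟨a, rfl⟩ := hx
  exact ⟨1 + PowerSeries.X * a, by rw [map_add, map_mul, map_one, algebraMap_X]⟩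

theorem Lead.add {k : ℤ} {x y : Fq} (hx : Lead k x) (hy : ValGe (k + 1) y) : Lead k (x + y) := by
  obtain ⟨a, rfl⟩ := hx
  obtain ⟨b, rfl⟩ := hy
  refine ⟨a + b, ?_⟩
  rw [map_add, zpow_add₀ q_ne_zero, zpow_one]; ring

theorem Lead.ne_zero {k : ℤ} {x : Fq} (hx : Lead k x) : x ≠ 0 := by
  obtain ⟨a, rfl⟩ := hx
  refine mul_ne_zero (zpow_ne_zero _ q_ne_zero) ?_
  have : (1 : Fq) + q * algebraMap Aq Fq a = algebraMap Aq Fq (1 + PowerSeries.X * a) := by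
    rw [map_add, map_mul, map_one, algebraMap_X]
  rw [this, map_ne_zero_iff _ algebraMap_Aq_injective]
  intro h
  simpa using congrArg PowerSeries.constantCoeff h

/-- A power series with constant term `1` is a unit of `𝐀`, and its inverse `b` satisfies `b = 1 - q
a b`. -/
theorem Lead.inv {k : ℤ} {x : Fq} (hx : Lead k x) : Lead (-k) x⁻¹ := by
  have hne := hx.ne_zero
  obtain ⟨a, rfl⟩ := hx
  have hu : IsUnit (1 + PowerSeries.X * a : Aq) := by
    rw [PowerSeries.isUnit_iff_constantCoeff]; simp
  obtain ⟨b, hb⟩ := hu.exists_right_inv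
  refine ⟨-(a * b), ?_⟩
  have hb' : (1 + q * algebraMap Aq Fq a) * algebraMap Aq Fq b = 1 := by
    rw [← algebraMap_X, ← map_mul, ← map_one (algebraMap Aq Fq), ← map_add, ← map_mul, hb]
  refine (eq_inv_of_mul_eq_one_left ?_).symm
  rw [map_neg, map_mul]
  have h1 : q ^ (-k) * q ^ k = 1 := by rw [← zpow_add₀ q_ne_zero]; simp
  linear_combination (1 + q * algebraMap Aq Fq a) * (1 - q * (algebraMap Aq Fq a * algebraMap Aq Fq b)) * h1
    - q * algebraMap Aq Fq a * hb'

theorem Lead.unique {k : ℤ} {x y : Fq} (hx : Lead k (x * y)) (hy : Lead k y) : Lead 0 x := by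
  have := hx.mul hy.inv
  rwa [mul_assoc, mul_inv_cancel₀ hy.ne_zero, mul_one, add_neg_cancel] at this

theorem one_sub_q_sq_lead : Lead 0 (1 - q ^ 2) :=
  ⟨-PowerSeries.X, by rw [map_neg, algebraMap_X, zpow_zero]; ring⟩

theorem q_sub_inv_ne_zero : q - q⁻¹ ≠ 0 := by
  intro h
  apply one_sub_q_sq_lead.ne_zero
  have := q_ne_zero
  field_simp at h
  linear_combination -h

theorem qz_neg (n : ℤ) : qz (-n) = -qz n := by
  simp only [qz, neg_neg]; ring

@[simp] theorem qz_zero : qz 0 = 0 := by simp [qz]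

@[simp] theorem qz_one : qz 1 = 1 := by
  simp only [qz, zpow_one, zpow_neg]
  exact div_self q_sub_inv_ne_zero

theorem qInt_eq_qz (k : ℕ) : qInt k = qz k := rfl

/-- `[n] = q^{1-n} (1 - q^{2n}) / (1 - q²)`, and numerator and denominator lie in `1 + q𝐀`. The
valuation estimates for strings rest on this exponent. -/
theorem lead_qz {n : ℤ} (hn : 1 ≤ n) : Lead (1 - n) (qz n) := by
  have h : Lead 0 (1 - q ^ (2 * n)) := by
    obtain ⟨d, hd⟩ := Int.le.dest (show (1 : ℤ) ≤ 2 * n by omega)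
    refine ⟨-PowerSeries.X ^ d, ?_⟩
    rw [← hd, zpow_add₀ q_ne_zero, map_neg, map_pow, algebraMap_X, zpow_natCast]
    simp only [zpow_one, zpow_zero]; ring
  have h2 := (lead_qpow (1 - n)).mul (h.mul one_sub_q_sq_lead.inv)
  have e : q ^ (1 - n) * ((1 - q ^ (2 * n)) * (1 - q ^ 2)⁻¹) = qz n := by
    have h0 := q_sub_inv_ne_zero
    have h1 := one_sub_q_sq_lead.ne_zero
    have h3 := q_ne_zero
    rw [qz, zpow_sub₀ h3, zpow_neg, two_mul, zpow_add₀ h3, zpow_one]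
    have h4 : q ^ n ≠ 0 := zpow_ne_zero _ h3
    have h5 : q ^ 2 - 1 ≠ 0 := by
      intro h; apply h1; linear_combination -h
    field_simp
    ring
  rw [e] at h2
  simpa using h2

theorem qz_ne_zero {n : ℤ} (hn : n ≠ 0) : qz n ≠ 0 := by
  rcases lt_or_gt_of_ne hn with h | h
  · rw [← neg_neg n, qz_neg]
    exact neg_ne_zero.2 (lead_qz (by omega)).ne_zero
  · exact (lead_qz (by omega)).ne_zero

theorem valGe_qz {n : ℤ} (hn : 0 ≤ n) : ValGe (1 - n) (qz n) := by
  rcases hn.eq_or_lt with rfl | h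
  · simpa using ValGe.zero _
  · exact (lead_qz (by omega)).valGe

theorem valGe_qz_inv {n : ℤ} (hn : 0 ≤ n) : ValGe (n - 1) (qz n)⁻¹ := by
  rcases hn.eq_or_lt with rfl | h
  · simpa using ValGe.zero _
  · simpa using (lead_qz (show 1 ≤ n by omega)).inv.valGe

theorem qFact_succ (k : ℕ) : qFact (k + 1) = qFact k * qz (k + 1) := by
  simp [qFact, Finset.prod_range_succ, qInt_eq_qz]

@[simp] theorem qFact_zero : qFact 0 = 1 := by simp [qFact]

theorem qFact_ne_zero (k : ℕ) : qFact k ≠ 0 :=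
  Finset.prod_ne_zero_iff.2 fun j _ => qz_ne_zero (by positivity)

/-- `[a + 1][b] - [a][b + 1] = [b - a]`, in the form used for `e f^{(k)}`. -/
theorem qz_add_mul_sub (a b : ℤ) : qz (a + 1) * qz b - qz a * qz (b + 1) = qz (b - a) := by
  have h0 := q_sub_inv_ne_zero
  have h3 := q_ne_zero
  simp only [qz, neg_add, neg_sub, zpow_add₀ h3, zpow_sub₀ h3, zpow_neg, zpow_one]
  have h4 : q ^ a ≠ 0 := zpow_ne_zero _ h3
  have h5 : q ^ b ≠ 0 := zpow_ne_zero _ h3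
  have h6 : q ^ 2 - 1 ≠ 0 := by
    intro h; apply one_sub_q_sq_lead.ne_zero; linear_combination -h
  field_simp
  ring

theorem Fq_zero_smul {M : Type*} [AddCommGroup M] [Module Fq M] (v : M) : (0 : Fq) • v = 0 :=
  zero_smul Fq v

theorem Fq_one_smul {M : Type*} [AddCommGroup M] [Module Fq M] (v : M) : (1 : Fq) • v = v :=
  one_smul Fq v

section divPow

variable {M : Type*} [AddCommGroup M] [Module Fq M] (T : Module.End Fq M)

@[simp] theorem divPow_zero : divPow T 0 = 1 := by simp [divPow]

theorem divPow_one : divPow T 1 = T := by simp [divPow, qFact, qInt_eq_qz]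

theorem divPow_succ_smul (k : ℕ) (u : M) :
    qz (k + 1) • divPow T (k + 1) u = T (divPow T k u) := by
  have h : qz (k + 1) ≠ 0 := qz_ne_zero (by positivity)
  simp only [divPow, LinearMap.smul_apply, qFact_succ, pow_succ', map_smul, smul_smul,
    Module.End.mul_apply]
  congr 1
  have := qFact_ne_zero k
  field_simp

theorem divPow_succ (k : ℕ) (u : M) :
    divPow T (k + 1) u = (qz (k + 1))⁻¹ • T (divPow T k u) := by
  rw [← divPow_succ_smul, inv_smul_smul₀ (qz_ne_zero (by positivity))]

theorem sum_divPow_add (u v : ℕ →₀ M) (g : ℕ → Module.End Fq M) :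
    ((u + v).sum fun k x => g k x) = (u.sum fun k x => g k x) + v.sum fun k x => g k x :=
  Finsupp.sum_add_index' (by simp) (by simp)

end divPow

end

section

/-! ### Strings for a quantum `sl₂`-triple -/

/-- `e` and `f` form a locally nilpotent quantum `sl₂`-triple with weight spaces `W`, where `α` is
the root and `p` is the pairing with the coroot. -/
structure SL2 {Λ M : Type*} [AddCommGroup Λ] [AddCommGroup M] [Module Fq M]
    (W : Λ → Submodule Fq M) (p : Λ →+ ℤ) (α : Λ) (e f : Module.End Fq M) : Prop where
  two : p α = 2
  e_mem : ∀ {lam u}, u ∈ W lam → e u ∈ W (lam + α)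
  f_mem : ∀ {lam u}, u ∈ W lam → f u ∈ W (lam - α)
  comm : ∀ {lam u}, u ∈ W lam → e (f u) = f (e u) + qz (p lam) • u
  nil_e : ∀ {lam u}, u ∈ W lam → ∃ k, (e ^ k) u = 0
  nil_f : ∀ {lam u}, u ∈ W lam → ∃ k, (f ^ k) u = 0

/-- `u` is a string decomposition of a vector of weight `lam`. -/
def IsStr {Λ M : Type*} [AddCommGroup Λ] [AddCommGroup M] [Module Fq M]
    (W : Λ → Submodule Fq M) (p : Λ →+ ℤ) (α : Λ) (e : Module.End Fq M) (lam : Λ)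
    (u : ℕ →₀ M) : Prop :=
  ∀ k : ℕ, u k ∈ W (lam + (k : ℤ) • α) ∧ e (u k) = 0 ∧
    (u k ≠ 0 → (k : ℤ) ≤ p (lam + (k : ℤ) • α))

namespace SL2

variable {Λ M : Type*} [AddCommGroup Λ] [AddCommGroup M] [Module Fq M]
  {W : Λ → Submodule Fq M} {p : Λ →+ ℤ} {α : Λ} {e f : Module.End Fq M}

/-- Interchanging `e` and `f` negates root and coroot; facts about highest weight vectors thus carry
over to lowest weight vectors. -/
theorem flip (S : SL2 W p α e f) : SL2 W (-p) (-α) f e where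
  two := by simp [S.two]
  e_mem h := by rw [← sub_eq_add_neg]; exact S.f_mem h
  f_mem h := by rw [sub_neg_eq_add]; exact S.e_mem h
  comm h := by
    rw [S.comm h, AddMonoidHom.neg_apply, qz_neg, neg_smul, add_neg_cancel_right]
  nil_e h := S.nil_f h
  nil_f h := S.nil_e h

variable (S : SL2 W p α e f)
include S

theorem divPow_mem {lam : Λ} {u : M} (hu : u ∈ W lam) (k : ℕ) :
    divPow f k u ∈ W (lam - (k : ℤ) • α) := by
  induction k with
  | zero => simpa using hu
  | succ k ih =>
    rw [divPow_succ]
    refine Submodule.smul_mem _ _ ?_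
    have := S.f_mem ih
    convert this using 2
    push_cast; module

theorem pow_e_mem {lam : Λ} {u : M} (hu : u ∈ W lam) (k : ℕ) :
    (e ^ k) u ∈ W (lam + (k : ℤ) • α) := by
  induction k with
  | zero => simpa using hu
  | succ k ih =>
    rw [pow_succ', Module.End.mul_apply]
    have := S.e_mem ih
    convert this using 2
    push_cast; module

theorem pairing (lam : Λ) (k : ℤ) : p (lam + k • α) = p lam + 2 * k := by
  rw [map_add, map_zsmul, S.two, smul_eq_mul]; ring

theorem pairing_sub (lam : Λ) (k : ℤ) : p (lam - k • α) = p lam - 2 * k := by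
  rw [map_sub, map_zsmul, S.two, smul_eq_mul]; ring

/-- Moving `e` past one more `f` adds a multiple by `[p λ - 2(k+1)]`; `qz_add_mul_sub` combines it
with the inductive term. -/
theorem e_divPow {lam : Λ} {w : M} (hw : w ∈ W lam) (he : e w = 0) (k : ℕ) :
    e (divPow f (k + 1) w) = qz (p lam - k) • divPow f k w := by
  induction k with
  | zero => simp [divPow_one, S.comm hw, he]
  | succ k ih =>
    have h1 : qz ((k + 1 : ℕ) + 1) ≠ 0 := qz_ne_zero (by positivity)
    rw [divPow_succ f (k + 1), map_smul, S.comm (S.divPow_mem hw (k + 1)), ih, map_smul,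
      ← divPow_succ_smul f k w, S.pairing_sub, smul_smul, ← add_smul, smul_smul]
    congr 1
    have h2 := qz_add_mul_sub (k + 1) (p lam - k - 1)
    rw [show p lam - k - 1 + 1 = p lam - k by ring,
      show p lam - k - 1 - (k + 1) = p lam - 2 * (k + 1 : ℕ) by push_cast; ring] at h2
    rw [inv_mul_eq_iff_eq_mul₀ h1, ← h2]
    push_cast
    rw [show p lam - (k + 1 : ℤ) = p lam - k - 1 by ring]
    ring

/-- Some `f^{(k)} w` vanishes. Applying `e` gives `[p λ - j]` times the preceding vector of the
string, and for `p λ < 0` this factor is never zero, so the vanishing descends to `w`. -/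
theorem eq_zero_of_neg {lam : Λ} {w : M} (hw : w ∈ W lam) (he : e w = 0) (hp : p lam < 0) :
    w = 0 := by
  obtain ⟨k, hk⟩ := S.nil_f hw
  have h : divPow f k w = 0 := by simp [divPow, hk]
  clear hk
  induction k with
  | zero => simpa using h
  | succ k ih =>
    apply ih
    have := S.e_divPow hw he k
    rw [h, map_zero, eq_comm, smul_eq_zero] at this
    exact this.resolve_left (qz_ne_zero (by omega))

/-- For `n = p λ ≥ 0` the factor in `e f^{(n+1)} w` is `[0]`, so `f^{(n+1)} w` is a highest weight
vector of weight `-n - 2` and vanishes. -/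
theorem divPow_eq_zero {lam : Λ} {w : M} (hw : w ∈ W lam) (he : e w = 0) {k : ℕ}
    (hk : p lam < k) : divPow f k w = 0 := by
  rcases lt_or_ge (p lam) 0 with h | h
  · simp [S.eq_zero_of_neg hw he h]
  obtain ⟨n, hn⟩ := Int.eq_ofNat_of_zero_le h
  have h1 : divPow f (n + 1) w = 0 := by
    refine S.eq_zero_of_neg (S.divPow_mem hw _) ?_ ?_
    · rw [S.e_divPow hw he, hn]; simp
    · rw [S.pairing_sub]; push_cast; omega
  obtain ⟨d, rfl⟩ := Nat.exists_eq_add_of_le (show n + 1 ≤ k by omega)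
  clear hk
  induction d with
  | zero => exact h1
  | succ d ih => rw [← add_assoc, divPow_succ, ih, map_zero, smul_zero]

theorem divPow_e_divPow_f {lam : Λ} {w : M} (hw : w ∈ W lam) (he : e w = 0) {N : ℕ}
    (hN : p lam = N) {k : ℕ} (hk : k ≤ N) :
    divPow e k (divPow f N w) = divPow f (N - k) w := by
  induction k with
  | zero => simp
  | succ k ih =>
    rw [divPow_succ, ih (by omega), show N - k = (N - (k + 1)) + 1 by omega, S.e_divPow hw he, hN,
      smul_smul]
    have h1 : qz ((k : ℤ) + 1) ≠ 0 := qz_ne_zero (by positivity)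
    rw [show (N : ℤ) - (N - (k + 1) : ℕ) = k + 1 by omega, inv_mul_cancel₀ h1, one_smul]

theorem pow_e_divPow_f {lam : Λ} {w : M} (hw : w ∈ W lam) (he : e w = 0) {j : ℕ}
    (hj : (j : ℤ) ≤ p lam) {k : ℕ} (hk : k ≤ j) :
    ∃ c : Fq, c ≠ 0 ∧ (e ^ k) (divPow f j w) = c • divPow f (j - k) w := by
  induction k with
  | zero => exact ⟨1, one_ne_zero, by simp⟩
  | succ k ih =>
    obtain ⟨c, hc, h⟩ := ih (by omega)
    refine ⟨c * qz (p lam - (j - (k + 1) : ℕ)), mul_ne_zero hc (qz_ne_zero (by omega)), ?_⟩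
    rw [pow_succ', Module.End.mul_apply, h, map_smul,
      show j - k = (j - (k + 1)) + 1 by omega, S.e_divPow hw he, smul_smul]

theorem pow_e_self {lam : Λ} {w : M} (hw : w ∈ W lam) (he : e w = 0) {j : ℕ}
    (hj : (j : ℤ) ≤ p lam) : ∃ c : Fq, c ≠ 0 ∧ (e ^ j) (divPow f j w) = c • w := by
  simpa using S.pow_e_divPow_f hw he hj le_rfl

theorem divPow_ne_zero {lam : Λ} {w : M} (hw : w ∈ W lam) (he : e w = 0) (h0 : w ≠ 0) {j : ℕ}
    (hj : (j : ℤ) ≤ p lam) : divPow f j w ≠ 0 := by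
  obtain ⟨c, hc, h⟩ := S.pow_e_self hw he hj
  intro h1
  rw [h1, map_zero, eq_comm, smul_eq_zero] at h
  exact h.elim hc h0

theorem pow_e_eq_zero {lam : Λ} {w : M} (hw : w ∈ W lam) (he : e w = 0) {j k : ℕ}
    (hjk : j < k) : (e ^ k) (divPow f j w) = 0 := by
  rcases lt_or_ge (p lam) j with h | h
  · rw [S.divPow_eq_zero hw he h, map_zero]
  obtain ⟨c, -, hc⟩ := S.pow_e_self hw he h
  obtain ⟨d, rfl⟩ := Nat.exists_eq_add_of_le (show j + 1 ≤ k by omega)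
  rw [add_comm, pow_add, pow_succ', Module.End.mul_apply, Module.End.mul_apply, hc, map_smul, he,
    smul_zero, map_zero]

omit S in
theorem IsStr.add {lam : Λ} {u v : ℕ →₀ M} (hu : IsStr W p α e lam u)
    (hv : IsStr W p α e lam v) : IsStr W p α e lam (u + v) := by
  intro k
  refine ⟨add_mem (hu k).1 (hv k).1, by simp [(hu k).2.1, (hv k).2.1], fun h => ?_⟩
  by_cases h1 : u k = 0
  · exact (hv k).2.2 fun h2 => h (by simp [h1, h2])
  · exact (hu k).2.2 h1

omit S in
theorem IsStr.smul {lam : Λ} {u : ℕ →₀ M} (hu : IsStr W p α e lam u) (c : Fq) :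
    IsStr W p α e lam (c • u) := by
  intro k
  refine ⟨Submodule.smul_mem _ _ (hu k).1, by simp [(hu k).2.1], fun h => ?_⟩
  exact (hu k).2.2 fun h1 => h (by simp [h1])

omit S in
theorem isStr_single {lam mu : Λ} {w : M} (hw : w ∈ W mu) (he : e w = 0) {k : ℕ}
    (hmu : mu = lam + (k : ℤ) • α) (hk : (k : ℤ) ≤ p mu) :
    IsStr W p α e lam (Finsupp.single k w) := by
  classical
  intro j
  rw [Finsupp.single_apply]
  split_ifs with h
  · subst h; subst hmu; exact ⟨hw, he, fun _ => hk⟩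
  · simp

/-- If `e^{N+1} v = 0`, then `e^N v` is a highest weight vector on which `e^N f^{(N)}` is a nonzero
scalar, so subtracting a multiple of `f^{(N)} e^N v` lowers the order of nilpotency. Nonnegativity
of `p λ` ensures `N ≤ p (λ + N α)`. -/
theorem exists_str_of_nonneg {lam : Λ} (hp : 0 ≤ p lam) (N : ℕ) {v : M} (hv : v ∈ W lam)
    (hN : (e ^ N) v = 0) : ∃ u, IsStr W p α e lam u ∧ v = u.sum fun k x => divPow f k x := by
  induction N generalizing v with
  | zero =>
    refine ⟨0, ?_, ?_⟩
    · intro k; simp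
    · simpa using hN
  | succ N ih =>
    have hx := S.pow_e_mem hv N
    have hex : e ((e ^ N) v) = 0 := by rwa [pow_succ', Module.End.mul_apply] at hN
    have hpx : (N : ℤ) ≤ p (lam + (N : ℤ) • α) := by rw [S.pairing]; omega
    obtain ⟨c, hc, hcx⟩ := S.pow_e_self hx hex hpx
    have hmem : divPow f N ((e ^ N) v) ∈ W lam := by
      simpa using S.divPow_mem hx N
    obtain ⟨u, hu, hvu⟩ := ih (v := v - c⁻¹ • divPow f N ((e ^ N) v))
      (sub_mem hv (Submodule.smul_mem _ _ hmem))
      (by rw [map_sub, map_smul, hcx, inv_smul_smul₀ hc, sub_self])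
    refine ⟨u + Finsupp.single N (c⁻¹ • (e ^ N) v), IsStr.add hu (isStr_single
      (Submodule.smul_mem _ _ hx) (by simp [hex]) rfl hpx), ?_⟩
    rw [sum_divPow_add, ← hvu]
    simp

/-- For `p λ ≤ 0` the vector is first decomposed from below, as a sum of `e^{(k)} u_k` with `f u_k =
0`. If the string of `u_k` has length `l`, its top `e^{(l)} u_k` is a highest weight vector, and
`e^{(k)} u_k` is `f^{(l-k)}` of it. -/
theorem exists_str {lam : Λ} {v : M} (hv : v ∈ W lam) :
    ∃ u, IsStr W p α e lam u ∧ v = u.sum fun k x => divPow f k x := by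
  rcases le_total 0 (p lam) with hp | hp
  · obtain ⟨N, hN⟩ := S.nil_e hv
    exact S.exists_str_of_nonneg hp N hv hN
  obtain ⟨N, hN⟩ := S.nil_f hv
  obtain ⟨u, hu, rfl⟩ := S.flip.exists_str_of_nonneg (by simpa using hp) N hv hN
  rw [Finsupp.sum]
  refine Finset.sum_induction _
    (fun v => ∃ u, IsStr W p α e lam u ∧ v = u.sum fun k x => divPow f k x) ?_ ?_ ?_
  · rintro _ _ ⟨u, hu, rfl⟩ ⟨v, hv, rfl⟩
    exact ⟨u + v, IsStr.add hu hv, (sum_divPow_add _ _ _).symm⟩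
  · exact ⟨0, fun k => by simp, by simp⟩
  · intro k hk
    obtain ⟨h1, h2, h3⟩ := hu k
    have hk' := h3 (Finsupp.mem_support_iff.1 hk)
    obtain ⟨l, hl⟩ := Int.eq_ofNat_of_zero_le (hk'.trans' (by positivity))
    have hw := S.flip.divPow_mem h1 l
    have hew : e (divPow e l (u k)) = 0 := by
      rw [← divPow_succ_smul e, S.flip.divPow_eq_zero h1 h2 (by omega), smul_zero]
    have hkl : k ≤ l := by omega
    have hpl : p lam = 2 * k - l := by
      rw [S.flip.pairing] at hl
      simp only [AddMonoidHom.neg_apply] at hl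
      omega
    refine ⟨Finsupp.single (l - k) (divPow e l (u k)), isStr_single hw hew ?_ ?_, ?_⟩
    · rw [Nat.cast_sub hkl]; module
    · rw [S.flip.pairing] at hl
      have h5 : lam + (k : ℤ) • -α - (l : ℤ) • -α = lam + ((l : ℤ) - k) • α := by module
      rw [h5, S.pairing]
      omega
    · rw [Finsupp.sum_single_index (by simp)]
      have := S.flip.divPow_e_divPow_f h1 h2 hl (k := l - k) (by omega)
      rw [this]
      congr 2
      omega

/-- For the top index `N`, the operator `e^N` kills the terms of smaller index and returns a nonzero
multiple of `u N`. -/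
theorem str_eq_zero {lam : Λ} {u : ℕ →₀ M} (hu : IsStr W p α e lam u)
    (h0 : (u.sum fun k x => divPow f k x) = 0) : u = 0 := by
  by_contra hne
  have hs : u.support.Nonempty := Finsupp.support_nonempty_iff.2 hne
  set N := u.support.max' hs
  have hN : u N ≠ 0 := Finsupp.mem_support_iff.1 (u.support.max'_mem hs)
  obtain ⟨h1, h2, h3⟩ := hu N
  obtain ⟨c, hc, hcx⟩ := S.pow_e_self h1 h2 (h3 hN)
  have := congrArg (e ^ N) h0
  rw [map_zero, Finsupp.sum, map_sum, Finset.sum_eq_single N, hcx, smul_eq_zero] at this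
  · exact this.elim hc hN
  · intro k hk hkN
    exact S.pow_e_eq_zero (hu k).1 (hu k).2.1 (lt_of_le_of_ne (u.support.le_max' k hk) hkN)
  · intro h
    exact absurd (u.support.max'_mem hs) h

theorem str_unique {lam : Λ} {u v : ℕ →₀ M} (hu : IsStr W p α e lam u)
    (hv : IsStr W p α e lam v)
    (h : (u.sum fun k x => divPow f k x) = v.sum fun k x => divPow f k x) : u = v := by
  have h1 : IsStr W p α e lam (u + (-1 : Fq) • v) := IsStr.add hu (IsStr.smul hv _)
  have h2 := S.str_eq_zero h1 (by
    rw [sum_divPow_add, Finsupp.sum_smul_index' (by simp), h]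
    simp only [map_smul]
    rw [← Finsupp.smul_sum]
    simp)
  rw [neg_one_smul, ← sub_eq_add_neg, sub_eq_zero] at h2
  exact h2

/-- The string decomposition of the vectors of weight `lam`. -/
def strMap (lam : Λ) : W lam →ₗ[Fq] (ℕ →₀ M) where
  toFun v := (S.exists_str v.2).choose
  map_add' v w := by
    have h := fun v : W lam => (S.exists_str v.2).choose_spec
    refine S.str_unique (h _).1 (IsStr.add (h _).1 (h _).1) ?_
    rw [sum_divPow_add, ← (h _).2, ← (h _).2, ← (h _).2]; rfl
  map_smul' c v := by
    have h := fun v : W lam => (S.exists_str v.2).choose_spec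
    refine S.str_unique (h _).1 (IsStr.smul (h _).1 _) ?_
    rw [Finsupp.sum_smul_index' (by simp), ← (h _).2]
    simp only [RingHom.id_apply, map_smul]
    rw [← Finsupp.smul_sum, ← (h _).2]; rfl

theorem strMap_spec {lam : Λ} {u : ℕ →₀ M} (hu : IsStr W p α e lam u)
    (hm : (u.sum fun k x => divPow f k x) ∈ W lam) : S.strMap lam ⟨_, hm⟩ = u :=
  have h := (S.exists_str hm).choose_spec
  S.str_unique h.1 hu h.2.symm

theorem sum_mem {lam : Λ} {u : ℕ →₀ M} (hu : IsStr W p α e lam u) :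
    (u.sum fun k x => divPow f k x) ∈ W lam := by
  refine Submodule.sum_mem _ fun k _ => ?_
  simpa using S.divPow_mem (hu k).1 k

/-- By uniqueness the string components depend linearly on a vector of given weight, so any
prescription `f^{(k)} u_k ↦ g_k u_k` extends to the direct sum of the weight spaces. Both even
Kashiwara operators arise in this way. -/
theorem exists_operator (hW : iSupIndep W) (hW' : ⨆ lam, W lam = ⊤) (g : ℕ → Module.End Fq M) :
    ∃ T : Module.End Fq M, ∀ lam u, IsStr W p α e lam u →
      T (u.sum fun k x => divPow f k x) = u.sum fun k x => g k x := by
  classical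
  have hI : DirectSum.IsInternal W :=
    DirectSum.isInternal_submodule_of_iSupIndep_of_iSup_eq_top hW hW'
  let φ := LinearEquiv.ofBijective (DirectSum.coeLinearMap W) hI
  let G : (ℕ →₀ M) →ₗ[Fq] M := Finsupp.lsum Fq g
  refine ⟨DirectSum.toModule Fq Λ M (fun lam => G ∘ₗ S.strMap lam) ∘ₗ φ.symm.toLinearMap, ?_⟩
  intro lam u hu
  have hm := S.sum_mem hu
  have : φ.symm (u.sum fun k x => divPow f k x) = DirectSum.lof Fq Λ (fun l => W l) lam ⟨_, hm⟩ := by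
    rw [LinearEquiv.symm_apply_eq]
    exact (DirectSum.coeLinearMap_lof W lam ⟨_, hm⟩).symm
  rw [LinearMap.comp_apply, LinearEquiv.coe_coe, this, DirectSum.toModule_lof,
    LinearMap.comp_apply, S.strMap_spec hu hm]
  rfl

/-- The divided powers of `f` applied to a highest weight vector admit a dual family of linear
forms. -/
theorem exists_dual (hW : iSupIndep W) {lam : Λ} {w : M} (hw : w ∈ W lam) (he : e w = 0)
    (h0 : w ≠ 0) {m : ℕ} (hm : p lam = m) (j : ℕ) (hj : j ≤ m) :
    ∃ ψ : M →ₗ[Fq] Fq, ∀ i, i ≤ m → ψ (divPow f i w) = if i = j then 1 else 0 := by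
  classical
  let v : Fin (m + 1) → M := fun i => divPow f i w
  have hinj : Function.Injective fun i : Fin (m + 1) => lam - ((i : ℕ) : ℤ) • α := by
    intro i i' h
    have := congrArg p h
    simp only [S.pairing_sub] at this
    exact Fin.ext (by omega)
  have hli : LinearIndependent Fq v :=
    (hW.comp hinj).linearIndependent _ (fun i => S.divPow_mem hw i)
      (fun i => S.divPow_ne_zero hw he h0 (by have := i.2; omega))
  let B := Module.Basis.extend hli.linearIndepOn_id
  have hmem : ∀ i, v i ∈ hli.linearIndepOn_id.extend (Set.subset_univ _) := fun i =>
    hli.linearIndepOn_id.subset_extend _ ⟨i, rfl⟩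
  refine ⟨B.coord ⟨v ⟨j, by omega⟩, hmem _⟩, fun i hi => ?_⟩
  have h1 : divPow f i w = B ⟨v ⟨i, by omega⟩, hmem _⟩ := by
    rw [Module.Basis.extend_apply_self]
  rw [h1, Module.Basis.coord_apply, Module.Basis.repr_self, Finsupp.single_apply]
  congr 1
  rw [Subtype.mk.injEq, hli.injective.eq_iff]
  simp

end SL2

end

section

/-! ### The tensor product of two strings -/

section qMul

variable {M : Type*} [AddCommGroup M] [Module Fq M] [Module Aq M] [IsScalarTower Aq Fq M]

/-- The submodule `qX` of an `𝐀`-submodule `X`. -/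
def qMul (X : Submodule Aq M) : Submodule Aq M := X.map (LinearMap.lsmul Aq M PowerSeries.X)

theorem X_smul_eq (v : M) : (PowerSeries.X : Aq) • v = q • v := by
  rw [← algebraMap_X, algebraMap_smul]

theorem mem_qMul {X : Submodule Aq M} {x : M} : x ∈ qMul X ↔ ∃ y ∈ X, q • y = x := by
  simp [qMul, X_smul_eq]

theorem qMul_le (X : Submodule Aq M) : qMul X ≤ X := by
  intro x hx
  obtain ⟨y, hy, rfl⟩ := mem_qMul.1 hx
  rw [← X_smul_eq]
  exact X.smul_mem _ hy

theorem ValGe.smul_mem {X : Submodule Aq M} {c : Fq} (hc : ValGe 0 c) {v : M} (hv : v ∈ X) :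
    c • v ∈ X := by
  obtain ⟨a, rfl⟩ := hc.exists_eq
  rw [algebraMap_smul]
  exact X.smul_mem _ hv

theorem ValGe.smul_mem_qMul {X : Submodule Aq M} {c : Fq} (hc : ValGe 1 c) {v : M} (hv : v ∈ X) :
    c • v ∈ qMul X := by
  obtain ⟨a, rfl⟩ := hc.exists_eq_X_mul
  rw [map_mul, mul_smul, algebraMap_X]
  exact mem_qMul.2 ⟨_, (valGe_algebraMap a).smul_mem hv, rfl⟩

theorem Lead.smul_sub_mem_qMul {X : Submodule Aq M} {c : Fq} (hc : Lead 0 c) {v : M} (hv : v ∈ X) :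
    c • v - v ∈ qMul X := by
  obtain ⟨a, rfl⟩ := hc
  have : ValGe 1 (q * algebraMap Aq Fq a) := ⟨a, by simp⟩
  convert this.smul_mem_qMul hv using 1
  rw [zpow_zero, one_mul, add_smul, one_smul, add_sub_cancel_left]

theorem map_mem_qMul {X : Submodule Aq M} {T : Module.End Fq M} (hT : ∀ x ∈ X, T x ∈ X) {x : M}
    (hx : x ∈ qMul X) : T x ∈ qMul X := by
  obtain ⟨y, hy, rfl⟩ := mem_qMul.1 hx
  exact mem_qMul.2 ⟨T y, hT y hy, by rw [map_smul]⟩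

/-- A form of Nakayama's lemma: an operator that maps approximations of the generators of `X`
into `X` preserves `X`. -/
theorem stable_of_approx {G : Set M} (hG : G.Finite) (T : Module.End Fq M)
    (h : ∀ x ∈ G, ∃ x', x - x' ∈ qMul (Submodule.span Aq G) ∧ T x' ∈ Submodule.span Aq G) :
    ∀ x ∈ Submodule.span Aq G, T x ∈ Submodule.span Aq G := by
  set X := Submodule.span Aq G
  have hfg : X.FG := Submodule.fg_span hG
  let T' := T.restrictScalars Aq
  have key : X.map T' ≤ X := by
    -- Nakayama: `T X ⊆ X + q T X`, where `T X` is finitely generated and `q` lies in the maximal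
    -- ideal of `𝐀`.
    refine Submodule.le_of_le_smul_of_le_jacobson_bot (I := Ideal.span {PowerSeries.X})
      (hfg.map T') ?_ ?_
    · rw [IsLocalRing.jacobson_eq_maximalIdeal _ bot_ne_top, Ideal.span_singleton_le_iff_mem,
        IsLocalRing.mem_maximalIdeal, mem_nonunits_iff, PowerSeries.isUnit_iff_constantCoeff]
      simp
    · rw [Submodule.map_span_le]
      intro x hx
      obtain ⟨x', h1, h2⟩ := h x hx
      obtain ⟨y, hy, hxy⟩ := mem_qMul.1 h1
      have : T' x = T x' + (PowerSeries.X : Aq) • T' y := by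
        rw [← map_smul, X_smul_eq, hxy]
        simp [T']
      rw [this]
      exact Submodule.add_mem_sup h2 (Submodule.smul_mem_smul (Ideal.mem_span_singleton_self _)
        (Submodule.mem_map_of_mem hy))
  exact fun x hx => key (Submodule.mem_map_of_mem hx)

end qMul

variable {M : Type*} [AddCommGroup M] [Module Fq M]

/-- The vectors `t j k` behave like `f^{(j)} x ⊗ f^{(k)} y`, where `x` and `y` are highest weight
vectors of weights `m` and `n`. -/
structure TensorString (e f : Module.End Fq M) (t : ℤ → ℤ → M) (m n : ℕ) : Prop where
  zero : ∀ j k : ℤ, ¬ (0 ≤ j ∧ j ≤ m ∧ 0 ≤ k ∧ k ≤ n) → t j k = 0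
  f_apply : ∀ j k, f (t j k) =
    qz (j + 1) • t (j + 1) k + (q ^ (m - 2 * j) * qz (k + 1)) • t j (k + 1)
  e_apply : ∀ j k, e (t j k) =
    (q ^ (2 * k - n) * qz (m - j + 1)) • t (j - 1) k + qz (n - k + 1) • t j (k - 1)
  dual : ∀ j k : ℤ, 0 ≤ j ∧ j ≤ m ∧ 0 ≤ k ∧ k ≤ n →
    ∃ ψ : M →ₗ[Fq] Fq, ∀ j' k', ψ (t j' k') = if j' = j ∧ k' = k then 1 else 0

namespace TensorString

variable {e f : Module.End Fq M} {t : ℤ → ℤ → M} {m n : ℕ}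

/-- `f^{(m-k)} x` is `e^{(k)}` of the lowest vector of its string, so reversing the indices
interchanges `e` and `f`. The factors are swapped as well, because the group-like elements sit on
opposite sides in the coproducts of `e` and `f`. -/
theorem flip (H : TensorString e f t m n) : TensorString f e (fun j k => t (m - k) (n - j)) n m where
  zero j k h := H.zero (m - k) (n - j) (by omega)
  f_apply j k := by
    rw [H.e_apply, add_comm]
    congr 1
    · rw [show (n : ℤ) - (n - j) + 1 = j + 1 by ring, show (n : ℤ) - j - 1 = n - (j + 1) by ring]
    · rw [show (m : ℤ) - (m - k) + 1 = k + 1 by ring, show (m : ℤ) - k - 1 = m - (k + 1) by ring,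
        show 2 * ((n : ℤ) - j) - n = n - 2 * j by ring]
  e_apply j k := by
    rw [H.f_apply, add_comm]
    congr 1
    · rw [show (n : ℤ) - j + 1 = n - (j - 1) by ring, show (n : ℤ) - (j - 1) = n - j + 1 by ring,
        show (m : ℤ) - 2 * (m - k) = 2 * k - m by ring]
    · rw [show (m : ℤ) - (k - 1) = m - k + 1 by ring]
  dual j k h := by
    obtain ⟨ψ, hψ⟩ := H.dual (m - k) (n - j) (by omega)
    refine ⟨ψ, fun j' k' => ?_⟩
    rw [hψ]
    congr 1
    rw [eq_iff_iff]
    omega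

/-- The combination `∑_i γ_i t_{i, P - i}`. -/
def comb (t : ℤ → ℤ → M) (m : ℕ) (γ : ℕ → Fq) (P : ℤ) : M :=
  ∑ i ∈ Finset.range (m + 1), γ i • t i (P - i)

theorem smul_comb (c : Fq) (γ : ℕ → Fq) (P : ℤ) :
    c • comb t m γ P = comb t m (fun i => c * γ i) P := by
  simp only [comb, Finset.smul_sum, smul_smul]

theorem add_comb (γ δ : ℕ → Fq) (P : ℤ) :
    comb t m γ P + comb t m δ P = comb t m (fun i => γ i + δ i) P := by
  simp only [comb, ← Finset.sum_add_distrib, add_smul]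

theorem f_comb (H : TensorString e f t m n) (γ : ℕ → Fq) (P : ℤ) :
    f (comb t m γ P) = comb t m (fun i => qz i * γ (i - 1) +
      q ^ ((m : ℤ) - 2 * i) * qz (P + 1 - i) * γ i) (P + 1) := by
  -- The truncated index `i - 1` is harmless at `i = 0`, where `[0] = 0`; at the other end `t (m +
  -- 1) _` vanishes.
  have h1 : ∑ i ∈ Finset.range (m + 1), (qz i * γ (i - 1)) • t i (P + 1 - i) =
      ∑ i ∈ Finset.range (m + 1), (qz (i + 1) * γ i) • t (i + 1) (P - i) := by
    rw [Finset.sum_range_succ', Finset.sum_range_succ]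
    rw [H.zero ((m : ℤ) + 1) (P - m) (by omega)]
    simp only [Nat.cast_add, Nat.cast_one, Nat.cast_zero, qz_zero, zero_mul, Fq_zero_smul, smul_zero,
      add_zero, add_tsub_cancel_right]
    refine Finset.sum_congr rfl fun i _ => ?_
    rw [show P + 1 - ((i : ℤ) + 1) = P - i by ring]
  simp only [comb, add_smul, Finset.sum_add_distrib, h1]
  rw [map_sum, ← Finset.sum_add_distrib]
  refine Finset.sum_congr rfl fun i _ => ?_
  rw [map_smul, H.f_apply, smul_add, smul_smul, smul_smul, show P - (i : ℤ) + 1 = P + 1 - i by ring]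
  congr 2 <;> ring

theorem e_comb (H : TensorString e f t m n) (γ : ℕ → Fq) (P : ℤ) :
    e (comb t m γ P) = comb t m (fun i => γ (i + 1) * (q ^ (2 * (P - 1 - i) - n) * qz (m - i)) +
      qz (n - P + i + 1) * γ i) (P - 1) := by
  have h1 : ∑ i ∈ Finset.range (m + 1), (γ (i + 1) * (q ^ (2 * (P - 1 - i) - n) * qz (m - i))) •
        t i (P - 1 - i) =
      ∑ i ∈ Finset.range (m + 1), (γ i * (q ^ (2 * (P - i) - n) * qz (m - i + 1))) •
        t (i - 1) (P - i) := by
    rw [Finset.sum_range_succ, Finset.sum_range_succ']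
    rw [H.zero (((0 : ℕ) : ℤ) - 1) (P - ((0 : ℕ) : ℤ)) (by omega)]
    simp only [sub_self, qz_zero, mul_zero, Fq_zero_smul, smul_zero, add_zero]
    refine Finset.sum_congr rfl fun i _ => ?_
    push_cast
    rw [show P - ((i : ℤ) + 1) = P - 1 - i by ring, show (m : ℤ) - (i + 1) + 1 = m - i by ring,
      show (i : ℤ) + 1 - 1 = i by ring]
  simp only [comb, add_smul, Finset.sum_add_distrib, h1]
  rw [map_sum, ← Finset.sum_add_distrib]
  refine Finset.sum_congr rfl fun i _ => ?_
  rw [map_smul, H.e_apply, smul_add, smul_smul, smul_smul, show P - (i : ℤ) - 1 = P - 1 - i by ring,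
    show (n : ℤ) - (P - i) + 1 = n - P + i + 1 by ring]
  congr 2
  ring

/-- The coefficients of the highest weight vector of degree `p`. -/
def hwCoeff (m n p : ℕ) : ℕ → Fq
  | 0 => 1
  | i + 1 => -hwCoeff m n p i * q ^ ((n : ℤ) - 2 * (p - 1 - i)) * qz (n - p + 1 + i) *
      (qz (m - i))⁻¹

/-- The highest weight vector of degree `p`. -/
def hwVec (t : ℤ → ℤ → M) (m n p : ℕ) : M := comb t m (hwCoeff m n p) p

/-- The recursion for `hwCoeff` is the vanishing of the coefficient of `t_{i,p-1-i}` in `e_comb`. At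
`i = m`, where the recursion would divide by `[0]`, that vector is zero because `p ≤ m`. -/
theorem e_hwVec (H : TensorString e f t m n) {p : ℕ} (hpm : p ≤ m) :
    e (hwVec t m n p) = 0 := by
  rw [hwVec, H.e_comb, comb]
  refine Finset.sum_eq_zero fun i hi => ?_
  rw [Finset.mem_range] at hi
  rcases eq_or_ne i m with rfl | h
  · rw [H.zero (i : ℤ) ((p : ℤ) - 1 - i) (by omega), smul_zero]
  · have h1 : qz ((m : ℤ) - i) ≠ 0 := qz_ne_zero (by omega)
    have h2 : q ^ (2 * ((p : ℤ) - 1 - i) - n) * q ^ ((n : ℤ) - 2 * (p - 1 - i)) = 1 := by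
      rw [← zpow_add₀ q_ne_zero]; ring_nf; simp
    rw [smul_eq_zero]; left
    rw [show hwCoeff m n p (i + 1) = -hwCoeff m n p i * q ^ ((n : ℤ) - 2 * (p - 1 - i)) *
      qz (n - p + 1 + i) * (qz (m - i))⁻¹ from rfl, show (n : ℤ) - p + i + 1 = n - p + 1 + i by ring]
    field_simp
    linear_combination -hwCoeff m n p i * qz (n - p + 1 + i) * h2

/-- The dual forms read off the coefficients of `e (comb t m γ p)`, whose vanishing forces the
recursion of `hwCoeff` on `γ`. Coefficients beyond `p` belong to zero vectors. -/
theorem eq_smul_hwVec (H : TensorString e f t m n) {p : ℕ} (hpm : p ≤ m) (hpn : p ≤ n)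
    (γ : ℕ → Fq) (h0 : e (comb t m γ p) = 0) : comb t m γ p = γ 0 • hwVec t m n p := by
  have key : ∀ i, i ≤ p → γ i = γ 0 * hwCoeff m n p i := by
    intro i
    induction i with
    | zero => simp [hwCoeff]
    | succ i ih =>
      intro hi
      obtain ⟨ψ, hψ⟩ := H.dual i (p - 1 - i) (by omega)
      have := congrArg ψ h0
      rw [H.e_comb, comb, map_sum, map_zero, Finset.sum_eq_single i] at this
      · rw [map_smul, hψ, if_pos ⟨rfl, rfl⟩, smul_eq_mul, mul_one, ih (by omega),
          show (n : ℤ) - p + i + 1 = n - p + 1 + i by ring] at this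
        have h1 : qz ((m : ℤ) - i) ≠ 0 := qz_ne_zero (by omega)
        have h2 : q ^ (2 * ((p : ℤ) - 1 - i) - n) * q ^ ((n : ℤ) - 2 * (p - 1 - i)) = 1 := by
          rw [← zpow_add₀ q_ne_zero]; ring_nf; simp
        rw [hwCoeff]
        field_simp
        linear_combination q ^ ((n : ℤ) - 2 * (p - 1 - i)) * this -
          γ (i + 1) * qz (m - i) * h2
      · intro j _ hj
        rw [map_smul, hψ, if_neg (by omega), smul_eq_mul, mul_zero]
      · intro h
        exact absurd (Finset.mem_range.2 (by omega)) h
  rw [hwVec, smul_comb, comb, comb]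
  refine Finset.sum_congr rfl fun i _ => ?_
  rcases le_or_gt i p with h | h
  · rw [key i h]
  · rw [H.zero (i : ℤ) ((p : ℤ) - i) (by omega), smul_zero, smul_zero]

/-- Each step of the recursion adds `(n - 2(p-1-i)) + (p - n - i) + (m - i - 1) = m - p + 1` to the
valuation; the three terms come from the power of `q`, from `[n-p+1+i]` and from `[m-i]⁻¹`. -/
theorem valGe_hwCoeff {p : ℕ} (hpm : p ≤ m) (hpn : p ≤ n) (i : ℕ) (hi : i ≤ p) :
    ValGe (i * (m - p + 1)) (hwCoeff m n p i) := by
  induction i with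
  | zero => simpa [hwCoeff] using lead_one.valGe
  | succ i ih =>
    have := (((ih (by omega)).neg.mul (valGe_qpow ((n : ℤ) - 2 * (p - 1 - i)))).mul
      (valGe_qz (show (0 : ℤ) ≤ n - p + 1 + i by omega))).mul
      (valGe_qz_inv (show (0 : ℤ) ≤ m - i by omega))
    rw [hwCoeff]
    refine this.mono ?_
    push_cast
    linarith

/-- The coefficients of `f^{(s)}` applied to the highest weight vector of degree `p`. -/
def strCoeff (m n p : ℕ) : ℕ → ℕ → Fq
  | 0 => hwCoeff m n p
  | s + 1 => fun i => (qz (s + 1))⁻¹ * (qz i * strCoeff m n p s (i - 1) +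
      q ^ ((m : ℤ) - 2 * i) * qz (p + s + 1 - i) * strCoeff m n p s i)

theorem divPow_hwVec (H : TensorString e f t m n) (p s : ℕ) :
    divPow f s (hwVec t m n p) = comb t m (strCoeff m n p s) (p + s) := by
  induction s with
  | zero => simp [hwVec, strCoeff]
  | succ s ih =>
    rw [divPow_succ, ih, H.f_comb, smul_comb, strCoeff]
    push_cast
    rw [add_assoc]

/-- Induction on `s`. On the diagonal `i = s` the factor `[s+1]⁻¹ [s+1]` carries the leading
coefficient over unchanged, and the other term has positive valuation because `s + 1 + p ≤ m`. The
exponents off the diagonal are chosen so that they reproduce themselves under the recursion on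
either side. -/
theorem strCoeff_spec {p : ℕ} (hpm : p ≤ m) (hpn : p ≤ n) (s : ℕ) (hs : s + p ≤ m) :
    (∀ i : ℕ, i ≤ s → ValGe ((s - i) * (m - p - i)) (strCoeff m n p s i)) ∧
    (∀ i : ℕ, s ≤ i → i ≤ s + p → ValGe ((i - s) * (m - p + 1 - s)) (strCoeff m n p s i)) ∧
    Lead 0 (strCoeff m n p s s) := by
  induction s with
  | zero =>
    refine ⟨fun i hi => ?_, fun i _ hi => ?_, lead_one⟩
    · obtain rfl : i = 0 := by omega
      simpa [strCoeff, hwCoeff] using lead_one.valGe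
    · simpa [strCoeff] using valGe_hwCoeff hpm hpn i (by omega)
  | succ s ih =>
    obtain ⟨ha, hb, hc⟩ := ih (by omega)
    have hinv := valGe_qz_inv (show (0 : ℤ) ≤ s + 1 by omega)
    have hlead : Lead 0 (strCoeff m n p (s + 1) (s + 1)) := by
      have h1 : qz ((s : ℤ) + 1) ≠ 0 := qz_ne_zero (by omega)
      have e1 : strCoeff m n p (s + 1) (s + 1) = strCoeff m n p s s + (qz (s + 1))⁻¹ *
          (q ^ ((m : ℤ) - 2 * (s + 1)) * qz p * strCoeff m n p s (s + 1)) := by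
        rw [strCoeff]
        push_cast
        rw [show (p : ℤ) + s + 1 - (s + 1) = p by ring, mul_add, inv_mul_cancel_left₀ h1]
      rw [e1]
      refine hc.add ?_
      rcases Nat.eq_zero_or_pos p with h | h
      · simpa [h] using ValGe.zero _
      refine (hinv.mul (((valGe_qpow _).mul (valGe_qz (show (0 : ℤ) ≤ p by omega))).mul
        (hb (s + 1) (by omega) (by omega)))).mono ?_
      push_cast
      linarith [show (s : ℤ) + 1 + p ≤ m by omega]
    have hsm : (s : ℤ) + 1 + p ≤ m := by omega
    refine ⟨fun i hi => ?_, fun i hi1 hi2 => ?_, hlead⟩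
    · simp only [strCoeff, mul_add]
      refine ValGe.add ?_ ?_
      · rcases Nat.eq_zero_or_pos i with h | h
        · subst h; simpa using ValGe.zero _
        refine (hinv.mul ((valGe_qz (show (0 : ℤ) ≤ i by omega)).mul
          (ha (i - 1) (by omega)))).mono ?_
        push_cast [Nat.cast_sub h]
        linarith [show (i : ℤ) ≤ s + 1 by omega]
      · rcases hi.eq_or_lt with h | h
        · rcases Nat.eq_zero_or_pos p with h' | h'
          · subst h; subst h'; simpa using ValGe.zero _
          refine (hinv.mul (((valGe_qpow _).mul (valGe_qz (show (0 : ℤ) ≤ p + s + 1 - i by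
            omega))).mul (hb i (by omega) (by omega)))).mono ?_
          subst h
          push_cast
          linarith
        · refine (hinv.mul (((valGe_qpow _).mul (valGe_qz (show (0 : ℤ) ≤ p + s + 1 - i by
            omega))).mul (ha i (by omega)))).mono ?_
          push_cast
          linarith
    · rcases hi1.eq_or_lt with h | h
      · subst h; simpa using hlead.valGe
      simp only [strCoeff, mul_add]
      refine ValGe.add ?_ ?_
      · refine (hinv.mul ((valGe_qz (show (0 : ℤ) ≤ i by omega)).mul
          (hb (i - 1) (by omega) (by omega)))).mono ?_
        push_cast [Nat.cast_sub (show 1 ≤ i by omega)]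
        linarith
      · rcases eq_or_ne i (p + s + 1) with h' | h'
        · subst h'; simpa using ValGe.zero _
        refine (hinv.mul (((valGe_qpow _).mul (valGe_qz (show (0 : ℤ) ≤ p + s + 1 - i by
          omega))).mul (hb i (by omega) (by omega)))).mono ?_
        push_cast
        linarith

end TensorString

end

/-! ### The hooks of strings in a tensor product and the signature rule modulo `q` -/

section

namespace TensorString

variable {M : Type*} [AddCommGroup M] [Module Fq M]
  {e f : Module.End Fq M} {t : ℤ → ℤ → M} {m n : ℕ}

/-- The vectors of total degree `P`. -/
def degreeSpan (t : ℤ → ℤ → M) (P : ℤ) : Submodule Fq M :=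
  Submodule.span Fq {v | ∃ j k, j + k = P ∧ v = t j k}

theorem comb_mem_degreeSpan (γ : ℕ → Fq) (P : ℤ) : comb t m γ P ∈ degreeSpan t P :=
  Submodule.sum_mem _ fun i _ => Submodule.smul_mem _ _
    (Submodule.subset_span ⟨i, P - i, by ring, rfl⟩)

theorem exists_comb (H : TensorString e f t m n) {P : ℤ} {v : M} (hv : v ∈ degreeSpan t P) :
    ∃ γ : ℕ → Fq, v = comb t m γ P := by
  induction hv using Submodule.span_induction with
  | mem v hv =>
    obtain ⟨j, k, hjk, rfl⟩ := hv
    by_cases h : 0 ≤ j ∧ j ≤ m ∧ 0 ≤ k ∧ k ≤ n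
    · lift j to ℕ using h.1
      refine ⟨fun i => if i = j then 1 else 0, ?_⟩
      rw [comb, Finset.sum_eq_single j]
      · rw [if_pos rfl, one_smul, ← hjk, add_sub_cancel_left]
      · intro i _ hi
        rw [if_neg hi, Fq_zero_smul]
      · intro hj
        exact absurd (Finset.mem_range.2 (by omega)) hj
    · exact ⟨0, by simp [H.zero j k h, comb, Fq_zero_smul]⟩
  | zero => exact ⟨0, by simp [comb, Fq_zero_smul]⟩
  | add v w _ _ h1 h2 =>
    obtain ⟨γ, rfl⟩ := h1
    obtain ⟨δ, rfl⟩ := h2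
    exact ⟨_, add_comb _ _ _⟩
  | smul c v _ h =>
    obtain ⟨γ, rfl⟩ := h
    exact ⟨_, smul_comb _ _ _⟩

theorem finite_range (H : TensorString e f t m n) : {v | ∃ j k, v = t j k}.Finite := by
  refine (((Set.finite_Icc (0 : ℤ) m).prod (Set.finite_Icc (0 : ℤ) n)).image
    (fun x => t x.1 x.2)).union (Set.finite_singleton 0) |>.subset ?_
  rintro _ ⟨j, k, rfl⟩
  by_cases h : 0 ≤ j ∧ j ≤ m ∧ 0 ≤ k ∧ k ≤ n
  · exact Or.inl ⟨(j, k), ⟨⟨h.1, h.2.1⟩, h.2.2⟩, rfl⟩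
  · exact Or.inr (H.zero j k h)

variable [Module Aq M] [IsScalarTower Aq Fq M]

/-- The `𝐀`-lattice spanned by the vectors `t j k`. -/
def lattice (t : ℤ → ℤ → M) : Submodule Aq M := Submodule.span Aq {v | ∃ j k, v = t j k}

omit [Module Fq M] [IsScalarTower Aq Fq M] in
theorem mem_lattice (j k : ℤ) : t j k ∈ lattice t := Submodule.subset_span ⟨j, k, rfl⟩

omit [Module Fq M] [IsScalarTower Aq Fq M] in
theorem lattice_flip (m n : ℤ) : lattice (fun j k => t (m - k) (n - j)) = lattice t := by
  unfold lattice
  congr 1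
  ext v
  constructor
  · rintro ⟨j, k, rfl⟩
    exact ⟨_, _, rfl⟩
  · rintro ⟨j, k, rfl⟩
    exact ⟨n - k, m - j, by simp⟩

/-- The first leg of the hook: by `s + p ≤ m` both exponents of `strCoeff_spec` are at least `1` off
the diagonal, so only `t_{s,p}` survives modulo `q`. -/
theorem divPow_hwVec_sub_mem (H : TensorString e f t m n) {p : ℕ} (hpm : p ≤ m) (hpn : p ≤ n)
    (s : ℕ) (hs : s + p ≤ m) : divPow f s (hwVec t m n p) - t s p ∈ qMul (lattice t) := by
  obtain ⟨ha, hb, hc⟩ := strCoeff_spec hpm hpn s hs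
  have hmem : s ∈ Finset.range (m + 1) := Finset.mem_range.2 (by omega)
  rw [H.divPow_hwVec, comb, ← Finset.add_sum_erase _ _ hmem, add_sub_right_comm]
  refine add_mem ?_ (Submodule.sum_mem _ fun i hi => ?_)
  · rw [add_sub_cancel_right]
    exact hc.smul_sub_mem_qMul (mem_lattice _ _)
  · rw [Finset.mem_erase, Finset.mem_range] at hi
    rcases lt_or_gt_of_ne hi.1 with h | h
    · refine ((ha i h.le).mono ?_).smul_mem_qMul (mem_lattice _ _)
      have h1 : (1 : ℤ) ≤ s - i := by omega
      have h2 : (1 : ℤ) ≤ m - p - i := by omega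
      nlinarith
    · rcases le_or_gt i (s + p) with h' | h'
      · refine ((hb i h.le h').mono ?_).smul_mem_qMul (mem_lattice _ _)
        have h1 : (1 : ℤ) ≤ i - s := by omega
        have h2 : (1 : ℤ) ≤ m - p + 1 - s := by omega
        nlinarith
      · rw [H.zero i (p + s - i) (by omega), smul_zero]
        exact zero_mem _

theorem dual_lattice {ψ : M →ₗ[Fq] Fq} (hψ : ∀ j k, ValGe 0 (ψ (t j k))) {v : M}
    (hv : v ∈ lattice t) : ValGe 0 (ψ v) := by
  induction hv using Submodule.span_induction with
  | mem v hv => obtain ⟨j, k, rfl⟩ := hv; exact hψ j k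
  | zero => simpa using ValGe.zero 0
  | add v w _ _ h1 h2 => rw [map_add]; exact h1.add h2
  | smul a v _ h =>
    rw [← algebraMap_smul Fq a, map_smul, smul_eq_mul]
    simpa using (valGe_algebraMap a).mul h

theorem lead_of_sub_mem {ψ : M →ₗ[Fq] Fq} (hψ : ∀ j k, ValGe 0 (ψ (t j k))) {v w : M}
    (hw : ψ w = 1) (hv : v - w ∈ qMul (lattice t)) : Lead 0 (ψ v) := by
  obtain ⟨y, hy, hyv⟩ := mem_qMul.1 hv
  obtain ⟨a, ha⟩ := (dual_lattice hψ hy).exists_eq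
  refine ⟨a, ?_⟩
  rw [eq_sub_iff_add_eq] at hyv
  rw [← hyv, map_add, map_smul, hw, ha, smul_eq_mul]
  simp [add_comm]

variable {Λ : Type*} [AddCommGroup Λ] {W : Λ → Submodule Fq M} {pr : Λ →+ ℤ} {α : Λ}

/-- Highest weight vectors whose strings approximate the vectors `t j k`. -/
theorem exists_hw (H : TensorString e f t m n) (S : SL2 W pr α e f) {lam : Λ}
    (hlam : pr lam = m + n) (ht : ∀ j k : ℤ, t j k ∈ W (lam - (j + k) • α)) {p : ℕ} (hpm : p ≤ m)
    (hpn : p ≤ n) :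
    ∃ w, w ∈ W (lam - (p : ℤ) • α) ∧ e w = 0 ∧ divPow f (m + n - 2 * p + 1) w = 0 ∧
      (∀ s : ℕ, s + p ≤ m → divPow f s w - t s p ∈ qMul (lattice t)) ∧
      (∀ s : ℕ, s + p ≤ n →
        divPow f (m + n - 2 * p - s) w - t (m - p) (n - s) ∈ qMul (lattice t)) := by
  set w := hwVec t m n p with hwdef
  set N := m + n - 2 * p with hN
  have hw : w ∈ W (lam - (p : ℤ) • α) := by
    rw [hwdef, hwVec, comb]
    refine Submodule.sum_mem _ fun i _ => Submodule.smul_mem _ _ ?_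
    have := ht i (p - i)
    rwa [add_sub_cancel] at this
  have he : e w = 0 := H.e_hwVec hpm
  have hpw : pr (lam - (p : ℤ) • α) = N := by rw [S.pairing_sub, hlam]; omega
  have htop : divPow f (N + 1) w = 0 := S.divPow_eq_zero hw he (by omega)
  have hz : f (divPow f N w) = 0 := by rw [← divPow_succ_smul, htop, smul_zero]
  refine ⟨w, hw, he, htop, H.divPow_hwVec_sub_mem hpm hpn, ?_⟩
  -- The second leg is the first leg of the flipped strings, climbed by `e` from the lowest weight
  -- vector `f^{(N)} w`. The degree `p + N` of that vector becomes `p` after the flip.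
  set t' : ℤ → ℤ → M := fun j k => t (m - k) (n - j) with ht'
  have H' : TensorString f e t' n m := H.flip
  obtain ⟨γ, hγ⟩ : ∃ γ : ℕ → Fq, divPow f N w = comb t' n γ p := by
    apply H'.exists_comb
    have h1 := H.divPow_hwVec p N
    rw [← hwdef] at h1
    rw [h1]
    have h2 := comb_mem_degreeSpan (t := t) (m := m) (strCoeff m n p N) (p + N)
    convert h2 using 1
    unfold degreeSpan
    congr 1
    ext v
    constructor
    · rintro ⟨j, k, hjk, rfl⟩
      exact ⟨_, _, by omega, rfl⟩
    · rintro ⟨j, k, hjk, rfl⟩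
      exact ⟨n - k, m - j, by omega, by simp [ht']⟩
  -- Uniqueness of the highest weight vector of degree `p`, applied to the flipped strings.
  have hd := H'.eq_smul_hwVec hpn hpm γ (by rw [← hγ, hz])
  rw [← hγ] at hd
  set d := γ 0
  have key : ∀ s : ℕ, s ≤ N → divPow f (N - s) w = d • divPow e s (hwVec t' n m p) := by
    intro s hs
    rw [← S.divPow_e_divPow_f hw he hpw hs, hd, map_smul]
  have hlat : lattice t' = lattice t := lattice_flip _ _
  have happ : ∀ s : ℕ, s + p ≤ n →
      divPow e s (hwVec t' n m p) - t (m - p) (n - s) ∈ qMul (lattice t) := by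
    intro s hs
    rw [← hlat]
    exact H'.divPow_hwVec_sub_mem hpn hpm s hs
  -- The corner `t_{m-p,p}` lies on both legs. Its coefficient in `f^{(m-p)} w` is in `1 + q𝐀` by
  -- the first leg and `d` times such an element by the second.
  have hlead : Lead 0 d := by
    obtain ⟨ψ, hψ⟩ := H.dual (m - p) p (by omega)
    have hψ' : ∀ j k, ValGe 0 (ψ (t j k)) := by
      intro j k
      rw [hψ]
      split_ifs
      · exact lead_one.valGe
      · exact ValGe.zero _
    have e1 := H.divPow_hwVec_sub_mem hpm hpn (m - p) (by omega)
    have e2 := happ (n - p) (by omega)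
    rw [Nat.cast_sub hpm] at e1
    rw [Nat.cast_sub hpn, show (n : ℤ) - (n - p) = p by ring] at e2
    have l1 := lead_of_sub_mem hψ' (by rw [hψ, if_pos ⟨rfl, rfl⟩]) e1
    have l2 := lead_of_sub_mem hψ' (by rw [hψ, if_pos ⟨rfl, rfl⟩]) e2
    have e3 := key (n - p) (by omega)
    rw [show N - (n - p) = m - p by omega] at e3
    rw [← hwdef, e3, map_smul, smul_eq_mul] at l1
    exact l1.unique l2
  intro s hs
  rw [key s (by omega)]
  have h1 := hlead.smul_sub_mem_qMul (X := lattice t) (v := divPow e s (hwVec t' n m p)) (by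
    have := add_mem (qMul_le _ (happ s hs)) (mem_lattice (t := t) (m - p) (n - s))
    rwa [sub_add_cancel] at this)
  have := add_mem h1 (happ s hs)
  rwa [sub_add_sub_cancel] at this

/-- The vector that the tensor product rule assigns to `f̃ (t j k)`. -/
def next (t : ℤ → ℤ → M) (m : ℕ) (j k : ℤ) : M := if k < m - j then t (j + 1) k else t j (k + 1)

/-- The vector that the tensor product rule assigns to `ẽ (t j k)`. -/
def prev (t : ℤ → ℤ → M) (m : ℕ) (j k : ℤ) : M := if k ≤ m - j then t (j - 1) k else t j (k - 1)

/-- The hooks cover the rectangle: `t_{j,k}` lies on the first leg for `p = k` if `j + k ≤ m`, and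
on the second leg for `p = m - j` otherwise. Its neighbours along the hook are `next` and `prev`. -/
theorem exists_string (H : TensorString e f t m n) (S : SL2 W pr α e f) {lam : Λ}
    (hlam : pr lam = m + n) (ht : ∀ j k : ℤ, t j k ∈ W (lam - (j + k) • α)) {j k : ℤ}
    (hjk : 0 ≤ j ∧ j ≤ m ∧ 0 ≤ k ∧ k ≤ n) :
    ∃ (mu : Λ) (w : M) (s : ℕ), w ∈ W mu ∧ e w = 0 ∧ (s : ℤ) ≤ pr mu ∧
      divPow f s w - t j k ∈ qMul (lattice t) ∧
      divPow f (s + 1) w - next t m j k ∈ qMul (lattice t) ∧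
      (s = 0 → prev t m j k = 0) ∧
      (∀ s', s = s' + 1 → divPow f s' w - prev t m j k ∈ qMul (lattice t)) := by
  obtain ⟨hj0, hjm, hk0, hkn⟩ := hjk
  lift j to ℕ using hj0
  lift k to ℕ using hk0
  rcases le_or_gt (j + k) m with h | h
  · obtain ⟨w, hw, he, htop, h1, h2⟩ := H.exists_hw S hlam ht (p := k) (by omega) (by omega)
    refine ⟨_, w, j, hw, he, by rw [S.pairing_sub, hlam]; omega, h1 j h, ?_, ?_, ?_⟩
    -- At the corner `j + k = m` the successor already lies on the second leg; it is zero if `k =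
    -- n`, where the string ends.
    · rcases h.eq_or_lt with h' | h'
      · rw [next, if_neg (by omega)]
        rcases Nat.eq_or_lt_of_le (show k ≤ n by omega) with h3 | h3
        · rw [show j + 1 = m + n - 2 * k + 1 by omega, htop, H.zero _ _ (by omega), sub_zero]
          exact zero_mem _
        · have := h2 (n - k - 1) (by omega)
          convert this using 3
          all_goals first | omega | (congr 1; omega)
      · rw [next, if_pos (by omega)]
        exact h1 (j + 1) (by omega)
    · intro hj
      rw [prev, if_pos (by omega), H.zero _ _ (by omega)]
    · intro s' hs'
      rw [prev, if_pos (by omega)]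
      have := h1 s' (by omega)
      convert this using 3
      omega
  · obtain ⟨w, hw, he, htop, h1, h2⟩ := H.exists_hw S hlam ht (p := m - j) (by omega) (by omega)
    have ej : (m : ℤ) - (m - j : ℕ) = j := by omega
    refine ⟨_, w, k + 2 * j - m, hw, he, by rw [S.pairing_sub, hlam]; omega, ?_, ?_, ?_, ?_⟩
    · have := h2 (n - k) (by omega)
      convert this using 3
      all_goals first | omega | (congr 1; omega)
    · rw [next, if_neg (by omega)]
      rcases Nat.eq_or_lt_of_le (show k ≤ n by omega) with h3 | h3
      · rw [show k + 2 * j - m + 1 = m + n - 2 * (m - j) + 1 by omega, htop,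
          H.zero _ _ (by omega), sub_zero]
        exact zero_mem _
      · have := h2 (n - k - 1) (by omega)
        convert this using 3
        all_goals first | omega | (congr 1; omega)
    · intro hj
      omega
    · intro s' hs'
      rw [prev, if_neg (by omega)]
      have := h2 (n - k + 1) (by omega)
      convert this using 3
      all_goals first | omega | (congr 1; omega)

/-- The tensor product rule for `f̃` on two strings. -/
theorem tildeF_rule (H : TensorString e f t m n) (S : SL2 W pr α e f) {lam : Λ}
    (hlam : pr lam = m + n) (ht : ∀ j k : ℤ, t j k ∈ W (lam - (j + k) • α))
    {T : Module.End Fq M}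
    (hT : ∀ mu, ∀ w ∈ W mu, e w = 0 → ∀ s, T (divPow f s w) = divPow f (s + 1) w) :
    (∀ x ∈ lattice t, T x ∈ lattice t) ∧ ∀ j k : ℤ, 0 ≤ j ∧ j ≤ m ∧ 0 ≤ k ∧ k ≤ n →
      T (t j k) - next t m j k ∈ qMul (lattice t) := by
  have hnext : ∀ j k, next t m j k ∈ lattice t := fun j k => by
    unfold next; split_ifs <;> exact mem_lattice _ _
  have hstab : ∀ x ∈ lattice t, T x ∈ lattice t := by
    refine stable_of_approx H.finite_range T ?_
    rintro _ ⟨j, k, rfl⟩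
    by_cases hjk : 0 ≤ j ∧ j ≤ m ∧ 0 ≤ k ∧ k ≤ n
    · obtain ⟨mu, w, s, hw, he, -, h1, h2, -, -⟩ := H.exists_string S hlam ht hjk
      refine ⟨divPow f s w, by rw [← neg_sub]; exact neg_mem h1, ?_⟩
      rw [hT mu w hw he]
      have := add_mem (qMul_le _ h2) (hnext j k)
      rwa [sub_add_cancel] at this
    · exact ⟨0, by simp [H.zero j k hjk], by simp⟩
  refine ⟨hstab, fun j k hjk => ?_⟩
  obtain ⟨mu, w, s, hw, he, -, h1, h2, -, -⟩ := H.exists_string S hlam ht hjk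
  -- `T` preserves the lattice, so it maps the error `f^{(s)} w - t_{j,k}` into `q` times the
  -- lattice.
  have := sub_mem h2 (map_mem_qMul hstab h1)
  rw [map_sub, hT mu w hw he] at this
  convert this using 1
  abel

/-- The tensor product rule for `ẽ` on two strings. -/
theorem tildeE_rule (H : TensorString e f t m n) (S : SL2 W pr α e f) {lam : Λ}
    (hlam : pr lam = m + n) (ht : ∀ j k : ℤ, t j k ∈ W (lam - (j + k) • α))
    {T : Module.End Fq M} (hT0 : ∀ mu, ∀ w ∈ W mu, e w = 0 → T w = 0)
    (hT : ∀ mu, ∀ w ∈ W mu, e w = 0 → ∀ s : ℕ, (s : ℤ) < pr mu →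
      T (divPow f (s + 1) w) = divPow f s w) :
    (∀ x ∈ lattice t, T x ∈ lattice t) ∧ ∀ j k : ℤ, 0 ≤ j ∧ j ≤ m ∧ 0 ≤ k ∧ k ≤ n →
      T (t j k) - prev t m j k ∈ qMul (lattice t) := by
  have hprev : ∀ j k, prev t m j k ∈ lattice t := fun j k => by
    unfold prev; split_ifs <;> exact mem_lattice _ _
  have key : ∀ j k : ℤ, 0 ≤ j ∧ j ≤ m ∧ 0 ≤ k ∧ k ≤ n → ∃ x, x - t j k ∈ qMul (lattice t) ∧
      T x - prev t m j k ∈ qMul (lattice t) := by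
    intro j k hjk
    obtain ⟨mu, w, s, hw, he, hs, h1, -, h2, h3⟩ := H.exists_string S hlam ht hjk
    refine ⟨divPow f s w, h1, ?_⟩
    rcases s with - | s
    · rw [h2 rfl, divPow_zero, Module.End.one_apply, hT0 mu w hw he, sub_zero]
      exact zero_mem _
    · rw [hT mu w hw he s (by push_cast at hs; omega)]
      exact h3 s rfl
  have hstab : ∀ x ∈ lattice t, T x ∈ lattice t := by
    refine stable_of_approx H.finite_range T ?_
    rintro _ ⟨j, k, rfl⟩
    by_cases hjk : 0 ≤ j ∧ j ≤ m ∧ 0 ≤ k ∧ k ≤ n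
    · obtain ⟨x, h1, h2⟩ := key j k hjk
      refine ⟨x, by rw [← neg_sub]; exact neg_mem h1, ?_⟩
      have := add_mem (qMul_le _ h2) (hprev j k)
      rwa [sub_add_cancel] at this
    · exact ⟨0, by simp [H.zero j k hjk], by simp⟩
  refine ⟨hstab, fun j k hjk => ?_⟩
  obtain ⟨x, h1, h2⟩ := key j k hjk
  have := sub_mem h2 (map_mem_qMul hstab h1)
  rw [map_sub] at this
  convert this using 1
  abel

end TensorString

end

section

/-! ### Representations of `U_q(𝔤𝔩(n))` in terms of operators -/

/-- `q` is not a root of unity, since otherwise `[a - b]` would vanish for some `a ≠ b`. -/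
theorem qpow_injective {a b : ℤ} (h : q ^ a = q ^ b) : a = b := by
  by_contra hab
  refine qz_ne_zero (sub_ne_zero.2 hab) ?_
  have h1 : q ^ (a - b) = 1 := by
    rw [zpow_sub₀ q_ne_zero, h, div_self (zpow_ne_zero _ q_ne_zero)]
  rw [qz, zpow_neg, h1]; simp

section Pairing

variable {r : ℕ}

/-- The pairing with `h` as a homomorphism. -/
def pairHom (h : Lat r) : Lat r →+ ℤ where
  toFun := pair h
  map_zero' := by simp [pair]
  map_add' := by simp [pair]

@[simp] theorem pairHom_apply (h μ : Lat r) : pairHom h μ = pair h μ := rfl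

theorem pair_add_right (h μ ν : Lat r) : pair h (μ + ν) = pair h μ + pair h ν :=
  map_add (pairHom h) μ ν

theorem pair_sub_right (h μ ν : Lat r) : pair h (μ - ν) = pair h μ - pair h ν :=
  map_sub (pairHom h) μ ν

theorem pair_zsmul_right (h μ : Lat r) (k : ℤ) : pair h (k • μ) = k * pair h μ :=
  (map_zsmul (pairHom h) k μ).trans (smul_eq_mul _ _)

theorem pair_comm (h μ : Lat r) : pair h μ = pair μ h := dotProduct_comm _ _

theorem pair_sub_left (h h' μ : Lat r) : pair (h - h') μ = pair h μ - pair h' μ := by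
  simp [pair]

theorem pair_neg_left (h μ : Lat r) : pair (-h) μ = -pair h μ := by simp [pair]

@[simp] theorem pair_kk (j : Fin (r + 1)) (μ : Lat r) : pair (kk j) μ = μ j := by
  simp [pair, kk]

theorem pair_hh (i : Fin r) (μ : Lat r) : pair (hh i) μ = μ i.castSucc - μ i.succ := by
  rw [hh, pair_sub_left, pair_kk, pair_kk]

theorem alpha_castSucc (i : Fin r) : alpha i i.castSucc = 1 := by
  simp [alpha, Fin.ext_iff]

theorem alpha_succ (i : Fin r) : alpha i i.succ = -1 := by
  simp [alpha, Fin.ext_iff]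

@[simp] theorem pair_hh_alpha (i : Fin r) : pair (hh i) (alpha i) = 2 := by
  rw [pair_hh, alpha_castSucc, alpha_succ]; norm_num

theorem alpha_ne_zero (i : Fin r) : alpha i ≠ 0 := by
  intro h
  have := pair_hh_alpha i
  rw [h] at this
  simp [pair] at this

theorem pair_hh_alpha_comm (i j : Fin r) : pair (hh i) (alpha j) = pair (hh j) (alpha i) :=
  pair_comm _ _

theorem pair_hh_alpha_adj {i j : Fin r} (hij : i.val + 1 = j.val ∨ j.val + 1 = i.val) :
    pair (hh i) (alpha j) = -1 := by
  rw [pair_hh]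
  simp only [alpha, Pi.sub_apply, Pi.single_apply, Fin.ext_iff, Fin.val_castSucc, Fin.val_succ]
  split_ifs <;> omega

theorem pair_hh_alpha_far {i j : Fin r} (hij : i.val + 1 < j.val ∨ j.val + 1 < i.val) :
    pair (hh i) (alpha j) = 0 := by
  rw [pair_hh]
  simp only [alpha, Pi.sub_apply, Pi.single_apply, Fin.ext_iff, Fin.val_castSucc, Fin.val_succ]
  split_ifs <;> omega

end Pairing

variable {r : ℕ}

/-- The operators `O` satisfy the defining relations of `U_q(𝔤𝔩(n))`. -/
structure GlOps.IsRep {M : Type*} [AddCommGroup M] [Module Fq M] (O : GlOps r M) : Prop where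
  K_zero : O.K 0 = 1
  K_add : ∀ h₁ h₂, O.K h₁ * O.K h₂ = O.K (h₁ + h₂)
  K_e : ∀ h i, O.K h * O.e i * O.K (-h) = q ^ pair h (alpha i) • O.e i
  K_f : ∀ h i, O.K h * O.f i * O.K (-h) = q ^ (-pair h (alpha i)) • O.f i
  e_f : ∀ i j, O.e i * O.f j - O.f j * O.e i =
    if i = j then (q - q⁻¹)⁻¹ • (O.K (hh i) - O.K (-hh i)) else 0
  e_e : ∀ i j : Fin r, (i.val + 1 < j.val ∨ j.val + 1 < i.val) → O.e i * O.e j - O.e j * O.e i = 0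
  f_f : ∀ i j : Fin r, (i.val + 1 < j.val ∨ j.val + 1 < i.val) → O.f i * O.f j - O.f j * O.f i = 0
  serre_e : ∀ i j : Fin r, (i.val + 1 = j.val ∨ j.val + 1 = i.val) →
    O.e i ^ 2 * O.e j - (q + q⁻¹) • (O.e i * O.e j * O.e i) + O.e j * O.e i ^ 2 = 0
  serre_f : ∀ i j : Fin r, (i.val + 1 = j.val ∨ j.val + 1 = i.val) →
    O.f i ^ 2 * O.f j - (q + q⁻¹) • (O.f i * O.f j * O.f i) + O.f j * O.f i ^ 2 = 0

section

variable {M : Type*} [AddCommGroup M] [Module Fq M]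

/-- Relations between the generators hold in every `U_q(𝔮(n))`-module. -/
theorem SuperRep.rel (R : SuperRep r M) {x y : FreeAlgebra Fq (QGen r)} (h : QRel r x y) :
    FreeAlgebra.lift Fq (fun g => R.ρ (Uq.gen g)) x =
      FreeAlgebra.lift Fq (fun g => R.ρ (Uq.gen g)) y := by
  have key : FreeAlgebra.lift Fq (fun g => R.ρ (Uq.gen g)) =
      R.ρ.comp (RingQuot.mkAlgHom Fq (QRel r)) := by
    ext g
    simp [Uq.gen]
  rw [key, AlgHom.comp_apply, AlgHom.comp_apply, RingQuot.mkAlgHom_rel Fq h]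

theorem SuperRep.ops_isRep (R : SuperRep r M) : R.ops.toGlOps.IsRep where
  K_zero := by simpa [SuperRep.ops, QGen.Q] using R.rel QRel.q_zero
  K_add h₁ h₂ := by simpa [SuperRep.ops, QGen.Q] using R.rel (QRel.q_add h₁ h₂)
  K_e h i := by simpa [SuperRep.ops, QGen.Q, QGen.E] using R.rel (QRel.q_e h i)
  K_f h i := by simpa [SuperRep.ops, QGen.Q, QGen.F] using R.rel (QRel.q_f h i)
  e_f i j := by
    have := R.rel (QRel.e_f i j)
    split_ifs at this ⊢ <;> simpa [SuperRep.ops, QGen.Q, QGen.F, QGen.E] using this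
  e_e i j h := by simpa [SuperRep.ops, QGen.E] using R.rel (QRel.e_e i j h)
  f_f i j h := by simpa [SuperRep.ops, QGen.F] using R.rel (QRel.f_f i j h)
  serre_e i j h := by simpa [SuperRep.ops, QGen.E] using R.rel (QRel.serre_e i j h)
  serre_f i j h := by simpa [SuperRep.ops, QGen.F] using R.rel (QRel.serre_f i j h)

theorem glOps_isRep (ρ : UqGl r →ₐ[Fq] Module.End Fq M) : (glOps ρ).IsRep := by
  have rel : ∀ {x y : FreeAlgebra Fq (GlGen r)}, GlRel r x y →
      FreeAlgebra.lift Fq (fun g => ρ (UqGl.gen g)) x =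
        FreeAlgebra.lift Fq (fun g => ρ (UqGl.gen g)) y := by
    intro x y h
    have key : FreeAlgebra.lift Fq (fun g => ρ (UqGl.gen g)) =
        ρ.comp (RingQuot.mkAlgHom Fq (GlRel r)) := by
      ext g
      simp [UqGl.gen]
    rw [key, AlgHom.comp_apply, AlgHom.comp_apply, RingQuot.mkAlgHom_rel Fq h]
  constructor
  case K_zero => simpa [glOps, GlGen.Q] using rel GlRel.q_zero
  case K_add => intro h₁ h₂; simpa [glOps, GlGen.Q] using rel (GlRel.q_add h₁ h₂)
  case K_e => intro h i; simpa [glOps, GlGen.Q, GlGen.E] using rel (GlRel.q_e h i)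
  case K_f => intro h i; simpa [glOps, GlGen.Q, GlGen.F] using rel (GlRel.q_f h i)
  case e_f =>
    intro i j
    have := rel (GlRel.e_f i j)
    split_ifs at this ⊢ <;> simpa [glOps, GlGen.Q, GlGen.F, GlGen.E] using this
  case e_e => intro i j h; simpa [glOps, GlGen.E] using rel (GlRel.e_e i j h)
  case f_f => intro i j h; simpa [glOps, GlGen.F] using rel (GlRel.f_f i j h)
  case serre_e => intro i j h; simpa [glOps, GlGen.E] using rel (GlRel.serre_e i j h)
  case serre_f => intro i j h; simpa [glOps, GlGen.F] using rel (GlRel.serre_f i j h)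

namespace GlOps.IsRep

variable {O : GlOps r M} (H : O.IsRep)
include H

theorem exists_hom : ∃ ρ : UqGl r →ₐ[Fq] Module.End Fq M, glOps ρ = O := by
  let g : GlGen r → Module.End Fq M := fun g => match g with
    | .e i => O.e i
    | .f i => O.f i
    | .qpow h => O.K h
  have hg : ∀ ⦃x y⦄, GlRel r x y → FreeAlgebra.lift Fq g x = FreeAlgebra.lift Fq g y := by
    intro x y h
    cases h with
    | q_zero => simpa [GlGen.Q, g] using H.K_zero
    | q_add h₁ h₂ => simpa [GlGen.Q, g] using H.K_add h₁ h₂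
    | q_e h i => simpa [GlGen.Q, GlGen.E, g] using H.K_e h i
    | q_f h i => simpa [GlGen.Q, GlGen.F, g] using H.K_f h i
    | e_f i j =>
      have := H.e_f i j
      split_ifs at this ⊢ <;> simpa [GlGen.Q, GlGen.F, GlGen.E, g] using this
    | e_e i j h => simpa [GlGen.E, g] using H.e_e i j h
    | f_f i j h => simpa [GlGen.F, g] using H.f_f i j h
    | serre_e i j h => simpa [GlGen.E, g] using H.serre_e i j h
    | serre_f i j h => simpa [GlGen.F, g] using H.serre_f i j h
  refine ⟨RingQuot.liftAlgHom Fq ⟨FreeAlgebra.lift Fq g, hg⟩, ?_⟩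
  have key : ∀ x, RingQuot.liftAlgHom Fq ⟨FreeAlgebra.lift Fq g, hg⟩ (UqGl.gen x) = g x := by
    intro x
    rw [UqGl.gen, RingQuot.liftAlgHom_mkAlgHom_apply, FreeAlgebra.lift_ι_apply]
  simp only [glOps, key]
  rfl

theorem K_mul_neg (h : Lat r) : O.K h * O.K (-h) = 1 := by
  rw [H.K_add, add_neg_cancel, H.K_zero]

theorem K_neg_mul (h : Lat r) : O.K (-h) * O.K h = 1 := by
  rw [H.K_add, neg_add_cancel, H.K_zero]

theorem K_mul_e (h : Lat r) (i : Fin r) :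
    O.K h * O.e i = q ^ pair h (alpha i) • (O.e i * O.K h) := by
  rw [← smul_mul_assoc, ← H.K_e, mul_assoc _ (O.K (-h)), H.K_neg_mul, mul_one]

theorem K_mul_f (h : Lat r) (i : Fin r) :
    O.K h * O.f i = q ^ (-pair h (alpha i)) • (O.f i * O.K h) := by
  rw [← smul_mul_assoc, ← H.K_f, mul_assoc _ (O.K (-h)), H.K_neg_mul, mul_one]

theorem K_comm (h h' : Lat r) : O.K h * O.K h' = O.K h' * O.K h := by
  rw [H.K_add, H.K_add, add_comm]

omit H in
theorem _root_.QueerCrystal.GlOps.mem_weightSpace {μ : Lat r} {u : M} :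
    u ∈ O.weightSpace μ ↔ ∀ h, O.K h u = q ^ pair h μ • u := by
  simp [GlOps.weightSpace, sub_eq_zero]

/-- Weight spaces lie in joint eigenspaces of the commuting operators `K h`, and distinct weights
have distinct systems of eigenvalues, since `q^{μ_j}` determines `μ_j`. -/
theorem weightSpace_independent : iSupIndep O.weightSpace := by
  have h := Module.End.independent_iInf_maxGenEigenspace_of_forall_mapsTo O.K (by
    intro h h' μ
    exact Module.End.mapsTo_maxGenEigenspace_of_comm (H.K_comm h' h) μ)
  have hinj : Function.Injective fun (μ : Lat r) (h : Lat r) => q ^ pair h μ := by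
    intro μ ν hμν
    ext j
    simpa using qpow_injective (congrFun hμν (kk j))
  refine (h.comp hinj).mono fun μ => ?_
  refine le_iInf fun h => ?_
  intro u hu
  refine Module.End.mem_maxGenEigenspace _ _ _ |>.2 ⟨1, ?_⟩
  rw [pow_one, LinearMap.sub_apply, GlOps.mem_weightSpace.1 hu h]
  simp

theorem e_mem {μ : Lat r} {u : M} (i : Fin r) (hu : u ∈ O.weightSpace μ) :
    O.e i u ∈ O.weightSpace (μ + alpha i) := by
  rw [GlOps.mem_weightSpace] at hu ⊢
  intro h
  rw [← Module.End.mul_apply, H.K_mul_e, LinearMap.smul_apply, Module.End.mul_apply, hu h,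
    map_smul, smul_smul, ← zpow_add₀ q_ne_zero, pair_add_right, add_comm]

theorem f_mem {μ : Lat r} {u : M} (i : Fin r) (hu : u ∈ O.weightSpace μ) :
    O.f i u ∈ O.weightSpace (μ - alpha i) := by
  rw [GlOps.mem_weightSpace] at hu ⊢
  intro h
  rw [← Module.End.mul_apply, H.K_mul_f, LinearMap.smul_apply, Module.End.mul_apply, hu h,
    map_smul, smul_smul, ← zpow_add₀ q_ne_zero, pair_sub_right, neg_add_eq_sub]

theorem e_f_apply {μ : Lat r} {u : M} (i : Fin r) (hu : u ∈ O.weightSpace μ) :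
    O.e i (O.f i u) = O.f i (O.e i u) + qz (pair (hh i) μ) • u := by
  have := congrArg (fun T : Module.End Fq M => T u) (H.e_f i i)
  simp only [if_true, LinearMap.sub_apply, Module.End.mul_apply, LinearMap.smul_apply,
    GlOps.mem_weightSpace.1 hu, pair_neg_left, ← sub_smul, smul_smul] at this
  rw [sub_eq_iff_eq_add'] at this
  rw [this, qz, div_eq_inv_mul]

/-- `T` shifts weights by `β ≠ 0`, and a finite-dimensional module has only finitely many nonzero
weight spaces. -/
theorem nilpotent [Module.Finite Fq M] (T : Module.End Fq M) {β : Lat r} (hβ : β ≠ 0)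
    (hT : ∀ {μ u}, u ∈ O.weightSpace μ → T u ∈ O.weightSpace (μ + β)) {μ : Lat r} {u : M}
    (hu : u ∈ O.weightSpace μ) : ∃ k, (T ^ k) u = 0 := by
  have hmem : ∀ k : ℕ, (T ^ k) u ∈ O.weightSpace (μ + (k : ℤ) • β) := by
    intro k
    induction k with
    | zero => simpa using hu
    | succ k ih =>
      rw [pow_succ', Module.End.mul_apply]
      convert hT ih using 2
      push_cast; module
  have hfin := WellFoundedGT.finite_ne_bot_of_iSupIndep H.weightSpace_independent
  by_contra! hne
  have hinj : Function.Injective fun k : ℕ => μ + (k : ℤ) • β := by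
    intro k l hkl
    have := add_left_cancel hkl
    simpa using smul_left_injective ℤ hβ this
  refine Set.infinite_of_injective_forall_mem hinj (fun k => ?_) hfin
  exact fun h => hne k ((Submodule.eq_bot_iff _).1 h _ (hmem k))

theorem sl2 [Module.Finite Fq M] (i : Fin r) :
    SL2 O.weightSpace (pairHom (hh i)) (alpha i) (O.e i) (O.f i) where
  two := pair_hh_alpha i
  e_mem := H.e_mem i
  f_mem := H.f_mem i
  comm := H.e_f_apply i
  nil_e := H.nilpotent _ (alpha_ne_zero i) (H.e_mem i)
  nil_f := H.nilpotent _ (neg_ne_zero.2 (alpha_ne_zero i)) (by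
    intro μ u hu
    rw [← sub_eq_add_neg]; exact H.f_mem i hu)

end GlOps.IsRep

end

end

section

variable {r : ℕ}

/-! ### Tensor products of representations -/

/-- The action of `U_q(𝔤𝔩(n))` on a tensor product. -/
def GlOps.tensor {M₁ M₂ : Type*} [AddCommGroup M₁] [Module Fq M₁]
    [AddCommGroup M₂] [Module Fq M₂] (O₁ : GlOps r M₁) (O₂ : GlOps r M₂) :
    GlOps r (M₁ ⊗[Fq] M₂) where
  K h := TensorProduct.map (O₁.K h) (O₂.K h)
  e i := TensorProduct.map (O₁.e i) (O₂.K (-hh i)) + TensorProduct.map 1 (O₂.e i)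
  f i := TensorProduct.map (O₁.f i) 1 + TensorProduct.map (O₁.K (hh i)) (O₂.f i)

/-- The quantum Serre relation for sums of `q`-commuting elements. -/
theorem serre_add {k A : Type*} [Field k] [Ring A] [Algebra k A] {q : k} (h0 : q ≠ 0)
    {a b c d : A}
    (hab : a * b = (q⁻¹ * q⁻¹) • (b * a)) (had : a * d = q • (d * a)) (hcb : c * b = q • (b * c))
    (hac : a ^ 2 * c - (q + q⁻¹) • (a * c * a) + c * a ^ 2 = 0)
    (hbd : b ^ 2 * d - (q + q⁻¹) • (b * d * b) + d * b ^ 2 = 0) :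
    (a + b) ^ 2 * (c + d) - (q + q⁻¹) • ((a + b) * (c + d) * (a + b)) + (c + d) * (a + b) ^ 2
      = 0 := by
  have hab' : ∀ x, a * (b * x) = (q⁻¹ * q⁻¹) • (b * (a * x)) := fun x => by
    rw [← mul_assoc, hab, smul_mul_assoc, mul_assoc]
  have had' : ∀ x, a * (d * x) = q • (d * (a * x)) := fun x => by
    rw [← mul_assoc, had, smul_mul_assoc, mul_assoc]
  have hcb' : ∀ x, c * (b * x) = q • (b * (c * x)) := fun x => by
    rw [← mul_assoc, hcb, smul_mul_assoc, mul_assoc]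
  trans (a ^ 2 * c - (q + q⁻¹) • (a * c * a) + c * a ^ 2) +
    (b ^ 2 * d - (q + q⁻¹) • (b * d * b) + d * b ^ 2)
  -- The rules move `b` and `d` to the left of `a` and `c`; the mixed monomials then cancel and the
  -- two given relations remain.
  · simp only [pow_two, mul_add, add_mul, mul_assoc, hab, had, hcb, hab', had', hcb',
      mul_smul_comm, smul_mul_assoc]
    match_scalars <;> field_simp <;> ring
  · rw [hac, hbd, add_zero]

section

variable {M₁ M₂ : Type*} [AddCommGroup M₁] [Module Fq M₁] [AddCommGroup M₂] [Module Fq M₂]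
  {O₁ : GlOps r M₁} {O₂ : GlOps r M₂}

theorem map_mul_map (a b : Module.End Fq M₁) (c d : Module.End Fq M₂) :
    TensorProduct.map a c * TensorProduct.map b d = TensorProduct.map (a * b) (c * d) :=
  (TensorProduct.map_mul _ _ _ _).symm

theorem tensorMap_sub_left (a b : Module.End Fq M₁) (c : Module.End Fq M₂) :
    TensorProduct.map (a - b) c = TensorProduct.map a c - TensorProduct.map b c := by
  rw [eq_sub_iff_add_eq, ← TensorProduct.map_add_left, sub_add_cancel]

theorem tensorMap_sub_right (a : Module.End Fq M₁) (c d : Module.End Fq M₂) :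
    TensorProduct.map a (c - d) = TensorProduct.map a c - TensorProduct.map a d := by
  rw [eq_sub_iff_add_eq, ← TensorProduct.map_add_right, sub_add_cancel]

theorem qpow_zero : q ^ (0 : ℤ) = (1 : Fq) := zpow_zero q

theorem qpow_neg_two : q ^ (-2 : ℤ) = q⁻¹ * q⁻¹ := by
  rw [zpow_neg, ← mul_inv, ← pow_two]; rfl

/-- The two summands of the coproducts of `e_i` and `e_j` commute up to the powers of `q` that
`serre_add` requires. Within each summand the relation is that of one tensor factor, as the
operators `K` commute. -/
theorem GlOps.IsRep.tensor_serre_e (H₁ : O₁.IsRep) (H₂ : O₂.IsRep) {i j : Fin r}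
    (hij : i.val + 1 = j.val ∨ j.val + 1 = i.val) :
    (O₁.tensor O₂).e i ^ 2 * (O₁.tensor O₂).e j - (q + q⁻¹) •
      ((O₁.tensor O₂).e i * (O₁.tensor O₂).e j * (O₁.tensor O₂).e i) +
        (O₁.tensor O₂).e j * (O₁.tensor O₂).e i ^ 2 = 0 := by
  refine serre_add (k := Fq) (a := TensorProduct.map (O₁.e i) (O₂.K (-hh i)))
    (b := TensorProduct.map 1 (O₂.e i)) (c := TensorProduct.map (O₁.e j) (O₂.K (-hh j)))
    (d := TensorProduct.map 1 (O₂.e j)) q_ne_zero ?_ ?_ ?_ ?_ ?_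
  · rw [map_mul_map, map_mul_map, H₂.K_mul_e, pair_neg_left, pair_hh_alpha, mul_one, one_mul,
      TensorProduct.map_smul_right, qpow_neg_two]
  · rw [map_mul_map, map_mul_map, H₂.K_mul_e, pair_neg_left, pair_hh_alpha_adj hij, neg_neg,
      zpow_one, mul_one, one_mul, TensorProduct.map_smul_right]
  · rw [map_mul_map, map_mul_map, H₂.K_mul_e, pair_neg_left, pair_hh_alpha_comm,
      pair_hh_alpha_adj hij, neg_neg, zpow_one, mul_one, one_mul, TensorProduct.map_smul_right]
  · have h1 : O₂.K (-hh i) * O₂.K (-hh j) * O₂.K (-hh i) =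
        O₂.K (-hh i) * O₂.K (-hh i) * O₂.K (-hh j) := by
      rw [mul_assoc, H₂.K_comm (-hh j), mul_assoc]
    have h2 : O₂.K (-hh j) * (O₂.K (-hh i) * O₂.K (-hh i)) =
        O₂.K (-hh i) * O₂.K (-hh i) * O₂.K (-hh j) := by
      rw [H₂.K_add, H₂.K_comm]
    have h3 := H₁.serre_e i j hij
    simp only [pow_two, map_mul_map] at h3 ⊢
    rw [h1, h2, ← TensorProduct.map_smul_left, ← tensorMap_sub_left,
      ← TensorProduct.map_add_left, h3, TensorProduct.map_zero_left]
  · have h3 := H₂.serre_e i j hij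
    simp only [pow_two, map_mul_map, mul_one] at h3 ⊢
    rw [← TensorProduct.map_smul_right, ← tensorMap_sub_right,
      ← TensorProduct.map_add_right, h3, TensorProduct.map_zero_right]

theorem GlOps.IsRep.tensor_serre_f (H₁ : O₁.IsRep) (H₂ : O₂.IsRep) {i j : Fin r}
    (hij : i.val + 1 = j.val ∨ j.val + 1 = i.val) :
    (O₁.tensor O₂).f i ^ 2 * (O₁.tensor O₂).f j - (q + q⁻¹) •
      ((O₁.tensor O₂).f i * (O₁.tensor O₂).f j * (O₁.tensor O₂).f i) +
        (O₁.tensor O₂).f j * (O₁.tensor O₂).f i ^ 2 = 0 := by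
  have hf : ∀ i, (O₁.tensor O₂).f i = TensorProduct.map (O₁.K (hh i)) (O₂.f i) +
      TensorProduct.map (O₁.f i) 1 := fun i => add_comm _ _
  rw [hf i, hf j]
  refine serre_add (k := Fq) (a := TensorProduct.map (O₁.K (hh i)) (O₂.f i))
    (b := TensorProduct.map (O₁.f i) 1) (c := TensorProduct.map (O₁.K (hh j)) (O₂.f j))
    (d := TensorProduct.map (O₁.f j) 1) q_ne_zero ?_ ?_ ?_ ?_ ?_
  · rw [map_mul_map, map_mul_map, H₁.K_mul_f, pair_hh_alpha, mul_one, one_mul,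
      TensorProduct.map_smul_left, qpow_neg_two]
  · rw [map_mul_map, map_mul_map, H₁.K_mul_f, pair_hh_alpha_adj hij, neg_neg,
      zpow_one, mul_one, one_mul, TensorProduct.map_smul_left]
  · rw [map_mul_map, map_mul_map, H₁.K_mul_f, pair_hh_alpha_comm,
      pair_hh_alpha_adj hij, neg_neg, zpow_one, mul_one, one_mul, TensorProduct.map_smul_left]
  · have h1 : O₁.K (hh i) * O₁.K (hh j) * O₁.K (hh i) =
        O₁.K (hh i) * O₁.K (hh i) * O₁.K (hh j) := by
      rw [mul_assoc, H₁.K_comm (hh j), mul_assoc]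
    have h2 : O₁.K (hh j) * (O₁.K (hh i) * O₁.K (hh i)) =
        O₁.K (hh i) * O₁.K (hh i) * O₁.K (hh j) := by
      rw [H₁.K_add, H₁.K_comm]
    have h3 := H₂.serre_f i j hij
    simp only [pow_two, map_mul_map] at h3 ⊢
    rw [h1, h2, ← TensorProduct.map_smul_right, ← tensorMap_sub_right,
      ← TensorProduct.map_add_right, h3, TensorProduct.map_zero_right]
  · have h3 := H₁.serre_f i j hij
    simp only [pow_two, map_mul_map, mul_one] at h3 ⊢
    rw [← TensorProduct.map_smul_left, ← tensorMap_sub_left,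
      ← TensorProduct.map_add_left, h3, TensorProduct.map_zero_left]

theorem GlOps.IsRep.tensor (H₁ : O₁.IsRep) (H₂ : O₂.IsRep) : (O₁.tensor O₂).IsRep := by
  constructor
  case K_zero => simp only [GlOps.tensor, H₁.K_zero, H₂.K_zero, TensorProduct.map_one]
  case K_add => intro h₁ h₂; simp only [GlOps.tensor, map_mul_map, H₁.K_add, H₂.K_add]
  case K_e =>
    intro h i
    have h1 : O₂.K h * O₂.K (-hh i) * O₂.K (-h) = O₂.K (-hh i) := by
      rw [H₂.K_add, H₂.K_add]; congr 1; abel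
    have h2 : O₁.K h * 1 * O₁.K (-h) = 1 := by rw [mul_one, H₁.K_mul_neg]
    simp only [GlOps.tensor, map_mul_map, mul_add, add_mul, H₁.K_e, H₂.K_e, h1, h2, smul_add,
      TensorProduct.map_smul_left, TensorProduct.map_smul_right]
  case K_f =>
    intro h i
    have h1 : O₁.K h * O₁.K (hh i) * O₁.K (-h) = O₁.K (hh i) := by
      rw [H₁.K_add, H₁.K_add]; congr 1; abel
    have h2 : O₂.K h * 1 * O₂.K (-h) = 1 := by rw [mul_one, H₂.K_mul_neg]
    simp only [GlOps.tensor, map_mul_map, mul_add, add_mul, H₁.K_f, H₂.K_f, h1, h2, smul_add,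
      TensorProduct.map_smul_left, TensorProduct.map_smul_right]
  case e_f =>
    intro i j
    -- The powers of `q` arising in the two factors cancel, so the cross terms drop out of the
    -- commutator.
    have h1 : TensorProduct.map (O₁.e i * O₁.K (hh j)) (O₂.K (-hh i) * O₂.f j) =
        TensorProduct.map (O₁.K (hh j) * O₁.e i) (O₂.f j * O₂.K (-hh i)) := by
      rw [H₁.K_mul_e, H₂.K_mul_f, TensorProduct.map_smul_left, TensorProduct.map_smul_right,
        pair_neg_left, neg_neg, pair_hh_alpha_comm]
    have e1 := H₁.e_f i j
    have e2 := H₂.e_f i j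
    have key : (O₁.tensor O₂).e i * (O₁.tensor O₂).f j - (O₁.tensor O₂).f j * (O₁.tensor O₂).e i =
        TensorProduct.map (O₁.e i * O₁.f j - O₁.f j * O₁.e i) (O₂.K (-hh i)) +
        TensorProduct.map (O₁.K (hh j)) (O₂.e i * O₂.f j - O₂.f j * O₂.e i) := by
      simp only [GlOps.tensor, mul_add, add_mul, map_mul_map, one_mul, mul_one, h1,
        tensorMap_sub_left, tensorMap_sub_right]
      abel
    rw [key, e1, e2]
    split_ifs with h
    · subst h
      simp only [TensorProduct.map_smul_left, TensorProduct.map_smul_right, ← smul_add,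
        tensorMap_sub_left, tensorMap_sub_right, GlOps.tensor]
      congr 1
      abel
    · simp
  case e_e =>
    intro i j hij
    have h1 := sub_eq_zero.1 (H₁.e_e i j hij)
    have h2 := sub_eq_zero.1 (H₂.e_e i j hij)
    have h3 : O₂.K (-hh i) * O₂.e j = O₂.e j * O₂.K (-hh i) := by
      rw [H₂.K_mul_e, pair_neg_left, pair_hh_alpha_far hij, neg_zero, qpow_zero]
      exact LinearMap.ext fun v => one_smul Fq _
    have h4 : O₂.K (-hh j) * O₂.e i = O₂.e i * O₂.K (-hh j) := by
      rw [H₂.K_mul_e, pair_neg_left, pair_hh_alpha_comm, pair_hh_alpha_far hij, neg_zero, qpow_zero]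
      exact LinearMap.ext fun v => one_smul Fq _
    simp only [GlOps.tensor, mul_add, add_mul, map_mul_map, one_mul, mul_one, h1, h2, h3, h4,
      H₂.K_comm (-hh i)]
    abel
  case f_f =>
    intro i j hij
    have h1 := sub_eq_zero.1 (H₁.f_f i j hij)
    have h2 := sub_eq_zero.1 (H₂.f_f i j hij)
    have h3 : O₁.K (hh i) * O₁.f j = O₁.f j * O₁.K (hh i) := by
      rw [H₁.K_mul_f, pair_hh_alpha_far hij, neg_zero, qpow_zero]
      exact LinearMap.ext fun v => one_smul Fq _
    have h4 : O₁.K (hh j) * O₁.f i = O₁.f i * O₁.K (hh j) := by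
      rw [H₁.K_mul_f, pair_hh_alpha_comm, pair_hh_alpha_far hij, neg_zero, qpow_zero]
      exact LinearMap.ext fun v => one_smul Fq _
    simp only [GlOps.tensor, mul_add, add_mul, map_mul_map, one_mul, mul_one, h1, h2, h3, h4,
      H₁.K_comm (hh i)]
    abel
  case serre_e => intro i j hij; exact H₁.tensor_serre_e H₂ hij
  case serre_f => intro i j hij; exact H₁.tensor_serre_f H₂ hij

theorem tmul_mem_weightSpace {μ ν : Lat r} {x : M₁} {y : M₂} (hx : x ∈ O₁.weightSpace μ)
    (hy : y ∈ O₂.weightSpace ν) : x ⊗ₜ[Fq] y ∈ (O₁.tensor O₂).weightSpace (μ + ν) := by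
  rw [GlOps.mem_weightSpace] at *
  intro h
  simp only [GlOps.tensor, TensorProduct.map_tmul, hx h, hy h]
  rw [TensorProduct.smul_tmul_smul, pair_add_right, zpow_add₀ q_ne_zero]

theorem GlOps.IsWeightModule.tensor (H₁ : O₁.IsRep) (H₂ : O₂.IsRep) (h₁ : O₁.IsWeightModule)
    (h₂ : O₂.IsWeightModule) : (O₁.tensor O₂).IsWeightModule := by
  refine ⟨(H₁.tensor H₂).weightSpace_independent, ?_⟩
  rw [eq_top_iff]
  rintro z -
  have h1 : ∀ x : M₁, x ∈ ⨆ μ, O₁.weightSpace μ := fun x => h₁.2 ▸ Submodule.mem_top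
  have h2 : ∀ y : M₂, y ∈ ⨆ μ, O₂.weightSpace μ := fun y => h₂.2 ▸ Submodule.mem_top
  induction z using TensorProduct.induction_on with
  | zero => exact zero_mem _
  | add z w hz hw => exact add_mem hz hw
  | tmul x y =>
    refine Submodule.iSup_induction _ (motive := fun x => x ⊗ₜ[Fq] y ∈ _) (h1 x) ?_ ?_ ?_
    · intro μ x hx
      refine Submodule.iSup_induction _ (motive := fun y => x ⊗ₜ[Fq] y ∈ _) (h2 y) ?_ ?_ ?_
      · intro ν y hy
        exact Submodule.mem_iSup_of_mem _ (tmul_mem_weightSpace hx hy)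
      · rw [TensorProduct.tmul_zero]; exact zero_mem _
      · intro y y' hy hy'
        rw [TensorProduct.tmul_add]; exact add_mem hy hy'
    · rw [TensorProduct.zero_tmul]; exact zero_mem _
    · intro x x' hx hx'
      rw [TensorProduct.add_tmul]; exact add_mem hx hx'

end

/-! ### The Kashiwara operators -/

/-- `O` describes a finite-dimensional weight module of `U_q(𝔤𝔩(n))`. -/
structure GlOps.Good {M : Type*} [AddCommGroup M] [Module Fq M] (O : GlOps r M) : Prop where
  isRep : O.IsRep
  weight : O.IsWeightModule
  finite : Module.Finite Fq M

theorem GlOps.Good.tensor {M₁ M₂ : Type*} [AddCommGroup M₁] [Module Fq M₁] [AddCommGroup M₂]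
    [Module Fq M₂] {O₁ : GlOps r M₁} {O₂ : GlOps r M₂} (H₁ : O₁.Good) (H₂ : O₂.Good) :
    (O₁.tensor O₂).Good where
  isRep := H₁.isRep.tensor H₂.isRep
  weight := GlOps.IsWeightModule.tensor H₁.isRep H₂.isRep H₁.weight H₂.weight
  finite := by
    have := H₁.finite
    have := H₂.finite
    infer_instance

namespace GlOps.Good

variable {M : Type*} [AddCommGroup M] [Module Fq M] {O : GlOps r M} (H : O.Good) (i : Fin r)
include H

theorem sl2 : SL2 O.weightSpace (pairHom (hh i)) (alpha i) (O.e i) (O.f i) :=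
  have := H.finite
  H.isRep.sl2 i

theorem isTildeE : O.IsTildeE i (O.tildeE i) := by
  have h : ∃ T, O.IsTildeE i T := (H.sl2 i).exists_operator H.weight.1 H.weight.2
    (fun k => if k = 0 then 0 else divPow (O.f i) (k - 1)) |>.imp fun T hT μ u hu => by
      rw [hT μ u hu]
      refine Finset.sum_congr rfl fun k _ => ?_
      by_cases hk : k = 0 <;> simp [hk]
  rw [GlOps.tildeE, dif_pos h]
  exact h.choose_spec

theorem isTildeF : O.IsTildeF i (O.tildeF i) := by
  have h : ∃ T, O.IsTildeF i T := (H.sl2 i).exists_operator H.weight.1 H.weight.2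
    (fun k => divPow (O.f i) (k + 1))
  rw [GlOps.tildeF, dif_pos h]
  exact h.choose_spec

variable {i} {μ : Lat r} {w : M} (hw : w ∈ O.weightSpace μ) (he : O.e i w = 0)
include hw he

/-- No bound on `k` is needed: past the end of the string both sides vanish. -/
theorem tildeF_divPow (k : ℕ) :
    O.tildeF i (divPow (O.f i) k w) = divPow (O.f i) (k + 1) w := by
  rcases le_or_gt (k : ℤ) (pairHom (hh i) μ) with h | h
  · have h1 : IsStr O.weightSpace (pairHom (hh i)) (alpha i) (O.e i) (μ - (k : ℤ) • alpha i)
        (Finsupp.single k w) := SL2.isStr_single hw he (by abel) h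
    have := H.isTildeF i _ _ h1
    rwa [Finsupp.sum_single_index (by simp), Finsupp.sum_single_index (by simp)] at this
  · rw [(H.sl2 i).divPow_eq_zero hw he h, (H.sl2 i).divPow_eq_zero hw he (by push_cast; omega),
      map_zero]

theorem tildeE_divPow {k : ℕ} (hk : (k : ℤ) ≤ pairHom (hh i) μ) :
    O.tildeE i (divPow (O.f i) k w) = if k = 0 then 0 else divPow (O.f i) (k - 1) w := by
  have h1 : IsStr O.weightSpace (pairHom (hh i)) (alpha i) (O.e i) (μ - (k : ℤ) • alpha i)
      (Finsupp.single k w) := SL2.isStr_single hw he (by abel) hk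
  have := H.isTildeE i _ _ h1
  rwa [Finsupp.sum_single_index (by simp), Finsupp.sum_single_index (by simp)] at this

theorem tildeE_eq_zero : O.tildeE i w = 0 := by
  by_cases h0 : w = 0
  · rw [h0, map_zero]
  have h : 0 ≤ pairHom (hh i) μ := by
    by_contra! h
    exact h0 ((H.sl2 i).eq_zero_of_neg hw he h)
  simpa using H.tildeE_divPow hw he (k := 0) (by simpa using h)

theorem tildeE_divPow_succ {k : ℕ} (hk : (k : ℤ) < pairHom (hh i) μ) :
    O.tildeE i (divPow (O.f i) (k + 1) w) = divPow (O.f i) k w := by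
  simpa using H.tildeE_divPow hw he (k := k + 1) (by push_cast; omega)

end GlOps.Good

end

section

variable {r : ℕ}

/-! ### Tensor products of strings -/

section strVec

variable {M : Type*} [AddCommGroup M] [Module Fq M]

/-- The vector `f^{(j)} w`, with the convention that it is zero for negative `j`. -/
def strVec (f : Module.End Fq M) (w : M) (j : ℤ) : M := if 0 ≤ j then divPow f j.toNat w else 0

theorem strVec_natCast (f : Module.End Fq M) (w : M) (j : ℕ) :
    strVec f w j = divPow f j w := by simp [strVec]

theorem strVec_of_neg (f : Module.End Fq M) (w : M) {j : ℤ} (hj : j < 0) : strVec f w j = 0 := by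
  rw [strVec, if_neg (by omega)]

theorem f_strVec (f : Module.End Fq M) (w : M) (j : ℤ) :
    f (strVec f w j) = qz (j + 1) • strVec f w (j + 1) := by
  rcases lt_trichotomy j (-1) with h | h | h
  · rw [strVec_of_neg _ _ (by omega), strVec_of_neg _ _ (by omega), map_zero, smul_zero]
  · subst h
    rw [strVec_of_neg _ _ (by omega)]
    simp [Fq_zero_smul]
  · lift j to ℕ using (by omega)
    have := strVec_natCast f w (j + 1)
    push_cast at this
    rw [this, strVec_natCast, divPow_succ_smul]

variable {O : GlOps r M} (H : O.Good) {i : Fin r} {μ : Lat r} {w : M} (hw : w ∈ O.weightSpace μ)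
  (he : O.e i w = 0) {m : ℕ} (hm : pair (hh i) μ = m)
include H hw he hm

theorem strVec_eq_zero {j : ℤ} (hj : ¬ (0 ≤ j ∧ j ≤ m)) : strVec (O.f i) w j = 0 := by
  by_cases h : 0 ≤ j
  · lift j to ℕ using h
    rw [strVec_natCast]
    exact (H.sl2 i).divPow_eq_zero hw he (by simp only [pairHom_apply]; omega)
  · exact strVec_of_neg _ _ (by omega)

omit he hm in
theorem strVec_mem (j : ℤ) : strVec (O.f i) w j ∈ O.weightSpace (μ - j • alpha i) := by
  by_cases h : 0 ≤ j
  · lift j to ℕ using h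
    rw [strVec_natCast]
    exact (H.sl2 i).divPow_mem hw j
  · rw [strVec_of_neg _ _ (by omega)]
    exact zero_mem _

theorem e_strVec (j : ℤ) :
    O.e i (strVec (O.f i) w j) = qz (m - j + 1) • strVec (O.f i) w (j - 1) := by
  rcases lt_trichotomy j 0 with h | h | h
  · rw [strVec_of_neg _ _ (by omega), strVec_of_neg _ _ (by omega), map_zero, smul_zero]
  · subst h
    rw [strVec_of_neg (j := 0 - 1) _ _ (by omega)]
    have := strVec_natCast (O.f i) w 0
    simp only [Nat.cast_zero] at this
    simp [this, he]
  · obtain ⟨k, rfl⟩ : ∃ k : ℕ, j = k + 1 := ⟨(j - 1).toNat, by omega⟩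
    have := strVec_natCast (O.f i) w (k + 1)
    push_cast at this
    rw [this, (H.sl2 i).e_divPow hw he, add_sub_cancel_right, strVec_natCast, pairHom_apply, hm]
    congr 2
    ring

omit he in
theorem K_strVec (j : ℤ) :
    O.K (hh i) (strVec (O.f i) w j) = q ^ ((m : ℤ) - 2 * j) • strVec (O.f i) w j ∧
    O.K (-hh i) (strVec (O.f i) w j) = q ^ (2 * j - (m : ℤ)) • strVec (O.f i) w j := by
  have h := GlOps.mem_weightSpace.1 (strVec_mem H hw (i := i) j)
  have e1 : pair (hh i) (μ - j • alpha i) = m - 2 * j := by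
    rw [pair_sub_right, pair_zsmul_right, pair_hh_alpha, hm]; ring
  rw [h, h, pair_neg_left, e1, neg_sub]
  exact ⟨rfl, rfl⟩

end strVec

section tensor

variable {M₁ M₂ : Type*} [AddCommGroup M₁] [Module Fq M₁] [AddCommGroup M₂] [Module Fq M₂]
  {O₁ : GlOps r M₁} {O₂ : GlOps r M₂} (H₁ : O₁.Good) (H₂ : O₂.Good) {i : Fin r}
  {μ ν : Lat r} {x : M₁} {y : M₂} (hx : x ∈ O₁.weightSpace μ) (hy : y ∈ O₂.weightSpace ν)
  (hex : O₁.e i x = 0) (hey : O₂.e i y = 0) (hx0 : x ≠ 0) (hy0 : y ≠ 0)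
  {m n : ℕ} (hm : pair (hh i) μ = m) (hn : pair (hh i) ν = n)

theorem exists_strVec_dual {M : Type*} [AddCommGroup M] [Module Fq M] {O : GlOps r M} (H : O.Good)
    {w : M} (hw : w ∈ O.weightSpace μ) (he : O.e i w = 0) (hw0 : w ≠ 0)
    (hm : pair (hh i) μ = m) {j : ℤ} (hj : 0 ≤ j ∧ j ≤ m) :
    ∃ ψ : M →ₗ[Fq] Fq, ∀ j', ψ (strVec (O.f i) w j') = if j' = j then 1 else 0 := by
  lift j to ℕ using hj.1
  obtain ⟨ψ, hψ⟩ := (H.sl2 i).exists_dual H.weight.1 hw he hw0 hm j (by omega)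
  refine ⟨ψ, fun j' => ?_⟩
  by_cases h : 0 ≤ j' ∧ j' ≤ m
  · lift j' to ℕ using h.1
    rw [strVec_natCast, hψ j' (by omega)]
    simp
  · rw [strVec_eq_zero H hw he hm h, map_zero, if_neg (by omega)]

include H₁ H₂ hx hy

theorem tmul_strVec_mem (j k : ℤ) : strVec (O₁.f i) x j ⊗ₜ[Fq] strVec (O₂.f i) y k ∈
    (O₁.tensor O₂).weightSpace (μ + ν - (j + k) • alpha i) := by
  convert tmul_mem_weightSpace (strVec_mem H₁ hx (i := i) j) (strVec_mem H₂ hy (i := i) k) using 2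
  module

include hex hey hx0 hy0 hm hn

/-- In the coproducts `q^{±h_i}` acts on vectors of a string by scalars, which gives the
coefficients. The dual forms are tensor products of those of the factors, whence the hypotheses `x ≠
0` and `y ≠ 0`. -/
theorem tensorString : TensorString ((O₁.tensor O₂).e i) ((O₁.tensor O₂).f i)
    (fun j k => strVec (O₁.f i) x j ⊗ₜ[Fq] strVec (O₂.f i) y k) m n where
  zero j k h := by
    by_cases h1 : 0 ≤ j ∧ j ≤ m
    · rw [strVec_eq_zero H₂ hy hey hn (by omega), TensorProduct.tmul_zero]
    · rw [strVec_eq_zero H₁ hx hex hm h1, TensorProduct.zero_tmul]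
  f_apply j k := by
    simp only [GlOps.tensor, LinearMap.add_apply, TensorProduct.map_tmul, f_strVec,
      (K_strVec H₁ hx hm j).1, Module.End.one_apply]
    rw [TensorProduct.smul_tmul_smul, TensorProduct.smul_tmul' (qz (j + 1))]
  e_apply j k := by
    simp only [GlOps.tensor, LinearMap.add_apply, TensorProduct.map_tmul,
      e_strVec H₁ hx hex hm j, e_strVec H₂ hy hey hn k,
      (K_strVec H₂ hy hn k).2, Module.End.one_apply]
    rw [TensorProduct.smul_tmul_smul, TensorProduct.tmul_smul, mul_comm (qz _)]
  dual j k h := by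
    obtain ⟨ψ₁, h1⟩ := exists_strVec_dual H₁ hx hex hx0 hm (j := j) ⟨h.1, h.2.1⟩
    obtain ⟨ψ₂, h2⟩ := exists_strVec_dual H₂ hy hey hy0 hn (j := k) h.2.2
    refine ⟨(TensorProduct.lid Fq Fq).toLinearMap ∘ₗ TensorProduct.map ψ₁ ψ₂, fun j' k' => ?_⟩
    simp only [LinearMap.comp_apply, TensorProduct.map_tmul, h1, h2, LinearEquiv.coe_coe,
      TensorProduct.lid_tmul, smul_eq_mul]
    split_ifs <;> simp_all

end tensor

namespace GlOps.Good

variable {M : Type*} [AddCommGroup M] [Module Fq M] {O : GlOps r M} (H : O.Good) {i : Fin r}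
include H

theorem pow_tildeE {μ : Lat r} {u : ℕ →₀ M} (hu : O.IsString i μ u) (k : ℕ) (hk : u k ≠ 0)
    (N : ℕ) : (O.tildeE i ^ N) (divPow (O.f i) k (u k)) =
      if k < N then 0 else divPow (O.f i) (k - N) (u k) := by
  obtain ⟨h1, h2, h3⟩ := hu k
  have h3 := h3 hk
  induction N with
  | zero => simp
  | succ N ih =>
    rw [pow_succ', Module.End.mul_apply, ih]
    split_ifs with h4 h5 h5
    · rw [map_zero]
    · omega
    · rw [show k - N = 0 by omega, divPow_zero, Module.End.one_apply, H.tildeE_eq_zero h1 h2]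
    · rw [show k - N = (k - (N + 1)) + 1 by omega, H.tildeE_divPow_succ h1 h2]
      simp only [pairHom_apply]
      omega

end GlOps.Good

/-! ### Lattices stable under the even Kashiwara operators -/

section lattice

variable {M : Type*} [AddCommGroup M] [Module Fq M] [Module Aq M] [IsScalarTower Aq Fq M]

/-- `L` is stable under `ẽ_i` and `f̃_i` and is spanned by weight vectors. -/
structure TildeStable (O : GlOps r M) (L : Submodule Aq M) : Prop where
  e_stable : ∀ i, Stable L (O.tildeE i)
  f_stable : ∀ i, Stable L (O.tildeF i)
  weight : L ≤ Submodule.span Aq {u | u ∈ L ∧ ∃ μ, u ∈ O.weightSpace μ}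

namespace TildeStable

variable {O : GlOps r M} {L : Submodule Aq M} (HL : TildeStable O L) (H : O.Good) {i : Fin r}
include HL H

theorem divPow_mem {μ : Lat r} {w : M} (hw : w ∈ O.weightSpace μ) (he : O.e i w = 0)
    (hL : w ∈ L) (k : ℕ) : divPow (O.f i) k w ∈ L := by
  induction k with
  | zero => simpa using hL
  | succ k ih => rw [← H.tildeF_divPow hw he]; exact HL.f_stable i _ ih

theorem divPow_mem_qMul {μ : Lat r} {w : M} (hw : w ∈ O.weightSpace μ) (he : O.e i w = 0)
    (hL : w ∈ qMul L) (k : ℕ) : divPow (O.f i) k w ∈ qMul L := by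
  induction k with
  | zero => simpa using hL
  | succ k ih => rw [← H.tildeF_divPow hw he]; exact map_mem_qMul (HL.f_stable i) ih

/-- `ẽ_i^N` extracts the top component `u N`, which therefore lies in `L`. So does `f_i^{(N)} u_N =
f̃_i^N u_N`, and subtracting it lowers the top index. -/
theorem component_mem {μ : Lat r} (N : ℕ) {u : ℕ →₀ M} (hu : O.IsString i μ u)
    (hN : ∀ k, N ≤ k → u k = 0) (hL : (u.sum fun k v => divPow (O.f i) k v) ∈ L) (k : ℕ) :
    u k ∈ L := by
  induction N generalizing u with
  | zero => rw [hN k (Nat.zero_le k)]; exact zero_mem _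
  | succ N ih =>
    have hpow : ∀ (j : ℕ) v, v ∈ L → (O.tildeE i ^ j) v ∈ L := by
      intro j v hv
      induction j with
      | zero => simpa using hv
      | succ j ih => rw [pow_succ', Module.End.mul_apply]; exact HL.e_stable i _ ih
    have huN : u N ∈ L := by
      by_cases h0 : u N = 0
      · rw [h0]; exact zero_mem _
      have h1 := hpow N _ hL
      rw [Finsupp.sum, map_sum, Finset.sum_eq_single N, H.pow_tildeE hu N h0] at h1
      · simpa using h1
      · intro k hk hkN
        rw [Finsupp.mem_support_iff] at hk
        rw [H.pow_tildeE hu k hk, if_pos]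
        by_contra h
        exact hk (hN k (by omega))
      · intro h
        rw [Finsupp.notMem_support_iff] at h
        exact absurd h h0
    obtain ⟨h1, h2, -⟩ := hu N
    by_cases hk : k = N
    · rwa [hk]
    have hu' : O.IsString i μ (u.erase N) := by
      intro j
      by_cases hj : j = N
      · subst hj; simp
      · rw [Finsupp.erase_ne hj]; exact hu j
    have := ih hu' (fun j hj => by
      by_cases hj' : j = N
      · subst hj'; simp
      · rw [Finsupp.erase_ne hj']; exact hN j (by omega)) (by
      have e1 := sum_divPow_add (u.erase N) (Finsupp.single N (u N)) (divPow (O.f i))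
      rw [Finsupp.erase_add_single, Finsupp.sum_single_index (by simp)] at e1
      rw [← sub_eq_iff_eq_add.2 e1]
      exact sub_mem hL (HL.divPow_mem H h1 h2 huN N))
    rwa [Finsupp.erase_ne hk] at this

theorem string_mem {μ : Lat r} {u : ℕ →₀ M} (hu : O.IsString i μ u)
    (hL : (u.sum fun k v => divPow (O.f i) k v) ∈ L) (k : ℕ) : u k ∈ L := by
  refine HL.component_mem H (u.support.sup id + 1) hu (fun j hj => ?_) hL k
  by_contra h
  have := Finset.le_sup (f := id) (Finsupp.mem_support_iff.2 h)
  simp only [id] at this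
  omega

theorem string_mem_qMul {μ : Lat r} {u : ℕ →₀ M} (hu : O.IsString i μ u)
    (hL : (u.sum fun k v => divPow (O.f i) k v) ∈ qMul L) (k : ℕ) : u k ∈ qMul L := by
  obtain ⟨y, hy, hyu⟩ := mem_qMul.1 hL
  have h1 : IsStr O.weightSpace (pairHom (hh i)) (alpha i) (O.e i) μ (q⁻¹ • u) :=
    SL2.IsStr.smul (show IsStr O.weightSpace (pairHom (hh i)) (alpha i) (O.e i) μ u from hu) _
  have h2 : ((q⁻¹ • u).sum fun k v => divPow (O.f i) k v) = y := by
    rw [Finsupp.sum_smul_index' (by simp)]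
    simp only [map_smul]
    rw [← Finsupp.smul_sum, ← hyu, inv_smul_smul₀ q_ne_zero]
  have := HL.string_mem H h1 (by rw [h2]; exact hy) k
  refine mem_qMul.2 ⟨_, this, ?_⟩
  rw [Finsupp.smul_apply, smul_inv_smul₀ q_ne_zero]

theorem le_span_strings (i : Fin r) : L ≤ Submodule.span Aq
    {u | ∃ (μ : Lat r) (x : M) (k : ℕ), x ∈ L ∧ x ∈ O.weightSpace μ ∧ O.e i x = 0 ∧
      u = divPow (O.f i) k x} := by
  refine HL.weight.trans (Submodule.span_le.2 ?_)
  rintro v ⟨hv, μ, hμ⟩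
  obtain ⟨u, hu, rfl⟩ := (H.sl2 i).exists_str hμ
  refine Submodule.sum_mem _ fun k _ => Submodule.subset_span ?_
  exact ⟨_, u k, k, HL.string_mem H hu hv k, (hu k).1, (hu k).2.1, rfl⟩

end TildeStable

end lattice

end

section

variable {r : ℕ} {M₁ M₂ : Type*} [AddCommGroup M₁] [Module Fq M₁] [Module Aq M₁]
  [IsScalarTower Aq Fq M₁] [AddCommGroup M₂] [Module Fq M₂] [Module Aq M₂] [IsScalarTower Aq Fq M₂]

/-! ### The tensor product of lattices -/

section

variable {L₁ : Submodule Aq M₁} {L₂ : Submodule Aq M₂}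

/-- The tensor product of vectors as an `𝐀`-bilinear map. -/
def tmulAq (M₁ M₂ : Type*) [AddCommGroup M₁] [Module Fq M₁] [Module Aq M₁]
    [IsScalarTower Aq Fq M₁] [AddCommGroup M₂] [Module Fq M₂] [Module Aq M₂]
    [IsScalarTower Aq Fq M₂] : M₁ →ₗ[Aq] M₂ →ₗ[Aq] M₁ ⊗[Fq] M₂ :=
  LinearMap.mk₂ Aq (fun x y => x ⊗ₜ[Fq] y) (fun _ _ _ => TensorProduct.add_tmul _ _ _)
    (fun _ _ _ => rfl) (fun _ _ _ => TensorProduct.tmul_add _ _ _)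
    (fun a x y => by
      rw [← algebraMap_smul Fq a y, TensorProduct.tmul_smul, algebraMap_smul])

@[simp] theorem tmulAq_apply (x : M₁) (y : M₂) : tmulAq M₁ M₂ x y = x ⊗ₜ[Fq] y := rfl

theorem tensorLattice_eq_map₂ (L₁ : Submodule Aq M₁) (L₂ : Submodule Aq M₂) :
    tensorLattice L₁ L₂ = Submodule.map₂ (tmulAq M₁ M₂) L₁ L₂ := by
  rw [Submodule.map₂_eq_span_image2, tensorLattice]
  congr 1
  ext w
  simp [Set.mem_image2, eq_comm]

theorem tmul_mem_tensorLattice {x : M₁} {y : M₂} (hx : x ∈ L₁) (hy : y ∈ L₂) :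
    x ⊗ₜ[Fq] y ∈ tensorLattice L₁ L₂ :=
  Submodule.subset_span ⟨x, hx, y, hy, rfl⟩

theorem tmul_mem_qMul_left {x : M₁} {y : M₂} (hx : x ∈ qMul L₁) (hy : y ∈ L₂) :
    x ⊗ₜ[Fq] y ∈ qMul (tensorLattice L₁ L₂) := by
  obtain ⟨x, hx', rfl⟩ := mem_qMul.1 hx
  exact mem_qMul.2 ⟨_, tmul_mem_tensorLattice hx' hy, rfl⟩

theorem tmul_mem_qMul_right {x : M₁} {y : M₂} (hx : x ∈ L₁) (hy : y ∈ qMul L₂) :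
    x ⊗ₜ[Fq] y ∈ qMul (tensorLattice L₁ L₂) := by
  obtain ⟨y, hy', rfl⟩ := mem_qMul.1 hy
  exact mem_qMul.2 ⟨_, tmul_mem_tensorLattice hx hy', (TensorProduct.tmul_smul _ _ _).symm⟩

theorem tensorLattice_le {G₁ : Set M₁} {G₂ : Set M₂} (h₁ : L₁ ≤ Submodule.span Aq G₁)
    (h₂ : L₂ ≤ Submodule.span Aq G₂) {X : Submodule Aq (M₁ ⊗[Fq] M₂)}
    (h : ∀ x ∈ G₁, ∀ y ∈ G₂, x ⊗ₜ[Fq] y ∈ X) : tensorLattice L₁ L₂ ≤ X := by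
  rw [tensorLattice_eq_map₂]
  refine (Submodule.map₂_le_map₂ h₁ h₂).trans ?_
  rw [Submodule.map₂_span_span, Submodule.span_le]
  rintro _ ⟨x, hx, y, hy, rfl⟩
  exact h x hx y hy

theorem tensorLattice_stable {G₁ : Set M₁} {G₂ : Set M₂} (h₁ : L₁ ≤ Submodule.span Aq G₁)
    (h₂ : L₂ ≤ Submodule.span Aq G₂) {T : Module.End Fq (M₁ ⊗[Fq] M₂)}
    (h : ∀ x ∈ G₁, ∀ y ∈ G₂, T (x ⊗ₜ[Fq] y) ∈ tensorLattice L₁ L₂) :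
    Stable (tensorLattice L₁ L₂) T :=
  tensorLattice_le h₁ h₂ (X := (tensorLattice L₁ L₂).comap (T.restrictScalars Aq)) h

end

section rules

variable {O₁ : GlOps r M₁} {O₂ : GlOps r M₂} (H₁ : O₁.Good) (H₂ : O₂.Good)
  {L₁ : Submodule Aq M₁} {L₂ : Submodule Aq M₂} (HL₁ : TildeStable O₁ L₁)
  (HL₂ : TildeStable O₂ L₂) {i : Fin r}
  {μ ν : Lat r} {x : M₁} {y : M₂} (hx : x ∈ O₁.weightSpace μ) (hy : y ∈ O₂.weightSpace ν)
  (hex : O₁.e i x = 0) (hey : O₂.e i y = 0) (hxL : x ∈ L₁) (hyL : y ∈ L₂)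

theorem TildeStable.strVec_mem {M : Type*} [AddCommGroup M] [Module Fq M] [Module Aq M]
    [IsScalarTower Aq Fq M] {O : GlOps r M} {L : Submodule Aq M} (HL : TildeStable O L) (H : O.Good) {x : M}
    (hx : x ∈ O.weightSpace μ) (hex : O.e i x = 0) (hxL : x ∈ L) (j : ℤ) :
    strVec (O.f i) x j ∈ L := by
  unfold strVec
  split_ifs
  · exact HL.divPow_mem H hx hex hxL _
  · exact zero_mem _

theorem strVec_zero_vec {M : Type*} [AddCommGroup M] [Module Fq M] (f : Module.End Fq M) (j : ℤ) :
    strVec f 0 j = 0 := by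
  simp [strVec]

include H₁ H₂ HL₁ HL₂ hx hy hex hey hxL hyL

theorem lattice_strVec_le : TensorString.lattice
    (fun j k => strVec (O₁.f i) x j ⊗ₜ[Fq] strVec (O₂.f i) y k) ≤ tensorLattice L₁ L₂ := by
  refine Submodule.span_le.2 ?_
  rintro _ ⟨j, k, rfl⟩
  exact tmul_mem_tensorLattice (HL₁.strVec_mem H₁ hx hex hxL j) (HL₂.strVec_mem H₂ hy hey hyL k)

theorem tildeF_strVec_tmul {j k : ℤ} (hj : 0 ≤ j ∧ j ≤ pair (hh i) μ)
    (hk : 0 ≤ k ∧ k ≤ pair (hh i) ν) :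
    (O₁.tensor O₂).tildeF i (strVec (O₁.f i) x j ⊗ₜ[Fq] strVec (O₂.f i) y k) -
      (if k < pair (hh i) μ - j then strVec (O₁.f i) x (j + 1) ⊗ₜ[Fq] strVec (O₂.f i) y k
        else strVec (O₁.f i) x j ⊗ₜ[Fq] strVec (O₂.f i) y (k + 1)) ∈
      qMul (tensorLattice L₁ L₂) := by
  -- A zero vector has no dual forms and is treated apart.
  by_cases hx0 : x = 0
  · simp [hx0, strVec_zero_vec]
  by_cases hy0 : y = 0
  · simp [hy0, strVec_zero_vec]
  obtain ⟨m, hm⟩ := Int.eq_ofNat_of_zero_le (hj.1.trans hj.2)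
  obtain ⟨n, hn⟩ := Int.eq_ofNat_of_zero_le (hk.1.trans hk.2)
  have h := ((tensorString H₁ H₂ hx hy hex hey hx0 hy0 hm hn).tildeF_rule
    ((H₁.tensor H₂).sl2 i) (lam := μ + ν) (by simp [pair_add_right, hm, hn])
    (fun j k => tmul_strVec_mem H₁ H₂ hx hy j k)
    (fun mu w hw he s => (H₁.tensor H₂).tildeF_divPow hw he s)).2 j k (by omega)
  rw [hm]
  exact Submodule.map_mono (lattice_strVec_le H₁ H₂ HL₁ HL₂ hx hy hex hey hxL hyL) h

theorem tildeE_strVec_tmul {j k : ℤ} (hj : 0 ≤ j ∧ j ≤ pair (hh i) μ)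
    (hk : 0 ≤ k ∧ k ≤ pair (hh i) ν) :
    (O₁.tensor O₂).tildeE i (strVec (O₁.f i) x j ⊗ₜ[Fq] strVec (O₂.f i) y k) -
      (if k ≤ pair (hh i) μ - j then strVec (O₁.f i) x (j - 1) ⊗ₜ[Fq] strVec (O₂.f i) y k
        else strVec (O₁.f i) x j ⊗ₜ[Fq] strVec (O₂.f i) y (k - 1)) ∈
      qMul (tensorLattice L₁ L₂) := by
  by_cases hx0 : x = 0
  · simp [hx0, strVec_zero_vec]
  by_cases hy0 : y = 0
  · simp [hy0, strVec_zero_vec]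
  obtain ⟨m, hm⟩ := Int.eq_ofNat_of_zero_le (hj.1.trans hj.2)
  obtain ⟨n, hn⟩ := Int.eq_ofNat_of_zero_le (hk.1.trans hk.2)
  have h := ((tensorString H₁ H₂ hx hy hex hey hx0 hy0 hm hn).tildeE_rule
    ((H₁.tensor H₂).sl2 i) (lam := μ + ν) (by simp [pair_add_right, hm, hn])
    (fun j k => tmul_strVec_mem H₁ H₂ hx hy j k)
    (fun mu w hw he => (H₁.tensor H₂).tildeE_eq_zero hw he)
    (fun mu w hw he s hs => (H₁.tensor H₂).tildeE_divPow_succ hw he hs)).2 j k (by omega)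
  rw [hm]
  exact Submodule.map_mono (lattice_strVec_le H₁ H₂ HL₁ HL₂ hx hy hex hey hxL hyL) h

end rules

section stable

variable {O₁ : GlOps r M₁} {O₂ : GlOps r M₂} {L₁ : Submodule Aq M₁} {L₂ : Submodule Aq M₂}

theorem TildeStable.stable_tensor (HL₁ : TildeStable O₁ L₁) (HL₂ : TildeStable O₂ L₂)
    (H₁ : O₁.Good) (H₂ : O₂.Good) (i : Fin r) {T : Module.End Fq (M₁ ⊗[Fq] M₂)}
    (h : ∀ {μ ν : Lat r} {x : M₁} {y : M₂}, x ∈ O₁.weightSpace μ → y ∈ O₂.weightSpace ν →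
      O₁.e i x = 0 → O₂.e i y = 0 → x ∈ L₁ → y ∈ L₂ → ∀ {j k : ℤ},
      0 ≤ j ∧ j ≤ pair (hh i) μ → 0 ≤ k ∧ k ≤ pair (hh i) ν →
      T (strVec (O₁.f i) x j ⊗ₜ[Fq] strVec (O₂.f i) y k) ∈ tensorLattice L₁ L₂) :
    Stable (tensorLattice L₁ L₂) T := by
  refine tensorLattice_stable (HL₁.le_span_strings H₁ i) (HL₂.le_span_strings H₂ i) ?_
  rintro _ ⟨μ, x, j, hxL, hx, hex, rfl⟩ _ ⟨ν, y, k, hyL, hy, hey, rfl⟩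
  rcases lt_or_ge (pair (hh i) μ) j with hj | hj
  · rw [(H₁.sl2 i).divPow_eq_zero hx hex hj, TensorProduct.zero_tmul, map_zero]
    exact zero_mem _
  rcases lt_or_ge (pair (hh i) ν) k with hk | hk
  · rw [(H₂.sl2 i).divPow_eq_zero hy hey hk, TensorProduct.tmul_zero, map_zero]
    exact zero_mem _
  rw [← strVec_natCast, ← strVec_natCast]
  exact h hx hy hex hey hxL hyL ⟨by positivity, hj⟩ ⟨by positivity, hk⟩

theorem TildeStable.tildeF_tensor (HL₁ : TildeStable O₁ L₁) (HL₂ : TildeStable O₂ L₂)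
    (H₁ : O₁.Good) (H₂ : O₂.Good) (i : Fin r) :
    Stable (tensorLattice L₁ L₂) ((O₁.tensor O₂).tildeF i) := by
  refine HL₁.stable_tensor HL₂ H₁ H₂ i fun hx hy hex hey hxL hyL j k hj hk => ?_
  have h := qMul_le _ (tildeF_strVec_tmul H₁ H₂ HL₁ HL₂ hx hy hex hey hxL hyL hj hk)
  refine (Submodule.sub_mem_iff_left _ ?_).1 h
  split_ifs <;> exact tmul_mem_tensorLattice (HL₁.strVec_mem H₁ hx hex hxL _)
    (HL₂.strVec_mem H₂ hy hey hyL _)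

theorem TildeStable.tildeE_tensor (HL₁ : TildeStable O₁ L₁) (HL₂ : TildeStable O₂ L₂)
    (H₁ : O₁.Good) (H₂ : O₂.Good) (i : Fin r) :
    Stable (tensorLattice L₁ L₂) ((O₁.tensor O₂).tildeE i) := by
  refine HL₁.stable_tensor HL₂ H₁ H₂ i fun hx hy hex hey hxL hyL j k hj hk => ?_
  have h := qMul_le _ (tildeE_strVec_tmul H₁ H₂ HL₁ HL₂ hx hy hex hey hxL hyL hj hk)
  refine (Submodule.sub_mem_iff_left _ ?_).1 h
  split_ifs <;> exact tmul_mem_tensorLattice (HL₁.strVec_mem H₁ hx hex hxL _)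
    (HL₂.strVec_mem H₂ hy hey hyL _)

end stable

end

section

/-! ### Reduction at `q = 0` -/

section red

variable {M : Type*} [AddCommGroup M] [Module Fq M] [Module Aq M] [IsScalarTower Aq Fq M]
  {L : Submodule Aq M}

theorem mem_qSub {u : L} : u ∈ qSub L ↔ (u : M) ∈ qMul L := by
  rw [mem_qMul, qSub, LinearMap.mem_range]
  constructor
  · rintro ⟨y, rfl⟩
    exact ⟨y, y.2, by simp [← X_smul_eq]⟩
  · rintro ⟨y, hy, h⟩
    exact ⟨⟨y, hy⟩, Subtype.ext (by simpa [X_smul_eq] using h)⟩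

theorem mkQ_eq_zero {u : L} : (qSub L).mkQ u = 0 ↔ (u : M) ∈ qMul L := by
  rw [← mem_qSub, Submodule.mkQ_apply, Submodule.Quotient.mk_eq_zero]

theorem mkQ_eq {u v : L} : (qSub L).mkQ u = (qSub L).mkQ v ↔ (u : M) - v ∈ qMul L := by
  rw [← sub_eq_zero, ← map_sub, mkQ_eq_zero, Submodule.coe_sub]

theorem X_smul_red (x : Red L) : (PowerSeries.X : Aq) • x = 0 := by
  obtain ⟨u, rfl⟩ := (qSub L).mkQ_surjective x
  rw [← map_smul, mkQ_eq_zero]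
  exact mem_qMul.2 ⟨u, u.2, by simp [X_smul_eq]⟩

theorem redMap_mkQ {T : Module.End Fq M} (hT : Stable L T) (u : L) :
    redMap hT ((qSub L).mkQ u) = (qSub L).mkQ ⟨T u, hT u u.2⟩ := rfl

theorem redMap_eq_zero {T : Module.End Fq M} (hT : Stable L T) (u : L) :
    redMap hT ((qSub L).mkQ u) = 0 ↔ T u ∈ qMul L := by
  rw [redMap_mkQ, mkQ_eq_zero]

theorem redMap_eq {T : Module.End Fq M} (hT : Stable L T) (u v : L) :
    redMap hT ((qSub L).mkQ u) = (qSub L).mkQ v ↔ T u - v ∈ qMul L := by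
  rw [redMap_mkQ, mkQ_eq]

end red

/-! ### The reduction of a tensor product of lattices -/

section redTensor

variable {M₁ M₂ : Type*} [AddCommGroup M₁] [Module Fq M₁] [Module Aq M₁]
  [IsScalarTower Aq Fq M₁] [AddCommGroup M₂] [Module Fq M₂] [Module Aq M₂] [IsScalarTower Aq Fq M₂]
  (L₁ : Submodule Aq M₁) (L₂ : Submodule Aq M₂)

/-- The canonical bilinear map `L₁ × L₂ → L₁ ⊗ L₂`. -/
def latticeTmul : L₁ →ₗ[Aq] L₂ →ₗ[Aq] tensorLattice L₁ L₂ :=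
  LinearMap.mk₂ Aq tensorElt
    (fun _ _ _ => Subtype.ext (TensorProduct.add_tmul _ _ _)) (fun _ _ _ => rfl)
    (fun _ _ _ => Subtype.ext (TensorProduct.tmul_add _ _ _))
    (fun a x y => Subtype.ext ((tmulAq M₁ M₂ (x : M₁)).map_smul a (y : M₂)))

/-- The canonical bilinear map `L₁/qL₁ × L₂/qL₂ → (L₁ ⊗ L₂)/q(L₁ ⊗ L₂)`. -/
def redTensor : Red L₁ →ₗ[Aq] Red L₂ →ₗ[Aq] Red (tensorLattice L₁ L₂) :=
  ((qSub L₂).liftQ ((qSub L₁).liftQ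
    ((latticeTmul L₁ L₂).compr₂ (qSub (tensorLattice L₁ L₂)).mkQ) (by
      intro u hu
      rw [LinearMap.mem_ker]
      ext v
      exact mkQ_eq_zero.2 (tmul_mem_qMul_left (mem_qSub.1 hu) v.2))).flip (by
    intro v hv
    rw [LinearMap.mem_ker]
    refine LinearMap.ext fun x => ?_
    obtain ⟨u, rfl⟩ := (qSub L₁).mkQ_surjective x
    exact mkQ_eq_zero.2 (tmul_mem_qMul_right u.2 (mem_qSub.1 hv)))).flip

variable {L₁ L₂}

theorem redTensor_mkQ (u : L₁) (v : L₂) :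
    redTensor L₁ L₂ ((qSub L₁).mkQ u) ((qSub L₂).mkQ v) =
      (qSub (tensorLattice L₁ L₂)).mkQ (tensorElt u v) := rfl

theorem tensorFiber_eq_map₂ {B₁ B₂ : Type*} (l₁ : B₁ → Submodule Aq (Red L₁))
    (l₂ : B₂ → Submodule Aq (Red L₂)) (b : B₁ × B₂) :
    tensorFiber l₁ l₂ b = Submodule.map₂ (redTensor L₁ L₂) (l₁ b.1) (l₂ b.2) := by
  rw [Submodule.map₂_eq_span_image2, tensorFiber]
  congr 1
  ext w
  constructor
  · rintro ⟨u, v, hu, hv, rfl⟩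
    exact ⟨_, hu, _, hv, rfl⟩
  · rintro ⟨x, hx, y, hy, rfl⟩
    obtain ⟨u, rfl⟩ := (qSub L₁).mkQ_surjective x
    obtain ⟨v, rfl⟩ := (qSub L₂).mkQ_surjective y
    exact ⟨u, v, hx, hy, rfl⟩

theorem map₂_redTensor_top : Submodule.map₂ (redTensor L₁ L₂) ⊤ ⊤ = ⊤ := by
  rw [eq_top_iff]
  rintro z -
  obtain ⟨⟨w, hw⟩, rfl⟩ := (qSub (tensorLattice L₁ L₂)).mkQ_surjective z
  have h : tensorLattice L₁ L₂ ≤ ((Submodule.map₂ (redTensor L₁ L₂) ⊤ ⊤).comap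
      (qSub (tensorLattice L₁ L₂)).mkQ).map (tensorLattice L₁ L₂).subtype := by
    refine Submodule.span_le.2 ?_
    rintro _ ⟨u, hu, v, hv, rfl⟩
    refine ⟨tensorElt ⟨u, hu⟩ ⟨v, hv⟩, ?_, rfl⟩
    rw [SetLike.mem_coe, Submodule.mem_comap, ← redTensor_mkQ]
    exact Submodule.apply_mem_map₂ _ trivial trivial
  obtain ⟨w', hw', h'⟩ := h hw
  have : w' = ⟨w, hw⟩ := Subtype.ext h'
  rwa [← this]

theorem le_span_basis {M ι : Type*} [AddCommGroup M] [Module Aq M] {L : Submodule Aq M}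
    (b : Module.Basis ι Aq L) : L ≤ Submodule.span Aq (Set.range fun i => (b i : M)) := by
  have := congrArg (Submodule.map L.subtype) b.span_eq
  rw [Submodule.map_span, ← Set.range_comp, Submodule.map_top, Submodule.range_subtype] at this
  exact this.ge

/-- Tensors of basis vectors form an `𝐅`-basis of `M₁ ⊗ M₂`, hence are independent over `𝐀`, and by
bilinearity they span the lattice. Freeness, base change and the universal property of the reduction
are all read off from this basis. -/
theorem exists_tensorBasis {ι κ : Type*} (b₁ : Module.Basis ι Aq L₁) (b₂ : Module.Basis κ Aq L₂)
    (h₁ : IsBaseChange Fq L₁.subtype) (h₂ : IsBaseChange Fq L₂.subtype) :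
    ∃ (b : Module.Basis (ι × κ) Aq (tensorLattice L₁ L₂))
      (bF : Module.Basis (ι × κ) Fq (M₁ ⊗[Fq] M₂)),
      (∀ p, b p = tensorElt (b₁ p.1) (b₂ p.2)) ∧ ∀ p, bF p = b p := by
  let bF := (h₁.basis b₁).tensorProduct (h₂.basis b₂)
  have hF : ∀ p, bF p = (tensorElt (b₁ p.1) (b₂ p.2) : tensorLattice L₁ L₂) := fun p => by
    simp [bF, Module.Basis.tensorProduct_apply', IsBaseChange.basis_apply, tensorElt]
  have hli : LinearIndependent Aq
      (fun p : ι × κ => (tensorElt (b₁ p.1) (b₂ p.2) : tensorLattice L₁ L₂)) := by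
    refine LinearIndependent.of_comp (tensorLattice L₁ L₂).subtype ?_
    have := bF.linearIndependent.restrict_scalars (R := Aq) (by
      intro a b hab
      refine algebraMap_Aq_injective ?_
      simpa [Algebra.smul_def] using hab)
    convert this using 1
    ext p
    rw [hF]; rfl
  have hsp : ⊤ ≤ Submodule.span Aq (Set.range
      fun p : ι × κ => (tensorElt (b₁ p.1) (b₂ p.2) : tensorLattice L₁ L₂)) := by
    have h : tensorLattice L₁ L₂ ≤ (Submodule.span Aq (Set.range
      fun p : ι × κ => (tensorElt (b₁ p.1) (b₂ p.2) : tensorLattice L₁ L₂))).map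
        (tensorLattice L₁ L₂).subtype := by
      refine tensorLattice_le (le_span_basis b₁) (le_span_basis b₂) ?_
      rintro _ ⟨i, rfl⟩ _ ⟨j, rfl⟩
      exact ⟨_, Submodule.subset_span ⟨(i, j), rfl⟩, rfl⟩
    rintro ⟨w, hw⟩ -
    obtain ⟨w', hw', h'⟩ := h hw
    rwa [← show w' = ⟨w, hw⟩ from Subtype.ext h']
  exact ⟨Module.Basis.mk hli hsp, bF, fun p => Module.Basis.mk_apply _ _ _,
    fun p => by rw [hF, Module.Basis.mk_apply]⟩

theorem free_tensorLattice [Module.Free Aq L₁] [Module.Free Aq L₂]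
    (h₁ : IsBaseChange Fq L₁.subtype) (h₂ : IsBaseChange Fq L₂.subtype) :
    Module.Free Aq (tensorLattice L₁ L₂) := by
  obtain ⟨b, -, -⟩ := exists_tensorBasis (Module.Free.chooseBasis Aq L₁)
    (Module.Free.chooseBasis Aq L₂) h₁ h₂
  exact Module.Free.of_basis b

theorem isBaseChange_of_basis {M ι : Type*} [AddCommGroup M] [Module Fq M] [Module Aq M]
    [IsScalarTower Aq Fq M] {L : Submodule Aq M} (b : Module.Basis ι Aq L)
    (bF : Module.Basis ι Fq M) (h : ∀ i, bF i = b i) : IsBaseChange Fq L.subtype := by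
  let e := (b.baseChange Fq).equiv bF (Equiv.refl ι)
  refine IsBaseChange.of_equiv e fun x => ?_
  have : (e.toLinearMap.restrictScalars Aq) ∘ₗ (TensorProduct.mk Aq Fq L 1) = L.subtype := by
    refine b.ext fun i => ?_
    have : (1 : Fq) ⊗ₜ[Aq] b i = b.baseChange Fq i := by simp
    rw [LinearMap.comp_apply, TensorProduct.mk_apply, this]
    exact ((b.baseChange Fq).equiv_apply i bF (Equiv.refl ι)).trans (h i)
  exact LinearMap.congr_fun this x

theorem isBaseChange_tensorLattice [Module.Free Aq L₁] [Module.Free Aq L₂]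
    (h₁ : IsBaseChange Fq L₁.subtype) (h₂ : IsBaseChange Fq L₂.subtype) :
    IsBaseChange Fq (tensorLattice L₁ L₂).subtype := by
  obtain ⟨b, bF, -, h⟩ := exists_tensorBasis (Module.Free.chooseBasis Aq L₁)
    (Module.Free.chooseBasis Aq L₂) h₁ h₂
  exact isBaseChange_of_basis b bF h

/-- The universal property of `(L₁ ⊗ L₂)/q(L₁ ⊗ L₂)` as the tensor product of `L₁/qL₁` and
`L₂/qL₂`. -/
theorem exists_redLift [Module.Free Aq L₁] [Module.Free Aq L₂]
    (h₁ : IsBaseChange Fq L₁.subtype) (h₂ : IsBaseChange Fq L₂.subtype)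
    {N : Type*} [AddCommGroup N] [Module Aq N] (g : Red L₁ →ₗ[Aq] Red L₂ →ₗ[Aq] N) :
    ∃ G : Red (tensorLattice L₁ L₂) →ₗ[Aq] N, ∀ x y, G (redTensor L₁ L₂ x y) = g x y := by
  set b₁ := Module.Free.chooseBasis Aq L₁
  set b₂ := Module.Free.chooseBasis Aq L₂
  obtain ⟨b, -, hb, -⟩ := exists_tensorBasis b₁ b₂ h₁ h₂
  let g' : L₁ →ₗ[Aq] L₂ →ₗ[Aq] N := g.compl₁₂ (qSub L₁).mkQ (qSub L₂).mkQ
  let G' : tensorLattice L₁ L₂ →ₗ[Aq] N := b.constr Aq fun p => g' (b₁ p.1) (b₂ p.2)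
  have hG' : ∀ u v, G' (tensorElt u v) = g' u v := by
    have : (latticeTmul L₁ L₂).compr₂ G' = g' := by
      refine b₁.ext fun i => b₂.ext fun j => ?_
      have h1 : latticeTmul L₁ L₂ (b₁ i) (b₂ j) = b (i, j) := (hb (i, j)).symm
      rw [LinearMap.compr₂_apply, h1]
      simp [G']
    exact fun u v => LinearMap.congr_fun₂ this u v
  refine ⟨(qSub (tensorLattice L₁ L₂)).liftQ G' ?_, ?_⟩
  · rintro _ ⟨y, rfl⟩
    rw [LinearMap.mem_ker]
    -- On basis tensors `G'` factors through the reductions, on which `q` acts by zero.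
    have : (LinearMap.lsmul Aq N PowerSeries.X) ∘ₗ G' = 0 := by
      refine b.ext fun p => ?_
      rw [LinearMap.comp_apply, hb, hG', LinearMap.lsmul_apply, LinearMap.zero_apply]
      simp only [g', LinearMap.compl₁₂_apply]
      rw [← map_smul, X_smul_red, map_zero]
    have h := LinearMap.congr_fun this y
    simpa using h
  · intro x y
    obtain ⟨u, rfl⟩ := (qSub L₁).mkQ_surjective x
    obtain ⟨v, rfl⟩ := (qSub L₂).mkQ_surjective y
    rw [redTensor_mkQ, Submodule.mkQ_apply, Submodule.liftQ_apply, hG']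
    rfl

end redTensor

end

section

/-! ### Direct sums -/

section directSum

variable {R X ι : Type*} [Ring R] [AddCommGroup X] [Module R X] {V : ι → Submodule R X}

theorem iSupIndep_of_maps {N : Type*} [AddCommGroup N] [Module R N] (p : ι → X →ₗ[R] N)
    (h1 : ∀ i, ∀ x ∈ V i, p i x = 0 → x = 0) (h2 : ∀ i j, j ≠ i → ∀ x ∈ V j, p i x = 0) :
    iSupIndep V := by
  intro i
  rw [Submodule.disjoint_def]
  intro x hx hx'
  refine h1 i x hx ?_
  have : ⨆ (j) (_ : j ≠ i), V j ≤ LinearMap.ker (p i) := iSup₂_le fun j hj x hx => h2 i j hj x hx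
  exact this hx'

theorem IsDirectSum.exists_proj (h : IsDirectSum V) (i : ι) :
    ∃ p : X →ₗ[R] X, (∀ x ∈ V i, p x = x) ∧ (∀ j, j ≠ i → ∀ x ∈ V j, p x = 0) ∧
      ∀ x, p x ∈ V i := by
  have hc : IsCompl (V i) (⨆ (j) (_ : j ≠ i), V j) := by
    refine ⟨h.1 i, codisjoint_iff.2 (eq_top_iff.2 ?_)⟩
    rw [← h.2]
    refine iSup_le fun j => ?_
    by_cases hj : j = i
    · rw [hj]; exact le_sup_left
    · exact le_sup_of_le_right (le_iSup₂_of_le j hj le_rfl)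
  refine ⟨(V i).projection _ hc, fun x hx => Submodule.projection_apply_of_mem_left hc hx,
    fun j hj x hx => ?_, fun x => Submodule.projection_apply_mem hc x⟩
  rw [Submodule.projection_apply_eq_zero_iff]
  exact (le_iSup₂_of_le (f := fun j (_ : j ≠ i) => V j) j hj le_rfl) hx

end directSum

section red

variable {M₁ M₂ : Type*} [AddCommGroup M₁] [Module Fq M₁] [Module Aq M₁]
  [IsScalarTower Aq Fq M₁] [AddCommGroup M₂] [Module Fq M₂] [Module Aq M₂] [IsScalarTower Aq Fq M₂]
  {L₁ : Submodule Aq M₁} {L₂ : Submodule Aq M₂}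

/-- The residue field `𝐀/q𝐀`. -/
abbrev Residue : Type := Aq ⧸ Ideal.span {(PowerSeries.X : Aq)}

/-- If all forms vanish on the class of `u`, then every coordinate of `u` in a basis of `L` is
divisible by `q`, so that `u ∈ qL`. -/
theorem exists_red_dual {M : Type*} [AddCommGroup M] [Module Fq M] [Module Aq M]
    [IsScalarTower Aq Fq M] {L : Submodule Aq M} [Module.Free Aq L] {x : Red L} (hx : x ≠ 0) :
    ∃ φ : Red L →ₗ[Aq] Residue, φ x ≠ 0 := by
  by_contra! h
  apply hx
  set b := Module.Free.chooseBasis Aq L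
  obtain ⟨u, rfl⟩ := (qSub L).mkQ_surjective x
  rw [Submodule.mkQ_apply, Submodule.Quotient.mk_eq_zero, ← b.linearCombination_repr u]
  refine Submodule.sum_mem _ fun i _ => ?_
  let φ : Red L →ₗ[Aq] Residue := (qSub L).liftQ
    ((Submodule.mkQ (Ideal.span {(PowerSeries.X : Aq)})) ∘ₗ b.coord i) (by
      rintro _ ⟨y, rfl⟩
      simp only [LinearMap.mem_ker, LinearMap.comp_apply, LinearMap.lsmul_apply, map_smul,
        Submodule.mkQ_apply, ← Submodule.Quotient.mk_smul, Submodule.Quotient.mk_eq_zero]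
      exact Ideal.mul_mem_right _ _ (Ideal.mem_span_singleton_self _))
  have h1 : φ ((qSub L).mkQ u) = Submodule.Quotient.mk (b.repr u i) := rfl
  have h2 := h φ
  rw [h1, Submodule.Quotient.mk_eq_zero, Ideal.mem_span_singleton] at h2
  obtain ⟨c, hc⟩ := h2
  refine ⟨c • b i, ?_⟩
  rw [LinearMap.lsmul_apply, smul_smul, ← hc]
  rfl

/-- Forms that do not vanish on `x` and `y` have a product that does not vanish on the tensor, since
`𝐀/q𝐀` is a domain. -/
theorem redTensor_ne_zero [Module.Free Aq L₁] [Module.Free Aq L₂]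
    (h₁ : IsBaseChange Fq L₁.subtype) (h₂ : IsBaseChange Fq L₂.subtype) {x : Red L₁} {y : Red L₂}
    (hx : x ≠ 0) (hy : y ≠ 0) : redTensor L₁ L₂ x y ≠ 0 := by
  obtain ⟨φ, hφ⟩ := exists_red_dual hx
  obtain ⟨ψ, hψ⟩ := exists_red_dual hy
  obtain ⟨G, hG⟩ := exists_redLift h₁ h₂ ((LinearMap.mul Aq Residue).compl₁₂ φ ψ)
  intro h
  have h1 := hG x y
  rw [h, map_zero] at h1
  have : (Ideal.span {(PowerSeries.X : Aq)}).IsPrime :=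
    PowerSeries.span_X_isPrime
  have h2 : φ x * ψ y = 0 := h1.symm
  exact (mul_ne_zero hφ hψ) h2

/-- The tensor product of operators on the reductions. -/
theorem exists_redTensorMap [Module.Free Aq L₁] [Module.Free Aq L₂]
    (h₁ : IsBaseChange Fq L₁.subtype) (h₂ : IsBaseChange Fq L₂.subtype)
    (S : Red L₁ →ₗ[Aq] Red L₁) (T : Red L₂ →ₗ[Aq] Red L₂) :
    ∃ G : Red (tensorLattice L₁ L₂) →ₗ[Aq] Red (tensorLattice L₁ L₂),
      ∀ x y, G (redTensor L₁ L₂ x y) = redTensor L₁ L₂ (S x) (T y) :=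
  exists_redLift h₁ h₂ ((redTensor L₁ L₂).compl₁₂ S T)

/-- Tensoring the projections of the two decompositions gives maps that are the identity on one
fibre and kill all others. -/
theorem isDirectSum_map₂ {B₁ B₂ : Type*} [Module.Free Aq L₁] [Module.Free Aq L₂]
    (h₁ : IsBaseChange Fq L₁.subtype) (h₂ : IsBaseChange Fq L₂.subtype)
    {l₁ : B₁ → Submodule Aq (Red L₁)} {l₂ : B₂ → Submodule Aq (Red L₂)}
    (hl₁ : IsDirectSum l₁) (hl₂ : IsDirectSum l₂) : IsDirectSum (tensorFiber l₁ l₂) := by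
  rw [funext (tensorFiber_eq_map₂ l₁ l₂)]
  choose p₁ h11 h12 h13 using hl₁.exists_proj
  choose p₂ h21 h22 h23 using hl₂.exists_proj
  choose P hP using fun b : B₁ × B₂ => exists_redTensorMap h₁ h₂ (p₁ b.1) (p₂ b.2)
  constructor
  · refine iSupIndep_of_maps P (fun b x hx h => ?_) (fun b c hcb x hx => ?_)
    · rw [← h]
      symm
      have : Submodule.map₂ (redTensor L₁ L₂) (l₁ b.1) (l₂ b.2) ≤
          LinearMap.eqLocus (P b) LinearMap.id := by
        rw [Submodule.map₂_le]
        intro x hx y hy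
        rw [LinearMap.mem_eqLocus, hP, h11 _ _ hx, h21 _ _ hy, LinearMap.id_apply]
      exact this hx
    · have : Submodule.map₂ (redTensor L₁ L₂) (l₁ c.1) (l₂ c.2) ≤ LinearMap.ker (P b) := by
        rw [Submodule.map₂_le]
        intro x hx y hy
        rw [LinearMap.mem_ker, hP]
        by_cases h : c.1 = b.1
        · rw [h22 b.2 c.2 (fun h' => hcb (Prod.ext h h')) y hy, map_zero]
        · rw [h12 b.1 c.1 h x hx, map_zero, LinearMap.zero_apply]
      exact this hx
  · rw [eq_top_iff, ← map₂_redTensor_top, ← hl₁.2, Submodule.map₂_iSup_left]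
    refine iSup_le fun b₁ => ?_
    rw [← hl₂.2, Submodule.map₂_iSup_right]
    exact iSup_le fun b₂ => le_iSup_of_le (b₁, b₂) le_rfl

/-- An operator that is bijective from `l` to a direct summand `l'` has a linear inverse. -/
theorem exists_linear_inverse {X : Type*} [AddCommGroup X] [Module Aq X] {l l' : Submodule Aq X}
    {A : X →ₗ[Aq] X} (hA : Set.BijOn A l l') {p : X →ₗ[Aq] X} (hp : ∀ x ∈ l', p x = x)
    (hp' : ∀ x, p x ∈ l') :
    ∃ S : X →ₗ[Aq] X, (∀ x ∈ l', S x ∈ l) ∧ (∀ x ∈ l, S (A x) = x) ∧ ∀ x ∈ l', A (S x) = x := by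
  let e : l ≃ₗ[Aq] l' := LinearEquiv.ofBijective (A.restrict hA.mapsTo) hA.bijective
  have he : ∀ x : l, (e x : X) = A x := fun x => rfl
  refine ⟨l.subtype ∘ₗ e.symm.toLinearMap ∘ₗ p.codRestrict l' hp', fun x hx => (Subtype.prop _),
    fun x hx => ?_, fun x hx => ?_⟩
  · have : p.codRestrict l' hp' (A x) = e ⟨x, hx⟩ :=
      Subtype.ext (hp _ (hA.mapsTo hx))
    simp [this]
  · have : p.codRestrict l' hp' x = ⟨x, hx⟩ := Subtype.ext (hp _ hx)
    simp only [LinearMap.comp_apply, this, Submodule.subtype_apply, LinearEquiv.coe_coe]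
    rw [← he, LinearEquiv.apply_symm_apply]

/-- The projections onto `l₁'` and `l₂'` extend the inverses of `A` and `B` to the whole reductions.
By the universal property these extensions have a tensor product `G`, and `G` inverts `D` on the
fibres. -/
theorem bijOn_map₂ [Module.Free Aq L₁] [Module.Free Aq L₂]
    (h₁ : IsBaseChange Fq L₁.subtype) (h₂ : IsBaseChange Fq L₂.subtype)
    {l₁ l₁' : Submodule Aq (Red L₁)} {l₂ l₂' : Submodule Aq (Red L₂)}
    {A : Red L₁ →ₗ[Aq] Red L₁} {B : Red L₂ →ₗ[Aq] Red L₂}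
    (hA : Set.BijOn A l₁ l₁') (hB : Set.BijOn B l₂ l₂')
    (hp₁ : ∃ p : Red L₁ →ₗ[Aq] Red L₁, (∀ x ∈ l₁', p x = x) ∧ ∀ x, p x ∈ l₁')
    (hp₂ : ∃ p : Red L₂ →ₗ[Aq] Red L₂, (∀ x ∈ l₂', p x = x) ∧ ∀ x, p x ∈ l₂')
    {D : Red (tensorLattice L₁ L₂) →ₗ[Aq] Red (tensorLattice L₁ L₂)}
    (hD : ∀ x ∈ l₁, ∀ y ∈ l₂, D (redTensor L₁ L₂ x y) = redTensor L₁ L₂ (A x) (B y)) :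
    Set.BijOn D (Submodule.map₂ (redTensor L₁ L₂) l₁ l₂ : Submodule Aq _)
      (Submodule.map₂ (redTensor L₁ L₂) l₁' l₂' : Submodule Aq _) := by
  obtain ⟨p₁, hp11, hp12⟩ := hp₁
  obtain ⟨p₂, hp21, hp22⟩ := hp₂
  obtain ⟨S₁, h11, h12, h13⟩ := exists_linear_inverse hA hp11 hp12
  obtain ⟨S₂, h21, h22, h23⟩ := exists_linear_inverse hB hp21 hp22
  obtain ⟨G, hG⟩ := exists_redTensorMap h₁ h₂ S₁ S₂
  have hm : Submodule.map₂ (redTensor L₁ L₂) l₁ l₂ ≤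
      (Submodule.map₂ (redTensor L₁ L₂) l₁' l₂').comap D := by
    rw [Submodule.map₂_le]
    intro x hx y hy
    rw [Submodule.mem_comap, hD x hx y hy]
    exact Submodule.apply_mem_map₂ _ (hA.mapsTo hx) (hB.mapsTo hy)
  have hm' : Submodule.map₂ (redTensor L₁ L₂) l₁' l₂' ≤
      (Submodule.map₂ (redTensor L₁ L₂) l₁ l₂).comap G := by
    rw [Submodule.map₂_le]
    intro x hx y hy
    rw [Submodule.mem_comap, hG]
    exact Submodule.apply_mem_map₂ _ (h11 x hx) (h21 y hy)
  have hl : Submodule.map₂ (redTensor L₁ L₂) l₁ l₂ ≤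
      LinearMap.eqLocus (G ∘ₗ D) LinearMap.id := by
    rw [Submodule.map₂_le]
    intro x hx y hy
    rw [LinearMap.mem_eqLocus, LinearMap.comp_apply, hD x hx y hy, hG, h12 x hx, h22 y hy,
      LinearMap.id_apply]
  have hr : Submodule.map₂ (redTensor L₁ L₂) l₁' l₂' ≤
      LinearMap.eqLocus (D ∘ₗ G) LinearMap.id := by
    rw [Submodule.map₂_le]
    intro x hx y hy
    rw [LinearMap.mem_eqLocus, LinearMap.comp_apply, hG, hD _ (h11 x hx) _ (h21 y hy), h13 x hx,
      h23 y hy, LinearMap.id_apply]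
  exact ⟨fun x hx => hm hx, Set.LeftInvOn.injOn (f₁' := G) fun x hx => hl hx,
    fun y hy => ⟨G y, hm' hy, hr hy⟩⟩

end red

end

section

variable {r : ℕ}

/-! ### Regular crystals -/

/-- An abstract crystal in which `ε_i(b)` and `φ_i(b)` are the lengths of the `i`-string through
`b` in the two directions. -/
structure GlCrystal.Regular {B : Type*} (C : GlCrystal r B) : Prop where
  isAbstract : C.IsAbstract
  eps_eq : ∀ i b, ∃ m : ℕ, C.eps i b = ((m : ℤ) : WithBot ℤ) ∧
    IsGreatest {k : ℕ | iter (C.e i) k b ≠ none} m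
  phi_eq : ∀ i b, ∃ m : ℕ, C.phi i b = ((m : ℤ) : WithBot ℤ) ∧
    IsGreatest {k : ℕ | iter (C.f i) k b ≠ none} m

theorem GlCrystal.IsGlCrystal.regular {B : Type*} {C : GlCrystal r B} (h : C.IsGlCrystal) :
    C.Regular := by
  obtain ⟨h1, d, ρ, L, β, -, h2⟩ := h
  exact ⟨h1, h2.eps_eq, h2.phi_eq⟩

theorem iter_one {B : Type*} (g : B → Option B) (b : B) : iter g 1 b = g b := rfl

theorem iter_succ {B : Type*} (g : B → Option B) (m : ℕ) (b : B) :
    iter g (m + 1) b = (g b).bind (iter g m) := by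
  induction m with
  | zero => simp [iter]
  | succ m ih =>
    rw [iter, ih]
    cases g b <;> rfl

/-- A function that drops by one along each arrow and is zero where no arrow starts counts the
remaining steps. -/
theorem iter_isGreatest {B : Type*} {g : B → Option B} {E : B → ℕ}
    (h0 : ∀ b, g b = none → E b = 0) (h1 : ∀ b b', g b = some b' → E b = E b' + 1) (b : B) :
    IsGreatest {k : ℕ | iter g k b ≠ none} (E b) := by
  have key : ∀ k b, iter g k b ≠ none ↔ k ≤ E b := by
    intro k
    induction k with
    | zero => simp [iter]
    | succ k ih =>
      intro b
      rw [iter_succ]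
      cases hb : g b with
      | none => simp [h0 b hb]
      | some b' => simp [h1 b b' hb, ← ih]
  constructor
  · exact (key _ _).2 le_rfl
  · exact fun k hk => (key _ _).1 hk

namespace GlCrystal.Regular

variable {B : Type*} {C : GlCrystal r B} (hC : C.Regular)
include hC

theorem e_eq_none {i : Fin r} {b : B} (h : C.eps i b = ((0 : ℤ) : WithBot ℤ)) :
    C.e i b = none := by
  obtain ⟨m, hm, h1⟩ := hC.eps_eq i b
  rw [hm, WithBot.coe_inj, Nat.cast_eq_zero] at h
  subst h
  by_contra hne
  have h2 : 1 ∈ {k : ℕ | iter (C.e i) k b ≠ none} := by simpa [iter_one] using hne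
  have := h1.2 h2
  omega

theorem exists_e {i : Fin r} {b : B} {m : ℕ} (h : C.eps i b = ((m + 1 : ℕ) : ℤ)) :
    ∃ b', C.e i b = some b' ∧ C.eps i b' = (m : ℤ) := by
  obtain ⟨m', hm, h1⟩ := hC.eps_eq i b
  rw [hm, WithBot.coe_inj, Nat.cast_inj] at h
  subst h
  have h2 : iter (C.e i) (m + 1) b ≠ none := h1.1
  rw [iter_succ] at h2
  cases hb : C.e i b with
  | none => rw [hb] at h2; simp at h2
  | some b' =>
    refine ⟨b', rfl, ?_⟩
    rw [hC.isAbstract.eps_e i b b' hb, hm, ← WithBot.coe_add]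
    congr 1
    push_cast; ring

/-- The lengths of the two halves of the `i`-string through `b`. -/
theorem exists_lengths (i : Fin r) (b : B) : ∃ c : ℕ, C.eps i b = (c : ℤ) ∧
    C.phi i b = ((c + pair (hh i) (C.wt b) : ℤ) : WithBot ℤ) ∧ 0 ≤ c + pair (hh i) (C.wt b) := by
  obtain ⟨c, hc, -⟩ := hC.eps_eq i b
  obtain ⟨d, hd, -⟩ := hC.phi_eq i b
  have h := hC.isAbstract.phi_eq i b
  rw [hc, ← WithBot.coe_add] at h
  refine ⟨c, hc, h, ?_⟩
  rw [h, WithBot.coe_inj] at hd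
  omega

end GlCrystal.Regular

/-! ### Crystals of subspaces -/

section fiber

variable {M : Type*} [AddCommGroup M] [Module Fq M] [Module Aq M] [IsScalarTower Aq Fq M]

theorem IsCrystalLattice.le_span {O : GlOps r M} {S : Set (Lat r)} {L : Submodule Aq M}
    (h : IsCrystalLattice O S L) :
    L ≤ Submodule.span Aq {u | u ∈ L ∧ ∃ μ ∈ S, u ∈ O.weightSpace μ} := by
  intro u hu
  have h1 : (⟨u, hu⟩ : L) ∈ ⨆ μ : S, latticeWeight O L μ := h.weight.2 ▸ Submodule.mem_top
  have h2 : ⨆ μ : S, latticeWeight O L μ ≤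
      (Submodule.span Aq {u | u ∈ L ∧ ∃ μ ∈ S, u ∈ O.weightSpace μ}).comap L.subtype :=
    iSup_le fun μ v hv => Submodule.subset_span ⟨v.2, μ, μ.2, hv⟩
  exact h2 h1

theorem IsCrystalLattice.tildeStable {O : GlOps r M} {S : Set (Lat r)} {L : Submodule Aq M}
    (h : IsCrystalLattice O S L) : TildeStable O L where
  e_stable := h.e_stable
  f_stable := h.f_stable
  weight := h.le_span.trans (Submodule.span_mono fun _ hu => ⟨hu.1, hu.2.imp fun _ h => h.2⟩)

/-- The properties of a crystal basis `(L, B, (l_b))` that concern the even arrows. -/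
structure FiberCrystal {B : Type*} (O : GlOps r M) (S : Set (Lat r)) (L : Submodule Aq M)
    (C : GlCrystal r B) (l : B → Submodule Aq (Red L)) : Prop where
  good : O.Good
  lattice : IsCrystalLattice O S L
  regular : C.Regular
  ne_bot : ∀ b, l b ≠ ⊥
  le_weight : ∀ b, l b ≤ redWeight O L (C.wt b)
  directSum : IsDirectSum l
  arrow_e : ∀ i b, InducesArrow (lattice.e_stable i) l b (C.e i b)
  arrow_f : ∀ i b, InducesArrow (lattice.f_stable i) l b (C.f i b)

namespace FiberCrystal

variable {B : Type*} {O : GlOps r M} {S : Set (Lat r)} {L : Submodule Aq M}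
  {C : GlCrystal r B} {l : B → Submodule Aq (Red L)} (h : FiberCrystal O S L C l)
include h

/-- Induction on `c`. If `ẽ_i b = 0`, then `ẽ_i` maps a representative into `qL`, and the components
of the image are those of positive index of the representative; only the highest weight component
survives. Otherwise one passes to `ẽ_i b` and returns by `f̃_i`. -/
theorem exists_highest_of_eps {i : Fin r} (c : ℕ) {b : B} (hc : C.eps i b = (c : ℤ)) {u : L}
    (hu : (qSub L).mkQ u ∈ l b) :
    ∃ x ∈ L, x ∈ O.weightSpace (C.wt b + (c : ℤ) • alpha i) ∧ O.e i x = 0 ∧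
      (u : M) - divPow (O.f i) c x ∈ qMul L := by
  have HL := h.lattice.tildeStable
  induction c generalizing b u with
  | zero =>
    have he := h.regular.e_eq_none hc
    have ha := h.arrow_e i b
    rw [he] at ha
    obtain ⟨v, hv, hvu⟩ := h.le_weight b hu
    have hvw : (v : M) ∈ O.weightSpace (C.wt b) := hv
    obtain ⟨w, hw, hvw'⟩ := (h.good.sl2 i).exists_str hvw
    have hE := ha _ hu
    rw [← hvu, redMap_eq_zero, hvw', h.good.isTildeE i _ w hw] at hE
    -- Shifting the indices by one turns the string decomposition of `v` into that of `ẽ_i v`.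
    have hw1 : IsStr O.weightSpace (pairHom (hh i)) (alpha i) (O.e i) (C.wt b + alpha i)
        (w.comapDomain Nat.succ Nat.succ_injective.injOn) := by
      intro k
      obtain ⟨h1, h2, h3⟩ := hw (k + 1)
      have e1 : C.wt b + alpha i + (k : ℤ) • alpha i = C.wt b + ((k + 1 : ℕ) : ℤ) • alpha i := by
        push_cast; module
      rw [Finsupp.comapDomain_apply, e1]
      exact ⟨h1, h2, fun h4 => by have := h3 h4; push_cast at this ⊢; omega⟩
    have hsum : (w.sum fun k v => if k = 0 then 0 else divPow (O.f i) (k - 1) v) =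
        (w.comapDomain Nat.succ Nat.succ_injective.injOn).sum fun k v => divPow (O.f i) k v := by
      have hsplit : w = Finsupp.single 0 (w 0) + Finsupp.mapDomain Nat.succ
          (w.comapDomain Nat.succ Nat.succ_injective.injOn) := by
        ext k
        cases k with
        | zero =>
          rw [Finsupp.add_apply, Finsupp.single_eq_same, Finsupp.mapDomain_of_notMem_range, add_zero]
          simp
        | succ k =>
          rw [Finsupp.add_apply, Finsupp.single_eq_of_ne (by simp), zero_add,
            Finsupp.mapDomain_apply Nat.succ_injective]
          rfl
      conv_lhs => rw [hsplit]
      rw [Finsupp.sum_add_index' (by simp) (fun k a a' => by split_ifs <;> simp),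
        Finsupp.sum_single_index (by simp), Finsupp.sum_mapDomain_index (by simp)
          (fun k a a' => by split_ifs <;> simp)]
      simp
    rw [hsum] at hE
    have hcomp := HL.string_mem_qMul h.good hw1 hE
    refine ⟨w 0, HL.string_mem h.good hw (by rw [← hvw']; exact v.2) 0, (hw 0).1, (hw 0).2.1, ?_⟩
    have h1 : (v : M) - w 0 ∈ qMul L := by
      have hs : (v : M) = w 0 + ∑ k ∈ w.support.erase 0, divPow (O.f i) k (w k) := by
        rw [hvw', Finsupp.sum]
        by_cases h0 : 0 ∈ w.support
        · rw [← Finset.add_sum_erase _ _ h0, divPow_zero]; rfl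
        · rw [Finset.erase_eq_of_notMem h0, Finsupp.notMem_support_iff.1 h0, zero_add]
      rw [hs, add_sub_cancel_left]
      refine Submodule.sum_mem _ fun k hk => ?_
      obtain ⟨k, rfl⟩ := Nat.exists_eq_succ_of_ne_zero (Finset.ne_of_mem_erase hk)
      have := hcomp k
      rw [Finsupp.comapDomain_apply] at this
      exact HL.divPow_mem_qMul h.good (hw (k + 1)).1 (hw (k + 1)).2.1 this _
    have h2 := mkQ_eq.1 hvu
    rw [divPow_zero, Module.End.one_apply]
    have := sub_mem h1 h2
    rwa [sub_sub_sub_cancel_left] at this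
  | succ c ih =>
    obtain ⟨b', hb', hc'⟩ := h.regular.exists_e hc
    have ha := h.arrow_e i b
    rw [hb'] at ha
    have hf := h.arrow_f i b'
    rw [(h.regular.isAbstract.f_iff_e i b' b).2 hb'] at hf
    have hEu := ha.mapsTo hu
    rw [redMap_mkQ] at hEu
    obtain ⟨x, hx, hxw, hex, hux⟩ := ih hc' hEu
    have hwt : C.wt b' + (c : ℤ) • alpha i = C.wt b + ((c + 1 : ℕ) : ℤ) • alpha i := by
      rw [h.regular.isAbstract.wt_e i b b' hb']; push_cast; module
    refine ⟨x, hx, hwt ▸ hxw, hex, ?_⟩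
    have hm := fun k => HL.divPow_mem h.good hxw hex hx k
    rw [← mkQ_eq (v := ⟨_, hm (c + 1)⟩)]
    have h1 : redMap (h.lattice.f_stable i) ((qSub L).mkQ ⟨_, h.lattice.e_stable i u u.2⟩) =
        (qSub L).mkQ ⟨_, hm (c + 1)⟩ := by
      rw [(mkQ_eq (v := ⟨_, hm c⟩)).2 hux, redMap_eq, h.good.tildeF_divPow hxw hex, sub_self]
      exact zero_mem _
    -- The classes of `u` and of `f_i^{(c+1)} x` both lie in `l_b` and have the same image under
    -- `ẽ_i`, which is injective there.
    refine ha.injOn hu ?_ ?_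
    · rw [← h1]
      exact hf.mapsTo hEu
    · rw [redMap_mkQ, redMap_mkQ, mkQ_eq]
      obtain ⟨c', hc1, -, hc3⟩ := h.regular.exists_lengths i b
      rw [hc, WithBot.coe_inj] at hc1
      have h2 := h.good.tildeE_divPow_succ hxw hex (k := c) (by
        rw [hwt, pairHom_apply, pair_add_right, pair_zsmul_right, pair_hh_alpha]
        omega)
      rw [← h2] at hux
      exact hux

theorem exists_highest (i : Fin r) {b : B} {a : Red L} (ha : a ∈ l b) :
    ∃ (c : ℕ) (x : M) (hx : strVec (O.f i) x c ∈ L), C.eps i b = (c : ℤ) ∧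
      C.phi i b = ((c + pair (hh i) (C.wt b) : ℤ) : WithBot ℤ) ∧ 0 ≤ c + pair (hh i) (C.wt b) ∧
      x ∈ L ∧ x ∈ O.weightSpace (C.wt b + (c : ℤ) • alpha i) ∧ O.e i x = 0 ∧
      a = (qSub L).mkQ ⟨strVec (O.f i) x c, hx⟩ := by
  obtain ⟨u, rfl⟩ := (qSub L).mkQ_surjective a
  obtain ⟨c, hc, h1, h2⟩ := h.regular.exists_lengths i b
  obtain ⟨x, hx, hxw, hex, hux⟩ := h.exists_highest_of_eps c hc ha
  refine ⟨c, x, h.lattice.tildeStable.strVec_mem h.good hxw hex hx _, hc, h1, h2, hx, hxw, hex, ?_⟩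
  rw [← strVec_natCast] at hux
  exact mkQ_eq.2 hux

end FiberCrystal

end fiber

/-! ### The signature rule on fibres -/

section rule

variable {M₁ M₂ : Type*} [AddCommGroup M₁] [Module Fq M₁] [Module Aq M₁]
  [IsScalarTower Aq Fq M₁] [AddCommGroup M₂] [Module Fq M₂] [Module Aq M₂] [IsScalarTower Aq Fq M₂]
  {B₁ B₂ : Type*} {O₁ : GlOps r M₁} {O₂ : GlOps r M₂} {S : Set (Lat r)} {L₁ : Submodule Aq M₁}
  {L₂ : Submodule Aq M₂} {C₁ : GlCrystal r B₁} {C₂ : GlCrystal r B₂}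
  {l₁ : B₁ → Submodule Aq (Red L₁)} {l₂ : B₂ → Submodule Aq (Red L₂)}
  (h₁ : FiberCrystal O₁ S L₁ C₁ l₁) (h₂ : FiberCrystal O₂ S L₂ C₂ l₂)
include h₁ h₂

theorem FiberCrystal.tildeF_redTensor (i : Fin r) (hF : Stable (tensorLattice L₁ L₂)
    ((O₁.tensor O₂).tildeF i)) {b : B₁ × B₂} {x : Red L₁} {y : Red L₂} (hx : x ∈ l₁ b.1)
    (hy : y ∈ l₂ b.2) [Decidable (C₁.phi i b.1 > C₂.eps i b.2)] :
    redMap hF (redTensor L₁ L₂ x y) = if C₁.phi i b.1 > C₂.eps i b.2 then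
      redTensor L₁ L₂ (redMap (h₁.lattice.f_stable i) x) y else
      redTensor L₁ L₂ x (redMap (h₂.lattice.f_stable i) y) := by
  obtain ⟨c, x, hxc, -, e2, e3, hxL, hxw, hex, rfl⟩ := h₁.exists_highest i hx
  obtain ⟨d, y, hyd, f1, f2, f3, hyL, hyw, hey, rfl⟩ := h₂.exists_highest i hy
  have H₁ := h₁.lattice.tildeStable
  have H₂ := h₂.lattice.tildeStable
  have hp : ∀ μ (c : ℕ), pair (hh i) (μ + (c : ℤ) • alpha i) = pair (hh i) μ + 2 * c := by
    intro μ c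
    rw [pair_add_right, pair_zsmul_right, pair_hh_alpha]; ring
  have key := tildeF_strVec_tmul h₁.good h₂.good H₁ H₂ hxw hyw hex hey hxL hyL
    (j := c) (k := d) (by rw [hp]; omega) (by rw [hp]; omega)
  have hx1 : O₁.tildeF i (strVec (O₁.f i) x c) = strVec (O₁.f i) x (c + 1) := by
    have := strVec_natCast (O₁.f i) x (c + 1)
    push_cast at this
    rw [this, strVec_natCast, h₁.good.tildeF_divPow hxw hex]
  have hy1 : O₂.tildeF i (strVec (O₂.f i) y d) = strVec (O₂.f i) y (d + 1) := by
    have := strVec_natCast (O₂.f i) y (d + 1)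
    push_cast at this
    rw [this, strVec_natCast, h₂.good.tildeF_divPow hyw hey]
  rw [redTensor_mkQ, redMap_mkQ, redMap_mkQ, redMap_mkQ, redTensor_mkQ, redTensor_mkQ]
  -- The string through `x` has length `⟨h_i, wt b₁⟩ + 2c = φ_i(b₁) + c`, so `φ_i(b₁)` steps remain
  -- after the first `c`; likewise `d = ε_i(b₂)`.
  have hc : C₁.phi i b.1 > C₂.eps i b.2 ↔ (d : ℤ) <
      pair (hh i) (C₁.wt b.1 + (c : ℤ) • alpha i) - c := by
    rw [e2, f1, gt_iff_lt, WithBot.coe_lt_coe, hp]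
    omega
  by_cases hlt : C₁.phi i b.1 > C₂.eps i b.2
  · rw [if_pos (hc.1 hlt), ← hx1] at key
    rw [if_pos hlt, mkQ_eq]
    exact key
  · rw [if_neg (mt hc.2 hlt), ← hy1] at key
    rw [if_neg hlt, mkQ_eq]
    exact key

theorem FiberCrystal.tildeE_redTensor (i : Fin r) (hE : Stable (tensorLattice L₁ L₂)
    ((O₁.tensor O₂).tildeE i)) {b : B₁ × B₂} {x : Red L₁} {y : Red L₂} (hx : x ∈ l₁ b.1)
    (hy : y ∈ l₂ b.2) [Decidable (C₁.phi i b.1 ≥ C₂.eps i b.2)] :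
    redMap hE (redTensor L₁ L₂ x y) = if C₁.phi i b.1 ≥ C₂.eps i b.2 then
      redTensor L₁ L₂ (redMap (h₁.lattice.e_stable i) x) y else
      redTensor L₁ L₂ x (redMap (h₂.lattice.e_stable i) y) := by
  obtain ⟨c, x, hxc, -, e2, e3, hxL, hxw, hex, rfl⟩ := h₁.exists_highest i hx
  obtain ⟨d, y, hyd, f1, f2, f3, hyL, hyw, hey, rfl⟩ := h₂.exists_highest i hy
  have H₁ := h₁.lattice.tildeStable
  have H₂ := h₂.lattice.tildeStable
  have hp : ∀ μ (c : ℕ), pair (hh i) (μ + (c : ℤ) • alpha i) = pair (hh i) μ + 2 * c := by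
    intro μ c
    rw [pair_add_right, pair_zsmul_right, pair_hh_alpha]; ring
  have key := tildeE_strVec_tmul h₁.good h₂.good H₁ H₂ hxw hyw hex hey hxL hyL
    (j := c) (k := d) (by rw [hp]; omega) (by rw [hp]; omega)
  have hx1 : O₁.tildeE i (strVec (O₁.f i) x c) = strVec (O₁.f i) x (c - 1) := by
    rw [strVec_natCast, h₁.good.tildeE_divPow hxw hex (by rw [pairHom_apply, hp]; omega)]
    cases c with
    | zero => rw [if_pos rfl, strVec_of_neg _ _ (by simp)]
    | succ c => simp [strVec_natCast]
  have hy1 : O₂.tildeE i (strVec (O₂.f i) y d) = strVec (O₂.f i) y (d - 1) := by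
    rw [strVec_natCast, h₂.good.tildeE_divPow hyw hey (by rw [pairHom_apply, hp]; omega)]
    cases d with
    | zero => rw [if_pos rfl, strVec_of_neg _ _ (by simp)]
    | succ c => simp [strVec_natCast]
  rw [redTensor_mkQ, redMap_mkQ, redMap_mkQ, redMap_mkQ, redTensor_mkQ, redTensor_mkQ]
  have hc : C₁.phi i b.1 ≥ C₂.eps i b.2 ↔ (d : ℤ) ≤
      pair (hh i) (C₁.wt b.1 + (c : ℤ) • alpha i) - c := by
    rw [e2, f1, ge_iff_le, WithBot.coe_le_coe, hp]
    omega
  by_cases hlt : C₁.phi i b.1 ≥ C₂.eps i b.2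
  · rw [if_pos (hc.1 hlt), ← hx1] at key
    rw [if_pos hlt, mkQ_eq]
    exact key
  · rw [if_neg (mt hc.2 hlt), ← hy1] at key
    rw [if_neg hlt, mkQ_eq]
    exact key

end rule

end

section

variable {r : ℕ}

/-! ### Tensor products of regular crystals -/

section

variable {B : Type*} {C : GlCrystal r B}

theorem iter_of_eq_none {g : B → Option B} {b : B} (h : g b = none) {m : ℕ}
    (hm : iter g m b ≠ none) : m = 0 := by
  cases m with
  | zero => rfl
  | succ m => rw [iter_succ, h] at hm; simp at hm

/-- The functions `ε_i` and `φ_i` of a regular crystal take natural numbers as values. -/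
theorem GlCrystal.Regular.exists_eps_phi (hC : C.Regular) (i : Fin r) : ∃ c p : B → ℤ,
    (∀ b, C.eps i b = (c b : WithBot ℤ)) ∧ (∀ b, C.phi i b = (p b : WithBot ℤ)) ∧
    (∀ b, p b = c b + pair (hh i) (C.wt b)) ∧ (∀ b, 0 ≤ c b) ∧ (∀ b, 0 ≤ p b) ∧
    (∀ b, C.e i b = none → c b = 0) ∧ (∀ b, C.f i b = none → p b = 0) ∧
    (∀ b b', C.e i b = some b' → c b' = c b - 1 ∧ p b' = p b + 1) ∧
    (∀ b b', C.f i b = some b' → c b' = c b + 1 ∧ p b' = p b - 1) := by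
  choose c hc hc' using hC.eps_eq i
  choose p hp hp' using hC.phi_eq i
  refine ⟨fun b => c b, fun b => p b, hc, hp, fun b => ?_, fun b => by positivity,
    fun b => by positivity, fun b h => ?_, fun b h => ?_, fun b b' h => ⟨?_, ?_⟩,
    fun b b' h => ⟨?_, ?_⟩⟩
  · have := hC.isAbstract.phi_eq i b
    rwa [hc, hp, ← WithBot.coe_add, WithBot.coe_inj] at this
  · simpa using iter_of_eq_none h (hc' b).1
  · simpa using iter_of_eq_none h (hp' b).1
  · have := hC.isAbstract.eps_e i b b' h
    rwa [hc, hc, ← WithBot.coe_add, WithBot.coe_inj] at this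
  · have := hC.isAbstract.phi_e i b b' h
    rwa [hp, hp, ← WithBot.coe_add, WithBot.coe_inj] at this
  · have := hC.isAbstract.eps_f i b b' h
    rwa [hc, hc, ← WithBot.coe_add, WithBot.coe_inj] at this
  · have := hC.isAbstract.phi_f i b b' h
    rwa [hp, hp, ← WithBot.coe_add, WithBot.coe_inj] at this

end

variable {B₁ B₂ : Type*} {C₁ : GlCrystal r B₁} {C₂ : GlCrystal r B₂}

/-- With `c = ε_i` and `p = φ_i` as integers, the tensor product has `ε_i = c₁ + max(0, c₂ - p₁)`
and `φ_i = p₂ + max(0, p₁ - c₂)`. In this form the axioms are linear arithmetic in each case of the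
signature rule, and `iter_isGreatest` identifies the two functions as string lengths. -/
theorem GlCrystal.Regular.tensor (h₁ : C₁.Regular) (h₂ : C₂.Regular) :
    (C₁.tensor C₂).Regular := by
  classical
  choose c₁ p₁ e₁ f₁ w₁ c₁0 p₁0 en₁ fn₁ es₁ fs₁ using h₁.exists_eps_phi
  choose c₂ p₂ e₂ f₂ w₂ c₂0 p₂0 en₂ fn₂ es₂ fs₂ using h₂.exists_eps_phi
  have hE : ∀ i b, (C₁.tensor C₂).eps i b =
      ((c₁ i b.1 + max 0 (c₂ i b.2 - p₁ i b.1) : ℤ) : WithBot ℤ) := by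
    intro i b
    have := w₁ i b.1
    simp only [GlCrystal.tensor, e₁, e₂]
    rw [← WithBot.coe_add, ← WithBot.coe_max, WithBot.coe_inj]
    omega
  have hP : ∀ i b, (C₁.tensor C₂).phi i b =
      ((p₂ i b.2 + max 0 (p₁ i b.1 - c₂ i b.2) : ℤ) : WithBot ℤ) := by
    intro i b
    have := w₂ i b.2
    simp only [GlCrystal.tensor, f₁, f₂]
    rw [← WithBot.coe_add, ← WithBot.coe_max, WithBot.coe_inj]
    omega
  have he : ∀ i b b', (C₁.tensor C₂).e i b = some b' ↔
      (c₂ i b.2 ≤ p₁ i b.1 ∧ C₁.e i b.1 = some b'.1 ∧ b.2 = b'.2) ∨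
      (p₁ i b.1 < c₂ i b.2 ∧ b.1 = b'.1 ∧ C₂.e i b.2 = some b'.2) := by
    rintro i b ⟨b₁', b₂'⟩
    simp only [GlCrystal.tensor, f₁, e₂, ge_iff_le, WithBot.coe_le_coe]
    split_ifs with h
    · simp only [Option.map_eq_some_iff, Prod.mk.injEq]
      constructor
      · rintro ⟨a, ha, rfl, h'⟩; exact Or.inl ⟨h, ha, h'⟩
      · rintro (h' | h')
        · exact ⟨_, h'.2.1, rfl, h'.2.2⟩
        · omega
    · simp only [Option.map_eq_some_iff, Prod.mk.injEq]
      constructor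
      · rintro ⟨a, ha, h', rfl⟩; exact Or.inr ⟨by omega, h', ha⟩
      · rintro (h' | h')
        · omega
        · exact ⟨_, h'.2.2, h'.2.1, rfl⟩
  have hf : ∀ i b b', (C₁.tensor C₂).f i b = some b' ↔
      (c₂ i b.2 < p₁ i b.1 ∧ C₁.f i b.1 = some b'.1 ∧ b.2 = b'.2) ∨
      (p₁ i b.1 ≤ c₂ i b.2 ∧ b.1 = b'.1 ∧ C₂.f i b.2 = some b'.2) := by
    rintro i b ⟨b₁', b₂'⟩
    simp only [GlCrystal.tensor, f₁, e₂, gt_iff_lt, WithBot.coe_lt_coe]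
    split_ifs with h
    · simp only [Option.map_eq_some_iff, Prod.mk.injEq]
      constructor
      · rintro ⟨a, ha, rfl, h'⟩; exact Or.inl ⟨h, ha, h'⟩
      · rintro (h' | h')
        · exact ⟨_, h'.2.1, rfl, h'.2.2⟩
        · omega
    · simp only [Option.map_eq_some_iff, Prod.mk.injEq]
      constructor
      · rintro ⟨a, ha, h', rfl⟩; exact Or.inr ⟨by omega, h', ha⟩
      · rintro (h' | h')
        · omega
        · exact ⟨_, h'.2.2, h'.2.1, rfl⟩
  have hen : ∀ i b, (C₁.tensor C₂).e i b = none →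
      c₁ i b.1 + max 0 (c₂ i b.2 - p₁ i b.1) = 0 := by
    intro i b h
    simp only [GlCrystal.tensor, f₁, e₂, ge_iff_le, WithBot.coe_le_coe] at h
    split_ifs at h with h'
    · have := en₁ i b.1 (by simpa using h)
      omega
    · have := en₂ i b.2 (by simpa using h)
      have := p₁0 i b.1
      omega
  have hfn : ∀ i b, (C₁.tensor C₂).f i b = none →
      p₂ i b.2 + max 0 (p₁ i b.1 - c₂ i b.2) = 0 := by
    intro i b h
    simp only [GlCrystal.tensor, f₁, e₂, gt_iff_lt, WithBot.coe_lt_coe] at h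
    split_ifs at h with h'
    · have := fn₁ i b.1 (by simpa using h)
      have := c₂0 i b.2
      omega
    · have := fn₂ i b.2 (by simpa using h)
      omega
  have hes : ∀ i b b', (C₁.tensor C₂).e i b = some b' →
      c₁ i b'.1 + max 0 (c₂ i b'.2 - p₁ i b'.1) = c₁ i b.1 + max 0 (c₂ i b.2 - p₁ i b.1) - 1 ∧
      p₂ i b'.2 + max 0 (p₁ i b'.1 - c₂ i b'.2) = p₂ i b.2 + max 0 (p₁ i b.1 - c₂ i b.2) + 1 := by
    intro i b b' h
    rcases (he i b b').1 h with ⟨h1, h2, h3⟩ | ⟨h1, h2, h3⟩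
    · have := es₁ i _ _ h2
      rw [← h3]
      omega
    · have := es₂ i _ _ h3
      rw [← h2]
      omega
  have hfs : ∀ i b b', (C₁.tensor C₂).f i b = some b' →
      c₁ i b'.1 + max 0 (c₂ i b'.2 - p₁ i b'.1) = c₁ i b.1 + max 0 (c₂ i b.2 - p₁ i b.1) + 1 ∧
      p₂ i b'.2 + max 0 (p₁ i b'.1 - c₂ i b'.2) = p₂ i b.2 + max 0 (p₁ i b.1 - c₂ i b.2) - 1 := by
    intro i b b' h
    rcases (hf i b b').1 h with ⟨h1, h2, h3⟩ | ⟨h1, h2, h3⟩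
    · have := fs₁ i _ _ h2
      rw [← h3]
      omega
    · have := fs₂ i _ _ h3
      rw [← h2]
      omega
  have hwt : ∀ b, (C₁.tensor C₂).wt b = C₁.wt b.1 + C₂.wt b.2 := fun b => rfl
  have A₁ := h₁.isAbstract
  have A₂ := h₂.isAbstract
  refine ⟨⟨?_, ?_, ?_, ?_, ?_, ?_, ?_, ?_, ?_⟩, ?_, ?_⟩
  · intro i b b' h
    rcases (he i b b').1 h with ⟨-, h2, h3⟩ | ⟨-, h2, h3⟩
    · rw [hwt, hwt, A₁.wt_e i _ _ h2, h3]; abel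
    · rw [hwt, hwt, A₂.wt_e i _ _ h3, h2]; abel
  · intro i b b' h
    rcases (hf i b b').1 h with ⟨-, h2, h3⟩ | ⟨-, h2, h3⟩
    · rw [hwt, hwt, A₁.wt_f i _ _ h2, h3]; abel
    · rw [hwt, hwt, A₂.wt_f i _ _ h3, h2]; abel
  · intro i b
    rw [hE, hP, hwt, pair_add_right, ← WithBot.coe_add, WithBot.coe_inj]
    have := w₁ i b.1
    have := w₂ i b.2
    omega
  · intro i b b'
    rw [he, hf]
    constructor
    · rintro (⟨h1, h2, h3⟩ | ⟨h1, h2, h3⟩)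
      · have := fs₁ i _ _ h2
        exact Or.inl ⟨by rw [← h3]; omega, (A₁.f_iff_e _ _ _).1 h2, h3.symm⟩
      · have := fs₂ i _ _ h3
        exact Or.inr ⟨by rw [← h2]; omega, h2.symm, (A₂.f_iff_e _ _ _).1 h3⟩
    · rintro (⟨h1, h2, h3⟩ | ⟨h1, h2, h3⟩)
      · have := es₁ i _ _ h2
        exact Or.inl ⟨by rw [← h3]; omega, (A₁.f_iff_e _ _ _).2 h2, h3.symm⟩
      · have := es₂ i _ _ h3
        exact Or.inr ⟨by rw [← h2]; omega, h2.symm, (A₂.f_iff_e _ _ _).2 h3⟩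
  · intro i b b' h
    rw [hE, hE, (hes i b b' h).1, ← WithBot.coe_add, sub_eq_add_neg]
  · intro i b b' h
    rw [hP, hP, (hes i b b' h).2, ← WithBot.coe_add]
  · intro i b b' h
    rw [hE, hE, (hfs i b b' h).1, ← WithBot.coe_add]
  · intro i b b' h
    rw [hP, hP, (hfs i b b' h).2, ← WithBot.coe_add, sub_eq_add_neg]
  · intro i b h
    rw [hP] at h
    exact absurd h WithBot.coe_ne_bot
  · intro i b
    have h0 : ∀ b : B₁ × B₂, 0 ≤ c₁ i b.1 + max 0 (c₂ i b.2 - p₁ i b.1) := fun b => by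
      have := c₁0 i b.1
      omega
    refine ⟨_, ?_, iter_isGreatest
      (E := fun b => (c₁ i b.1 + max 0 (c₂ i b.2 - p₁ i b.1)).toNat) ?_ ?_ b⟩
    · rw [hE, Int.toNat_of_nonneg (h0 b)]
    · intro b h
      simp only [hen i b h, Int.toNat_zero]
    · intro b b' h
      have := hes i b b' h
      have := h0 b'
      omega
  · intro i b
    have h0 : ∀ b : B₁ × B₂, 0 ≤ p₂ i b.2 + max 0 (p₁ i b.1 - c₂ i b.2) := fun b => by
      have := p₂0 i b.2
      omega
    refine ⟨_, ?_, iter_isGreatest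
      (E := fun b => (p₂ i b.2 + max 0 (p₁ i b.1 - c₂ i b.2)).toNat) ?_ ?_ b⟩
    · rw [hP, Int.toNat_of_nonneg (h0 b)]
    · intro b h
      simp only [hfn i b h, Int.toNat_zero]
    · intro b b' h
      have := hfs i b b' h
      have := h0 b'
      omega

end

section

variable {r : ℕ}

/-! ### The tensor product theorem for the even arrows -/

section lattice

variable {M : Type*} [AddCommGroup M] [Module Fq M] [Module Aq M] [IsScalarTower Aq Fq M]

/-- Independence is inherited from the module; only the spanning property uses that `L` is generated
by weight vectors. -/
theorem isDirectSum_latticeWeight {O : GlOps r M} (H : O.IsWeightModule) {S : Set (Lat r)}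
    {L : Submodule Aq M}
    (h : L ≤ Submodule.span Aq {u | u ∈ L ∧ ∃ μ ∈ S, u ∈ O.weightSpace μ}) :
    IsDirectSum fun μ : S => latticeWeight O L μ := by
  choose p h1 h2 h3 using IsDirectSum.exists_proj H
  constructor
  · refine iSupIndep_of_maps (fun μ : S => ((p μ).restrictScalars Aq) ∘ₗ L.subtype) ?_ ?_
    · intro μ x hx h0
      exact Subtype.ext ((h1 μ x hx).symm.trans h0)
    · intro μ ν hν x hx
      exact h2 μ ν (fun h => hν (Subtype.ext h)) x hx
  · rw [eq_top_iff]
    rintro ⟨u, hu⟩ -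
    have h4 : Submodule.span Aq {u | u ∈ L ∧ ∃ μ ∈ S, u ∈ O.weightSpace μ} ≤
        (⨆ μ : S, latticeWeight O L μ).map L.subtype := by
      refine Submodule.span_le.2 ?_
      rintro v ⟨hv, μ, hμ, hvμ⟩
      exact ⟨⟨v, hv⟩, (le_iSup (fun μ : S => latticeWeight O L μ) ⟨μ, hμ⟩) hvμ, rfl⟩
    obtain ⟨v, hv, hvu⟩ := h4 (h hu)
    rwa [← show v = ⟨u, hu⟩ from Subtype.ext hvu]

end lattice

section tensor

variable {M₁ M₂ : Type*} [AddCommGroup M₁] [Module Fq M₁] [Module Aq M₁]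
  [IsScalarTower Aq Fq M₁] [AddCommGroup M₂] [Module Fq M₂] [Module Aq M₂] [IsScalarTower Aq Fq M₂]
  {B₁ B₂ : Type*} {S : Set (Lat r)} {L₁ : Submodule Aq M₁} {L₂ : Submodule Aq M₂}
  {l₁ : B₁ → Submodule Aq (Red L₁)} {l₂ : B₂ → Submodule Aq (Red L₂)}

theorem IsCrystalLattice.tensor {O₁ : GlOps r M₁} {O₂ : GlOps r M₂} (H₁ : O₁.Good) (H₂ : O₂.Good)
    (h₁ : IsCrystalLattice O₁ S L₁) (h₂ : IsCrystalLattice O₂ S L₂)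
    (hS : ∀ μ ∈ S, ∀ ν ∈ S, μ + ν ∈ S) :
    IsCrystalLattice (O₁.tensor O₂) S (tensorLattice L₁ L₂) where
  free := have := h₁.free; have := h₂.free; free_tensorLattice h₁.base h₂.base
  base := have := h₁.free; have := h₂.free; isBaseChange_tensorLattice h₁.base h₂.base
  weight := by
    refine isDirectSum_latticeWeight (H₁.tensor H₂).weight (tensorLattice_le h₁.le_span h₂.le_span ?_)
    rintro x ⟨hx, μ, hμ, hxμ⟩ y ⟨hy, ν, hν, hyν⟩
    exact Submodule.subset_span ⟨tmul_mem_tensorLattice hx hy, μ + ν, hS μ hμ ν hν,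
      tmul_mem_weightSpace hxμ hyν⟩
  e_stable := h₁.tildeStable.tildeE_tensor h₂.tildeStable H₁ H₂
  f_stable := h₁.tildeStable.tildeF_tensor h₂.tildeStable H₁ H₂

theorem tensorFiber_le {b : B₁ × B₂} {X : Submodule Aq (Red (tensorLattice L₁ L₂))}
    (h : ∀ x ∈ l₁ b.1, ∀ y ∈ l₂ b.2, redTensor L₁ L₂ x y ∈ X) : tensorFiber l₁ l₂ b ≤ X := by
  rw [tensorFiber_eq_map₂, Submodule.map₂_le]
  exact h

theorem redTensor_mem_tensorFiber {b : B₁ × B₂} {x : Red L₁} {y : Red L₂} (hx : x ∈ l₁ b.1)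
    (hy : y ∈ l₂ b.2) : redTensor L₁ L₂ x y ∈ tensorFiber l₁ l₂ b := by
  rw [tensorFiber_eq_map₂]
  exact Submodule.apply_mem_map₂ _ hx hy

variable [Module.Free Aq L₁] [Module.Free Aq L₂]
  (h₁ : IsBaseChange Fq L₁.subtype) (h₂ : IsBaseChange Fq L₂.subtype)
  (hl₁ : IsDirectSum l₁) (hl₂ : IsDirectSum l₂) {T : Module.End Fq (M₁ ⊗[Fq] M₂)}
  (hT : Stable (tensorLattice L₁ L₂) T) {b : B₁ × B₂}

include h₁ h₂ hl₁ hl₂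

theorem inducesArrow_left {T₁ : Module.End Fq M₁} {hT₁ : Stable L₁ T₁} {o : Option B₁}
    (ha : InducesArrow hT₁ l₁ b.1 o)
    (hr : ∀ x ∈ l₁ b.1, ∀ y ∈ l₂ b.2, redMap hT (redTensor L₁ L₂ x y) =
      redTensor L₁ L₂ (redMap hT₁ x) y) :
    InducesArrow hT (tensorFiber l₁ l₂) b (o.map fun b₁ => (b₁, b.2)) := by
  cases o with
  | none =>
    refine tensorFiber_le (X := LinearMap.ker (redMap hT)) fun x hx y hy => ?_
    rw [LinearMap.mem_ker, hr x hx y hy, ha x hx, map_zero, LinearMap.zero_apply]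
  | some b' =>
    simp only [Option.map_some, InducesArrow, tensorFiber_eq_map₂]
    refine bijOn_map₂ h₁ h₂ ha (B := LinearMap.id) (Set.bijOn_id _) ?_ ?_ hr
    · exact (hl₁.exists_proj b').imp fun p hp => ⟨hp.1, hp.2.2⟩
    · exact (hl₂.exists_proj b.2).imp fun p hp => ⟨hp.1, hp.2.2⟩

/-- The operator `A` leaves room for the Koszul sign: it is the identity for the even arrows and the
parity operator for the odd ones. -/
theorem inducesArrow_right {T₂ : Module.End Fq M₂} {hT₂ : Stable L₂ T₂} {o : Option B₂}
    (ha : InducesArrow hT₂ l₂ b.2 o) {A : Red L₁ →ₗ[Aq] Red L₁}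
    (hA : Set.BijOn A (l₁ b.1) (l₁ b.1))
    (hr : ∀ x ∈ l₁ b.1, ∀ y ∈ l₂ b.2, redMap hT (redTensor L₁ L₂ x y) =
      redTensor L₁ L₂ (A x) (redMap hT₂ y)) :
    InducesArrow hT (tensorFiber l₁ l₂) b (o.map fun b₂ => (b.1, b₂)) := by
  cases o with
  | none =>
    refine tensorFiber_le (X := LinearMap.ker (redMap hT)) fun x hx y hy => ?_
    rw [LinearMap.mem_ker, hr x hx y hy, ha y hy, map_zero]
  | some b' =>
    simp only [Option.map_some, InducesArrow, tensorFiber_eq_map₂]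
    refine bijOn_map₂ h₁ h₂ hA ha ?_ ?_ hr
    · exact (hl₁.exists_proj b.1).imp fun p hp => ⟨hp.1, hp.2.2⟩
    · exact (hl₂.exists_proj b').imp fun p hp => ⟨hp.1, hp.2.2⟩

end tensor

section tensor

variable {M₁ M₂ : Type*} [AddCommGroup M₁] [Module Fq M₁] [Module Aq M₁]
  [IsScalarTower Aq Fq M₁] [AddCommGroup M₂] [Module Fq M₂] [Module Aq M₂] [IsScalarTower Aq Fq M₂]
  {B₁ B₂ : Type*} {O₁ : GlOps r M₁} {O₂ : GlOps r M₂} {S : Set (Lat r)} {L₁ : Submodule Aq M₁}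
  {L₂ : Submodule Aq M₂} {C₁ : GlCrystal r B₁} {C₂ : GlCrystal r B₂}
  {l₁ : B₁ → Submodule Aq (Red L₁)} {l₂ : B₂ → Submodule Aq (Red L₂)}
  (h₁ : FiberCrystal O₁ S L₁ C₁ l₁) (h₂ : FiberCrystal O₂ S L₂ C₂ l₂)
include h₁ h₂

omit h₁ h₂ in
theorem redTensor_mem_redWeight {μ ν : Lat r} {x : Red L₁} {y : Red L₂}
    (hx : x ∈ redWeight O₁ L₁ μ) (hy : y ∈ redWeight O₂ L₂ ν) :
    redTensor L₁ L₂ x y ∈ redWeight (O₁.tensor O₂) (tensorLattice L₁ L₂) (μ + ν) := by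
  obtain ⟨u, hu, rfl⟩ := hx
  obtain ⟨v, hv, rfl⟩ := hy
  exact ⟨tensorElt u v, tmul_mem_weightSpace (O₁ := O₁) (O₂ := O₂) hu hv, rfl⟩

theorem FiberCrystal.tensor (hS : ∀ μ ∈ S, ∀ ν ∈ S, μ + ν ∈ S) :
    FiberCrystal (O₁.tensor O₂) S (tensorLattice L₁ L₂) (C₁.tensor C₂) (tensorFiber l₁ l₂) := by
  classical
  have F₁ := h₁.lattice.free
  have F₂ := h₂.lattice.free
  have HL := h₁.lattice.tensor h₁.good h₂.good h₂.lattice hS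
  refine ⟨h₁.good.tensor h₂.good, HL, h₁.regular.tensor h₂.regular, ?_, ?_, ?_, ?_, ?_⟩
  · intro b hb
    obtain ⟨x, hx, hx0⟩ := (Submodule.ne_bot_iff _).1 (h₁.ne_bot b.1)
    obtain ⟨y, hy, hy0⟩ := (Submodule.ne_bot_iff _).1 (h₂.ne_bot b.2)
    have := redTensor_mem_tensorFiber (b := b) hx hy
    rw [hb, Submodule.mem_bot] at this
    exact redTensor_ne_zero h₁.lattice.base h₂.lattice.base hx0 hy0 this
  · exact fun b => tensorFiber_le fun x hx y hy => redTensor_mem_redWeight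
      (h₁.le_weight b.1 hx) (h₂.le_weight b.2 hy)
  · exact isDirectSum_map₂ h₁.lattice.base h₂.lattice.base h₁.directSum h₂.directSum
  · intro i b
    simp only [GlCrystal.tensor]
    by_cases hc : C₁.phi i b.1 ≥ C₂.eps i b.2
    · rw [if_pos hc]
      refine inducesArrow_left h₁.lattice.base h₂.lattice.base h₁.directSum h₂.directSum _
        (h₁.arrow_e i b.1) fun x hx y hy => ?_
      rw [h₁.tildeE_redTensor h₂ i (HL.e_stable i) hx hy, if_pos hc]
    · rw [if_neg hc]
      refine inducesArrow_right h₁.lattice.base h₂.lattice.base h₁.directSum h₂.directSum _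
        (h₂.arrow_e i b.2) (A := LinearMap.id) (Set.bijOn_id _) fun x hx y hy => ?_
      rw [h₁.tildeE_redTensor h₂ i (HL.e_stable i) hx hy, if_neg hc]
      rfl
  · intro i b
    simp only [GlCrystal.tensor]
    by_cases hc : C₁.phi i b.1 > C₂.eps i b.2
    · rw [if_pos hc]
      refine inducesArrow_left h₁.lattice.base h₂.lattice.base h₁.directSum h₂.directSum _
        (h₁.arrow_f i b.1) fun x hx y hy => ?_
      rw [h₁.tildeF_redTensor h₂ i (HL.f_stable i) hx hy, if_pos hc]
    · rw [if_neg hc]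
      refine inducesArrow_right h₁.lattice.base h₂.lattice.base h₁.directSum h₂.directSum _
        (h₂.arrow_f i b.2) (A := LinearMap.id) (Set.bijOn_id _) fun x hx y hy => ?_
      rw [h₁.tildeF_redTensor h₂ i (HL.f_stable i) hx hy, if_neg hc]
      rfl

end tensor

end

section

variable {r : ℕ}

/-! ### Tensor products of `𝔤𝔩(n)`-crystals -/

section

variable {M : Type*} [AddCommGroup M] [Module Fq M] [Module Aq M] [IsScalarTower Aq Fq M]

/-- `𝐀` is local: a scalar that kills a nonzero class is not a unit, hence is divisible by `q`,
which acts by zero. -/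
theorem smul_red_eq_zero {L : Submodule Aq M} {a : Aq} {x y : Red L} (h : a • x = 0)
    (hx : x ≠ 0) : a • y = 0 := by
  have ha : ¬ IsUnit a := fun hu => hx (hu.smul_eq_zero.1 h)
  rw [PowerSeries.isUnit_iff_constantCoeff, isUnit_iff_ne_zero, not_not,
    ← PowerSeries.X_dvd_iff] at ha
  obtain ⟨c, rfl⟩ := ha
  rw [mul_comm, mul_smul, X_smul_red, smul_zero]

theorem bijOn_span_singleton {L : Submodule Aq M} {T : Red L →ₗ[Aq] Red L} {x y : Red L}
    (hT : T x = y) (hy : y ≠ 0) :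
    Set.BijOn T (Submodule.span Aq {x}) (Submodule.span Aq {y}) := by
  refine ⟨?_, ?_, ?_⟩
  · intro z hz
    obtain ⟨a, rfl⟩ := Submodule.mem_span_singleton.1 hz
    rw [map_smul, hT]
    exact Submodule.smul_mem _ _ (Submodule.mem_span_singleton_self _)
  · intro z hz w hw h
    obtain ⟨a, rfl⟩ := Submodule.mem_span_singleton.1 hz
    obtain ⟨c, rfl⟩ := Submodule.mem_span_singleton.1 hw
    rw [map_smul, map_smul, hT, ← sub_eq_zero, ← sub_smul] at h
    rw [← sub_eq_zero, ← sub_smul]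
    exact smul_red_eq_zero h hy
  · intro z hz
    obtain ⟨a, rfl⟩ := Submodule.mem_span_singleton.1 hz
    exact ⟨a • x, Submodule.smul_mem _ _ (Submodule.mem_span_singleton_self _), by rw [map_smul, hT]⟩

variable {B : Type*} {O : GlOps r M} {L : Submodule Aq M} {C : GlCrystal r B} {β : B → Red L}

/-- Taking the lines through the basis vectors as fibres makes the rule for fibres apply to ordinary
crystal bases. -/
theorem IsGlCrystalBasis.fiberCrystal (h : IsGlCrystalBasis O L C β) (H : O.Good)
    (hC : C.IsAbstract) :
    FiberCrystal O Set.univ L C (fun b => Submodule.span Aq {β b}) where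
  good := H
  lattice := h.lattice
  regular := ⟨hC, h.eps_eq, h.phi_eq⟩
  ne_bot b := by simpa using h.ne_zero b
  le_weight b := by
    rw [Submodule.span_le, Set.singleton_subset_iff]
    exact h.wt_mem b
  directSum := h.basis
  arrow_e i b := by
    have h1 := h.map_e i b
    cases hb : C.e i b with
    | none =>
      intro x hx
      obtain ⟨a, rfl⟩ := Submodule.mem_span_singleton.1 hx
      rw [map_smul, h1, hb, Option.elim_none, smul_zero]
    | some b' =>
      rw [hb] at h1
      exact bijOn_span_singleton h1 (h.ne_zero b')
  arrow_f i b := by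
    have h1 := h.map_f i b
    cases hb : C.f i b with
    | none =>
      intro x hx
      obtain ⟨a, rfl⟩ := Submodule.mem_span_singleton.1 hx
      rw [map_smul, h1, hb, Option.elim_none, smul_zero]
    | some b' =>
      rw [hb] at h1
      exact bijOn_span_singleton h1 (h.ne_zero b')

end

section tensor

variable {M₁ M₂ : Type*} [AddCommGroup M₁] [Module Fq M₁] [Module Aq M₁]
  [IsScalarTower Aq Fq M₁] [AddCommGroup M₂] [Module Fq M₂] [Module Aq M₂] [IsScalarTower Aq Fq M₂]
  {B₁ B₂ : Type*} {O₁ : GlOps r M₁} {O₂ : GlOps r M₂} {L₁ : Submodule Aq M₁}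
  {L₂ : Submodule Aq M₂} {C₁ : GlCrystal r B₁} {C₂ : GlCrystal r B₂}
  {β₁ : B₁ → Red L₁} {β₂ : B₂ → Red L₂}

theorem IsGlCrystalBasis.tensor (H₁ : O₁.Good) (H₂ : O₂.Good) (hC₁ : C₁.IsAbstract)
    (hC₂ : C₂.IsAbstract) (h₁ : IsGlCrystalBasis O₁ L₁ C₁ β₁)
    (h₂ : IsGlCrystalBasis O₂ L₂ C₂ β₂) :
    IsGlCrystalBasis (O₁.tensor O₂) (tensorLattice L₁ L₂) (C₁.tensor C₂)
      (fun b => redTensor L₁ L₂ (β₁ b.1) (β₂ b.2)) := by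
  classical
  have F₁ := h₁.fiberCrystal H₁ hC₁
  have F₂ := h₂.fiberCrystal H₂ hC₂
  have F := F₁.tensor F₂ (fun _ _ _ _ => Set.mem_univ _)
  have := h₁.lattice.free
  have := h₂.lattice.free
  have hm₁ := fun b => Submodule.mem_span_singleton_self (R := Aq) (β₁ b)
  have hm₂ := fun b => Submodule.mem_span_singleton_self (R := Aq) (β₂ b)
  refine ⟨F.lattice, fun b => redTensor_ne_zero h₁.lattice.base h₂.lattice.base
    (h₁.ne_zero _) (h₂.ne_zero _), ?_, fun b => redTensor_mem_redWeight (h₁.wt_mem _) (h₂.wt_mem _),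
    ?_, ?_, F.regular.eps_eq, F.regular.phi_eq⟩
  · convert F.directSum using 2 with b
    rw [tensorFiber_eq_map₂, Submodule.map₂_span_span, Set.image2_singleton]
  · intro i b
    rw [F₁.tildeE_redTensor F₂ i _ (hm₁ _) (hm₂ _), h₁.map_e, h₂.map_e]
    simp only [GlCrystal.tensor]
    by_cases hc : C₁.phi i b.1 ≥ C₂.eps i b.2
    · rw [if_pos hc, if_pos hc]
      cases C₁.e i b.1 <;> simp
    · rw [if_neg hc, if_neg hc]
      cases C₂.e i b.2 <;> simp
  · intro i b
    rw [F₁.tildeF_redTensor F₂ i _ (hm₁ _) (hm₂ _), h₁.map_f, h₂.map_f]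
    simp only [GlCrystal.tensor]
    by_cases hc : C₁.phi i b.1 > C₂.eps i b.2
    · rw [if_pos hc, if_pos hc]
      cases C₁.f i b.1 <;> simp
    · rw [if_neg hc, if_neg hc]
      cases C₂.f i b.2 <;> simp

end tensor

section unique

variable {M : Type*} [AddCommGroup M] [Module Fq M] {O : GlOps r M} (H : O.Good)
  {i : Fin r} {T : Module.End Fq M}
include H

theorem GlOps.Good.ext {T T' : Module.End Fq M}
    (h : ∀ μ u, O.IsString i μ u → T (u.sum fun k v => divPow (O.f i) k v) =
      T' (u.sum fun k v => divPow (O.f i) k v)) : T = T' := by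
  refine LinearMap.ext fun v => ?_
  have h1 : ⨆ μ, O.weightSpace μ ≤ LinearMap.eqLocus T T' := by
    refine iSup_le fun μ v hv => ?_
    obtain ⟨u, hu, rfl⟩ := (H.sl2 i).exists_str hv
    exact h μ u hu
  exact h1 (H.weight.2 ▸ Submodule.mem_top)

/-- `tildeE` is obtained by choice; uniqueness is what allows it to be identified after transport of
structure. -/
theorem GlOps.Good.tildeE_unique (hT : O.IsTildeE i T) : O.tildeE i = T :=
  H.ext fun μ u hu => by rw [H.isTildeE i μ u hu, hT μ u hu]

theorem GlOps.Good.tildeF_unique (hT : O.IsTildeF i T) : O.tildeF i = T :=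
  H.ext fun μ u hu => by rw [H.isTildeF i μ u hu, hT μ u hu]

end unique

/-! ### Transport of crystal bases along linear isomorphisms -/

section transport

variable {M N : Type*} [AddCommGroup M] [Module Fq M] [AddCommGroup N] [Module Fq N]

/-- Transport of structure along a linear isomorphism. -/
def GlOps.conj (O : GlOps r M) (φ : M ≃ₗ[Fq] N) : GlOps r N where
  K h := φ.conj (O.K h)
  e i := φ.conj (O.e i)
  f i := φ.conj (O.f i)

variable {O : GlOps r M} (φ : M ≃ₗ[Fq] N)

theorem GlOps.mem_weightSpace_conj {μ : Lat r} {u : M} :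
    φ u ∈ (O.conj φ).weightSpace μ ↔ u ∈ O.weightSpace μ := by
  simp only [GlOps.mem_weightSpace, GlOps.conj, LinearEquiv.conj_apply_apply,
    LinearEquiv.symm_apply_apply, ← map_smul, φ.injective.eq_iff]

theorem conj_divPow (T : Module.End Fq M) (k : ℕ) (u : M) :
    divPow (φ.conj T) k (φ u) = φ (divPow T k u) := by
  induction k with
  | zero => simp
  | succ k ih => rw [divPow_succ, ih, divPow_succ, map_smul, LinearEquiv.conj_apply_apply,
      LinearEquiv.symm_apply_apply]

theorem GlOps.isString_conj {i : Fin r} {μ : Lat r} {u : ℕ →₀ N}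
    (hu : (O.conj φ).IsString i μ u) :
    O.IsString i μ (u.mapRange φ.symm (map_zero _)) := by
  intro k
  obtain ⟨h1, h2, h3⟩ := hu k
  rw [Finsupp.mapRange_apply]
  refine ⟨?_, ?_, fun h => h3 fun h' => h (by rw [h', map_zero])⟩
  · rwa [← GlOps.mem_weightSpace_conj φ, LinearEquiv.apply_symm_apply]
  · simpa [GlOps.conj, LinearEquiv.conj_apply_apply] using h2

theorem GlOps.sum_conj {u : ℕ →₀ N} (g : ℕ → Module.End Fq M) (g' : ℕ → Module.End Fq N)
    (hg : ∀ k v, g' k (φ v) = φ (g k v)) :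
    (u.sum fun k v => g' k v) = φ ((u.mapRange φ.symm (map_zero _)).sum fun k v => g k v) := by
  rw [Finsupp.sum_mapRange_index (by simp), map_finsuppSum]
  refine Finset.sum_congr rfl fun k _ => ?_
  simp only [← hg, LinearEquiv.apply_symm_apply]

theorem GlOps.Good.conj (H : O.Good) : (O.conj φ).Good := by
  have hr : (O.conj φ).IsRep := by
    obtain ⟨ρ, rfl⟩ := H.isRep.exists_hom
    exact glOps_isRep ((φ.conjAlgEquiv Fq).toAlgHom.comp ρ)
  refine ⟨hr, ⟨hr.weightSpace_independent, ?_⟩, ?_⟩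
  · rw [eq_top_iff]
    rintro v -
    have h1 : ⨆ μ, O.weightSpace μ ≤ (⨆ μ, (O.conj φ).weightSpace μ).comap φ.toLinearMap :=
      iSup_le fun μ u hu => Submodule.mem_iSup_of_mem μ ((GlOps.mem_weightSpace_conj φ).2 hu)
    have h2 := h1 (x := φ.symm v) (H.weight.2 ▸ Submodule.mem_top)
    simpa using h2
  · have := H.finite
    exact Module.Finite.equiv φ

theorem GlOps.Good.tildeE_conj (H : O.Good) (i : Fin r) :
    (O.conj φ).tildeE i = φ.conj (O.tildeE i) := by
  refine (H.conj φ).tildeE_unique fun μ u hu => ?_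
  have h1 := GlOps.sum_conj φ (u := u) (fun k => divPow (O.f i) k)
    (fun k => divPow ((O.conj φ).f i) k) (fun k v => conj_divPow φ _ k v)
  have h2 := GlOps.sum_conj φ (u := u) (fun k => if k = 0 then 0 else divPow (O.f i) (k - 1))
    (fun k => if k = 0 then 0 else divPow ((O.conj φ).f i) (k - 1)) (fun k v => by
      split_ifs
      · simp
      · exact conj_divPow φ _ _ v)
  have h3 := H.isTildeE i μ _ (GlOps.isString_conj φ hu)
  rw [h1, LinearEquiv.conj_apply_apply, LinearEquiv.symm_apply_apply, h3]
  have h4 : ∀ (c : ℕ) (T : Module.End Fq M) v, (if c = 0 then (0 : Module.End Fq M) else T) v =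
      if c = 0 then 0 else T v := fun c T v => by split_ifs <;> rfl
  have h5 : ∀ (c : ℕ) (T : Module.End Fq N) v, (if c = 0 then (0 : Module.End Fq N) else T) v =
      if c = 0 then 0 else T v := fun c T v => by split_ifs <;> rfl
  simp only [h4, h5] at h2
  exact h2.symm

theorem GlOps.Good.tildeF_conj (H : O.Good) (i : Fin r) :
    (O.conj φ).tildeF i = φ.conj (O.tildeF i) := by
  refine (H.conj φ).tildeF_unique fun μ u hu => ?_
  have h1 := GlOps.sum_conj φ (u := u) (fun k => divPow (O.f i) k)
    (fun k => divPow ((O.conj φ).f i) k) (fun k v => conj_divPow φ _ k v)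
  have h2 := GlOps.sum_conj φ (u := u) (fun k => divPow (O.f i) (k + 1))
    (fun k => divPow ((O.conj φ).f i) (k + 1)) (fun k v => conj_divPow φ _ _ v)
  have h3 := H.isTildeF i μ _ (GlOps.isString_conj φ hu)
  rw [h1, LinearEquiv.conj_apply_apply, LinearEquiv.symm_apply_apply, h3, h2]

variable [Module Aq M] [IsScalarTower Aq Fq M] [Module Aq N] [IsScalarTower Aq Fq N]

/-- Transport of a lattice along a linear isomorphism. -/
abbrev mapLattice (L : Submodule Aq M) : Submodule Aq N :=
  L.map (φ.restrictScalars Aq).toLinearMap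

/-- The isomorphism of reductions induced by an isomorphism of modules. -/
def redEquiv (L : Submodule Aq M) : Red L ≃ₗ[Aq] Red (mapLattice φ L) :=
  Submodule.Quotient.equiv (qSub L) (qSub (mapLattice φ L))
    ((φ.restrictScalars Aq).submoduleMap L) (by
      ext v
      rw [Submodule.mem_map]
      constructor
      · rintro ⟨u, hu, rfl⟩
        obtain ⟨y, hy, hyu⟩ := mem_qMul.1 (mem_qSub.1 hu)
        exact mem_qSub.2 (mem_qMul.2 ⟨φ y, ⟨y, hy, rfl⟩, by
          rw [← map_smul, hyu]; rfl⟩)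
      · intro hv
        obtain ⟨_, ⟨y, hy, rfl⟩, hyv⟩ := mem_qMul.1 (mem_qSub.1 hv)
        refine ⟨(PowerSeries.X : Aq) • ⟨y, hy⟩, ⟨⟨y, hy⟩, rfl⟩, Subtype.ext ?_⟩
        rw [← hyv]
        change φ ((PowerSeries.X : Aq) • y) = q • φ y
        rw [X_smul_eq, map_smul])

variable {L : Submodule Aq M}

theorem redEquiv_mkQ (u : L) :
    redEquiv φ L ((qSub L).mkQ u) = (qSub (mapLattice φ L)).mkQ ⟨φ u, u, u.2, rfl⟩ := rfl

theorem stable_conj {T : Module.End Fq M} (hT : Stable L T) :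
    Stable (mapLattice φ L) (φ.conj T) := by
  rintro _ ⟨u, hu, rfl⟩
  refine ⟨T u, hT u hu, ?_⟩
  change φ (T u) = φ.conj T (φ u)
  rw [LinearEquiv.conj_apply_apply, LinearEquiv.symm_apply_apply]

theorem redMap_redEquiv {T : Module.End Fq M} (hT : Stable L T) {T' : Module.End Fq N}
    (hT' : Stable (mapLattice φ L) T') (h : T' = φ.conj T) (x : Red L) :
    redMap hT' (redEquiv φ L x) = redEquiv φ L (redMap hT x) := by
  subst h
  obtain ⟨u, rfl⟩ := (qSub L).mkQ_surjective x
  rw [redEquiv_mkQ, redMap_mkQ, redMap_mkQ, redEquiv_mkQ]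
  congr 1
  refine Subtype.ext ?_
  change φ.conj T (φ u) = φ (T u)
  rw [LinearEquiv.conj_apply_apply, LinearEquiv.symm_apply_apply]

theorem IsCrystalLattice.conj {S : Set (Lat r)} (H : O.Good) (h : IsCrystalLattice O S L) :
    IsCrystalLattice (O.conj φ) S (mapLattice φ L) where
  free := have := h.free; Module.Free.of_equiv ((φ.restrictScalars Aq).submoduleMap L)
  base := by
    have := h.free
    let b := Module.Free.chooseBasis Aq L
    refine isBaseChange_of_basis (b.map ((φ.restrictScalars Aq).submoduleMap L))
      ((h.base.basis b).map φ) fun i => ?_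
    rw [Module.Basis.map_apply, Module.Basis.map_apply, IsBaseChange.basis_apply]
    rfl
  weight := by
    refine isDirectSum_latticeWeight (H.conj φ).weight ?_
    refine Submodule.map_le_iff_le_comap.2 (h.le_span.trans (Submodule.span_le.2 ?_))
    rintro u ⟨hu, μ, hμ, huμ⟩
    exact Submodule.subset_span ⟨⟨u, hu, rfl⟩, μ, hμ, (GlOps.mem_weightSpace_conj φ).2 huμ⟩
  e_stable i := by rw [H.tildeE_conj]; exact stable_conj φ (h.e_stable i)
  f_stable i := by rw [H.tildeF_conj]; exact stable_conj φ (h.f_stable i)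

theorem IsGlCrystalBasis.conj {B : Type*} {C : GlCrystal r B} {β : B → Red L} (H : O.Good)
    (h : IsGlCrystalBasis O L C β) :
    IsGlCrystalBasis (O.conj φ) (mapLattice φ L) C (fun b => redEquiv φ L (β b)) where
  lattice := h.lattice.conj φ H
  ne_zero b := by simpa using h.ne_zero b
  basis := by
    have hs : ∀ b, Submodule.span Aq {redEquiv φ L (β b)} =
        (Submodule.span Aq {β b}).map (redEquiv φ L).toLinearMap := fun b => by
      rw [Submodule.map_span, Set.image_singleton]; rfl
    choose p h1 h2 h3 using h.basis.exists_proj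
    constructor
    · refine iSupIndep_of_maps (fun b => p b ∘ₗ (redEquiv φ L).symm.toLinearMap) ?_ ?_
      · intro b x hx h0
        rw [hs] at hx
        obtain ⟨y, hy, rfl⟩ := hx
        have h4 : p b y = 0 := by simpa using h0
        rw [h1 b y hy] at h4
        rw [h4, map_zero]
      · intro b b' hb x hx
        rw [hs] at hx
        obtain ⟨y, hy, rfl⟩ := hx
        simpa using h2 b b' hb y hy
    · simp only [hs]
      rw [← Submodule.map_iSup, h.basis.2, Submodule.map_top, LinearEquiv.range]
  wt_mem b := by
    obtain ⟨u, hu, hub⟩ := h.wt_mem b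
    refine ⟨⟨φ u, u, u.2, rfl⟩, (GlOps.mem_weightSpace_conj φ).2 hu, ?_⟩
    rw [← hub, redEquiv_mkQ]
  map_e i b := by
    rw [redMap_redEquiv φ (h.lattice.e_stable i) _ (H.tildeE_conj φ i), h.map_e]
    cases C.e i b <;> simp
  map_f i b := by
    rw [redMap_redEquiv φ (h.lattice.f_stable i) _ (H.tildeF_conj φ i), h.map_f]
    cases C.f i b <;> simp
  eps_eq := h.eps_eq
  phi_eq := h.phi_eq

end transport

/-- `IsGlCrystal` asks for a realisation on some `𝐅^d`, so the structure is transported along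
coordinates. -/
theorem IsGlCrystalBasis.isGlCrystal {M B : Type*} [AddCommGroup M] [Module Fq M] [Module Aq M]
    [IsScalarTower Aq Fq M] {O : GlOps r M} {L : Submodule Aq M} {C : GlCrystal r B}
    {β : B → Red L} (H : O.Good) (hC : C.IsAbstract) (h : IsGlCrystalBasis O L C β) :
    C.IsGlCrystal := by
  have := H.finite
  let φ : M ≃ₗ[Fq] (Fin (Module.finrank Fq M) → Fq) := (Module.finBasis Fq M).equivFun
  obtain ⟨ρ, hρ⟩ := (H.conj φ).isRep.exists_hom
  have hb := h.conj φ H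
  have hW := (H.conj φ).weight
  rw [← hρ] at hb hW
  exact ⟨hC, _, ρ, _, _, hW, hb⟩

theorem GlCrystal.IsGlCrystal.tensor {B₁ B₂ : Type*} {C₁ : GlCrystal r B₁} {C₂ : GlCrystal r B₂}
    (h₁ : C₁.IsGlCrystal) (h₂ : C₂.IsGlCrystal) : (C₁.tensor C₂).IsGlCrystal := by
  have hr := h₁.regular.tensor h₂.regular
  obtain ⟨hC₁, d₁, ρ₁, L₁, β₁, hW₁, hb₁⟩ := h₁
  obtain ⟨hC₂, d₂, ρ₂, L₂, β₂, hW₂, hb₂⟩ := h₂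
  have H₁ : (glOps ρ₁).Good := ⟨glOps_isRep ρ₁, hW₁, inferInstance⟩
  have H₂ : (glOps ρ₂).Good := ⟨glOps_isRep ρ₂, hW₂, inferInstance⟩
  exact (hb₁.tensor H₁ H₂ hC₁ hC₂ hb₂).isGlCrystal (H₁.tensor H₂) hr.isAbstract

end

section

variable {r : ℕ} [NeZero r]

/-! ### The odd operators -/

theorem pair_hh_zero (μ : Lat r) : pair (hh (0 : Fin r)) μ = μ 0 - μ (0 : Fin r).succ := pair_hh 0 μ

theorem alpha_zero_zero : alpha (0 : Fin r) 0 = 1 := alpha_castSucc 0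

section

variable {M : Type*} [AddCommGroup M] [Module Fq M]

/-- The properties of the action of the generators `q^h`, `e_i`, `f_i`, `k_{1̄}` on a module in
`𝒪_int^{≥0}` that enter the study of the odd Kashiwara operators. -/
structure QOps.Queer (O : QOps r M) : Prop where
  good : O.toGlOps.Good
  nonneg : ∀ μ, O.weightSpace μ ≠ ⊥ → 0 ≤ μ
  K_k1 : ∀ h, O.K h * O.k1 = O.k1 * O.K h
  k1_sq : O.k1 ^ 2 = (q ^ 2 - (q ^ 2)⁻¹)⁻¹ • (O.K ((2 : ℤ) • kk 0) - O.K (-((2 : ℤ) • kk 0)))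
  k1_eq_zero : ∀ μ : Lat r, μ 0 = 0 → ∀ u ∈ O.weightSpace μ, O.k1 u = 0
  σ_sq : O.σ * O.σ = 1
  σ_K : ∀ h, O.σ * O.K h = O.K h * O.σ
  σ_e : ∀ i, O.σ * O.e i = O.e i * O.σ
  σ_f : ∀ i, O.σ * O.f i = O.f i * O.σ
  σ_k1 : O.σ * O.k1 = -(O.k1 * O.σ)

theorem SuperRep.InOint.queer {R : SuperRep r M} (h : R.InOint) : R.ops.Queer where
  good := ⟨R.ops_isRep, h.weight, h.finite⟩
  nonneg := h.nonneg
  K_k1 g := by simpa [SuperRep.ops, QGen.Q, QGen.Kb] using R.rel (QRel.q_kbar g 0)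
  k1_sq := by simpa [SuperRep.ops, QGen.Q, QGen.Kb] using R.rel (QRel.kbar_sq 0)
  k1_eq_zero μ hμ u hu := by
    by_cases h0 : R.ops.weightSpace μ = ⊥
    · rw [h0, Submodule.mem_bot] at hu
      rw [hu, map_zero]
    · exact h.kbar μ (h.nonneg μ h0) 0 (by rw [pair_kk, hμ]) u hu
  σ_sq := R.σ_sq
  σ_K := R.σ_q
  σ_e := R.σ_e
  σ_f := R.σ_f
  σ_k1 := R.σ_kbar 0

variable {O : QOps r M}

theorem QOps.tildeK1_apply (u : M) : O.tildeK1 u = q⁻¹ • O.K (kk 0) (O.k1 u) := rfl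

section

variable (HK : ∀ h, O.K h * O.k1 = O.k1 * O.K h) {μ : Lat r} {u : M} (hu : u ∈ O.weightSpace μ)
include HK hu

theorem QOps.k1_mem_of_comm : O.k1 u ∈ O.weightSpace μ := by
  rw [GlOps.mem_weightSpace] at hu ⊢
  intro h
  rw [← Module.End.mul_apply, HK, Module.End.mul_apply, hu, map_smul]

theorem QOps.k1_eq : O.k1 u = q ^ (1 - μ 0) • O.tildeK1 u := by
  rw [QOps.tildeK1_apply, GlOps.mem_weightSpace.1 (QOps.k1_mem_of_comm HK hu), pair_kk, smul_smul,
    smul_smul, ← zpow_neg_one, ← zpow_add₀ q_ne_zero, ← zpow_add₀ q_ne_zero,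
    show 1 - μ 0 + -1 + μ 0 = 0 by ring, qpow_zero, Fq_one_smul]

theorem QOps.tildeK1_mem : O.tildeK1 u ∈ O.weightSpace μ := by
  rw [QOps.tildeK1_apply, GlOps.mem_weightSpace.1 (QOps.k1_mem_of_comm HK hu)]
  exact Submodule.smul_mem _ _ (Submodule.smul_mem _ _ (QOps.k1_mem_of_comm HK hu))

/-- On `M_μ` one has `k_{1̄} = q^{1-μ₁} k̃_{1̄}`, and `e_1` raises `μ₁` by one; the powers of `q` in
the definition cancel and leave a plain commutator. -/
theorem QOps.tildeE1_apply (HR : O.IsRep) :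
    O.tildeE1 u = O.tildeK1 (O.e 0 u) - O.e 0 (O.tildeK1 u) := by
  have h1 : O.tildeE1 u = -(q ^ (μ 0 - 1) • (O.e 0 (O.k1 u) - q • O.k1 (O.e 0 u))) := by
    simp only [QOps.tildeE1, LinearMap.neg_apply, Module.End.mul_apply, LinearMap.smul_apply,
      GlOps.mem_weightSpace.1 hu, map_smul, LinearMap.sub_apply, pair_kk]
    rw [smul_smul, zpow_sub_one₀ q_ne_zero, mul_comm]
  rw [h1, QOps.k1_eq HK hu, QOps.k1_eq HK (HR.e_mem 0 hu), Pi.add_apply, alpha_zero_zero, map_smul,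
    smul_smul, smul_sub, smul_smul, smul_smul, ← zpow_add₀ q_ne_zero]
  have e1 : q * q ^ (1 - (μ 0 + 1)) = q ^ (1 - μ 0) := by
    rw [← zpow_one_add₀ q_ne_zero]; congr 1; ring
  rw [e1, ← zpow_add₀ q_ne_zero, show μ 0 - 1 + (1 - μ 0) = 0 by ring, qpow_zero, Fq_one_smul,
    Fq_one_smul, neg_sub]

/-- The same substitution with `f_1`, which lowers `μ₁`: again a commutator, but a power of `q`
remains. -/
theorem QOps.tildeF1_apply (HR : O.IsRep) :
    O.tildeF1 u = q ^ (1 - pair (hh (0 : Fin r)) μ) •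
      (O.f 0 (O.tildeK1 u) - O.tildeK1 (O.f 0 u)) := by
  have h1 : O.tildeF1 u =
      -(q ^ (μ (0 : Fin r).succ - 1) • (O.k1 (O.f 0 u) - q • O.f 0 (O.k1 u))) := by
    simp only [QOps.tildeF1, LinearMap.neg_apply, Module.End.mul_apply, LinearMap.smul_apply,
      GlOps.mem_weightSpace.1 hu, map_smul, LinearMap.sub_apply, pair_kk]
    rw [smul_smul, zpow_sub_one₀ q_ne_zero, mul_comm]
  have e1 : q * q ^ (1 - μ 0) = q ^ (2 - μ 0) := by
    rw [← zpow_one_add₀ q_ne_zero]; congr 1; ring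
  rw [h1, QOps.k1_eq HK hu, QOps.k1_eq HK (HR.f_mem 0 hu), Pi.sub_apply, alpha_zero_zero, map_smul,
    smul_smul, e1, show 1 - (μ 0 - 1) = 2 - μ 0 by ring, ← smul_sub, smul_smul,
    ← zpow_add₀ q_ne_zero, ← smul_neg, neg_sub, pair_hh_zero]
  congr 2
  ring

end

namespace QOps.Queer

variable (H : O.Queer) {μ : Lat r} {u : M} (hu : u ∈ O.weightSpace μ)
include H

theorem tildeK1_eq_zero (hu : u ∈ O.weightSpace μ) (hμ : μ 0 = 0) : O.tildeK1 u = 0 := by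
  rw [QOps.tildeK1_apply, H.k1_eq_zero μ hμ u hu, map_zero, smul_zero]

theorem σ_tildeK1 : O.σ * O.tildeK1 = -(O.tildeK1 * O.σ) := by
  rw [QOps.tildeK1, mul_smul_comm, ← mul_assoc, H.σ_K, mul_assoc, H.σ_k1, smul_mul_assoc,
    mul_assoc, mul_neg]
  exact LinearMap.ext fun v => smul_neg q⁻¹ (O.K (kk 0) (O.k1 (O.σ v)))

theorem σ_tildeK1_apply (u : M) : O.σ (O.tildeK1 u) = -O.tildeK1 (O.σ u) :=
  congrArg (fun T : Module.End Fq M => T u) H.σ_tildeK1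

theorem σ_σ (u : M) : O.σ (O.σ u) = u :=
  congrArg (fun T : Module.End Fq M => T u) H.σ_sq

theorem σ_mem (hu : u ∈ O.weightSpace μ) : O.σ u ∈ O.weightSpace μ := by
  rw [GlOps.mem_weightSpace] at hu ⊢
  intro h
  rw [← Module.End.mul_apply, ← H.σ_K, Module.End.mul_apply, hu, map_smul]

theorem nonneg_of_ne_zero (hu : u ∈ O.weightSpace μ) (h0 : u ≠ 0) : 0 ≤ μ :=
  H.nonneg μ fun h => h0 (by rwa [h, Submodule.mem_bot] at hu)

/-- A rescaling of the relation for `k_{1̄}²`. Modulo `q` the scalar is `1` for `μ₁ > 0` and `0` for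
`μ₁ = 0`. -/
theorem tildeK1_tildeK1 (hu : u ∈ O.weightSpace μ) :
    O.tildeK1 (O.tildeK1 u) = ((q ^ (4 * μ 0) - 1) / (q ^ (4 : ℤ) - 1)) • u := by
  have h1 := congrArg (fun T : Module.End Fq M => T u) H.k1_sq
  simp only [pow_two, Module.End.mul_apply, LinearMap.smul_apply, LinearMap.sub_apply,
    GlOps.mem_weightSpace.1 hu, pair_neg_left] at h1
  have e1 : pair ((2 : ℤ) • kk 0) μ = 2 * μ 0 := by
    rw [pair_comm, pair_zsmul_right, pair_comm, pair_kk]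
  rw [e1, ← sub_smul, smul_smul] at h1
  have hk := QOps.k1_mem_of_comm H.K_k1 hu
  have h2 : O.tildeK1 (O.tildeK1 u) = (q⁻¹ * q ^ μ 0) • (q⁻¹ * q ^ μ 0) • O.k1 (O.k1 u) := by
    rw [QOps.tildeK1_apply u, GlOps.mem_weightSpace.1 hk, pair_kk, QOps.tildeK1_apply, map_smul,
      map_smul, map_smul, map_smul, GlOps.mem_weightSpace.1 (QOps.k1_mem_of_comm H.K_k1 hk),
      pair_kk]
    simp only [smul_smul]
    congr 1
    ring
  rw [h2, h1, smul_smul, smul_smul]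
  congr 1
  have h0 := q_ne_zero
  have h4 : q ^ (4 : ℤ) - 1 ≠ 0 := by
    intro h
    have := qpow_injective (a := 4) (b := 0) (by rw [qpow_zero]; exact sub_eq_zero.1 h)
    omega
  have h5 : q ^ 2 - (q ^ 2)⁻¹ = (q ^ 2)⁻¹ * (q ^ (4 : ℤ) - 1) := by
    have : q ^ (4 : ℤ) = q ^ 4 := zpow_ofNat q 4
    rw [this]
    field_simp
  have h6 : q ^ (2 * μ 0) = q ^ μ 0 * q ^ μ 0 := by rw [two_mul, zpow_add₀ h0]
  have h7 : q ^ (4 * μ 0) = q ^ μ 0 * q ^ μ 0 * (q ^ μ 0 * q ^ μ 0) := by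
    rw [← zpow_add₀ h0, ← zpow_add₀ h0]; congr 1; ring
  have h8 : q ^ μ 0 ≠ 0 := zpow_ne_zero _ h0
  rw [← pow_two q, h5, zpow_neg, h6, h7]
  generalize q ^ μ 0 = t at *
  generalize q ^ (4 : ℤ) - 1 = d at *
  field_simp

end QOps.Queer

end

section

variable {M₁ M₂ : Type*} [AddCommGroup M₁] [Module Fq M₁] [AddCommGroup M₂] [Module Fq M₂]
  {O₁ : GlOps r M₁} {O₂ : GlOps r M₂} {lam μ : Lat r} {x : M₁} {y : M₂}

omit [NeZero r] in
theorem GlOps.tensor_e_tmul (i : Fin r)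
    (hy : y ∈ O₂.weightSpace μ) (x : M₁) :
    (O₁.tensor O₂).e i (x ⊗ₜ y) =
      q ^ (-pair (hh i) μ) • (O₁.e i x ⊗ₜ[Fq] y) + x ⊗ₜ[Fq] O₂.e i y := by
  simp only [GlOps.tensor, LinearMap.add_apply, TensorProduct.map_tmul,
    GlOps.mem_weightSpace.1 hy, pair_neg_left, TensorProduct.tmul_smul, Module.End.one_apply]

omit [NeZero r] in
theorem GlOps.tensor_f_tmul (i : Fin r)
    (hx : x ∈ O₁.weightSpace lam) (y : M₂) :
    (O₁.tensor O₂).f i (x ⊗ₜ y) =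
      O₁.f i x ⊗ₜ[Fq] y + q ^ (pair (hh i) lam) • (x ⊗ₜ[Fq] O₂.f i y) := by
  simp only [GlOps.tensor, LinearMap.add_apply, TensorProduct.map_tmul,
    GlOps.mem_weightSpace.1 hx, Module.End.one_apply, TensorProduct.smul_tmul']

end

theorem tensor_tildeE1_aux {k V : Type*} [Field k] [AddCommGroup V] [Module k V] (s t p : k)
    (A A' B C D D' : V) : s • (t • A + B) + ((t * p ^ 2) • C + D) -
      (t • (s • A' + C) + (s • B + D')) =
      (s * t) • (A - A') + ((p ^ 2 - 1) * t) • C + (D - D') := by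
  module

theorem tensor_tildeF1_aux {k V : Type*} [Field k] [AddCommGroup V] [Module k V]
    (a s t t' u u' c c' : k) (A A' B C D D' : V) (h1 : a * t = u * c)
    (h2 : a * s * t - a * (s * t') = u') (h3 : a * s = c') :
    a • (t • A + B + s • (t • C + D) - ((t • A' + B) + s • (t' • C + D'))) =
      u • c • (A - A') + u' • C + c' • (D - D') := by
  rw [smul_smul, ← h1, ← h2, ← h3]
  module

section tensor

variable {M₁ M₂ : Type*} [AddCommGroup M₁] [Module Fq M₁] [AddCommGroup M₂] [Module Fq M₂]
  {O₁ : QOps r M₁} {O₂ : QOps r M₂} (H₁ : O₁.Queer) (H₂ : O₂.Queer)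
  {lam μ : Lat r} {x : M₁} {y : M₂} (hx : x ∈ O₁.weightSpace lam) (hy : y ∈ O₂.weightSpace μ)

theorem QOps.toGlOps_tensor : (O₁.tensor O₂).toGlOps = O₁.toGlOps.tensor O₂.toGlOps := rfl

include H₁ H₂

theorem QOps.tensor_K_k1 (h : Lat r) :
    (O₁.tensor O₂).K h * (O₁.tensor O₂).k1 = (O₁.tensor O₂).k1 * (O₁.tensor O₂).K h := by
  have h1 : O₁.K h * (O₁.K (-kk 0) * O₁.σ) = O₁.K (-kk 0) * O₁.σ * O₁.K h := by
    rw [← mul_assoc, H₁.good.isRep.K_comm, mul_assoc, mul_assoc, H₁.σ_K]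
  simp only [QOps.tensor, mul_add, add_mul, map_mul_map, H₁.K_k1, H₂.K_k1,
    H₂.good.isRep.K_comm h, h1]

include hy

omit H₂ in
-- In the second summand the factor `q^{-k_1}` of the coproduct cancels against `q^{k_1}` in
-- `k̃_{1̄}`, leaving only the parity operator.
theorem QOps.tensor_tildeK1 (x : M₁) : (O₁.tensor O₂).tildeK1 (x ⊗ₜ y) =
    q ^ (2 * μ 0) • (O₁.tildeK1 x ⊗ₜ[Fq] y) + O₁.σ x ⊗ₜ[Fq] O₂.tildeK1 y := by
  have h1 : O₁.K (kk 0) (O₁.K (-kk 0) (O₁.σ x)) = O₁.σ x := by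
    rw [← Module.End.mul_apply, H₁.good.isRep.K_mul_neg]; rfl
  have h2 := GlOps.mem_weightSpace.1 hy (kk 0)
  rw [pair_kk] at h2
  simp only [QOps.tildeK1_apply, QOps.tensor, LinearMap.add_apply, TensorProduct.map_tmul, map_add,
    Module.End.mul_apply, h1, h2, map_smul, TensorProduct.tmul_smul, smul_add,
    TensorProduct.smul_tmul']
  rw [smul_smul, smul_smul, smul_smul, two_mul, zpow_add₀ q_ne_zero]
  congr 3
  ring

include hx

/-- Expand the commutator of `k̃_{1̄}` and `e_1`. The terms `σ e_1 x ⊗ k̃_{1̄} y` cancel because `σ`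
commutes with `e_1`. The terms `k̃_{1̄} x ⊗ e_1 y` do not, because `e_1 y` has first coordinate `μ₁
+ 1`, which changes the factor `q^{2μ₁}` by `q²`. -/
theorem QOps.tensor_tildeE1 : (O₁.tensor O₂).tildeE1 (x ⊗ₜ y) =
    q ^ (μ 0 + μ (0 : Fin r).succ) • (O₁.tildeE1 x ⊗ₜ[Fq] y) +
      ((q ^ 2 - 1) * q ^ (2 * μ 0)) • (O₁.tildeK1 x ⊗ₜ[Fq] O₂.e 0 y) +
      O₁.σ x ⊗ₜ[Fq] O₂.tildeE1 y := by
  have HR₁ := H₁.good.isRep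
  have HR₂ := H₂.good.isRep
  have hσ : O₁.e 0 (O₁.σ x) = O₁.σ (O₁.e 0 x) :=
    (congrArg (fun T : Module.End Fq M₁ => T x) (H₁.σ_e 0)).symm
  have hexy := GlOps.tensor_e_tmul (O₁ := O₁.toGlOps) (O₂ := O₂.toGlOps) 0 hy
  have hKy := QOps.tildeK1_mem H₂.K_k1 hy
  have h4 : q ^ (2 * (μ + alpha (0 : Fin r)) 0) = q ^ (2 * μ 0) * q ^ 2 := by
    rw [Pi.add_apply, alpha_zero_zero, mul_add, zpow_add₀ q_ne_zero]; rfl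
  have h5 : q ^ (μ 0 + μ (0 : Fin r).succ) = q ^ (-pair (hh (0 : Fin r)) μ) * q ^ (2 * μ 0) := by
    rw [← zpow_add₀ q_ne_zero, pair_hh_zero]; congr 1; ring
  rw [QOps.tildeE1_apply (QOps.tensor_K_k1 H₁ H₂) (tmul_mem_weightSpace hx hy)
    (HR₁.tensor HR₂), QOps.toGlOps_tensor, hexy, map_add, map_smul,
    QOps.tensor_tildeK1 H₁ hy, QOps.tensor_tildeK1 H₁ (HR₂.e_mem 0 hy), QOps.tensor_tildeK1 H₁ hy,
    map_add, map_smul, hexy, GlOps.tensor_e_tmul (O₁ := O₁.toGlOps) 0 hKy, hσ, h4, h5,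
    QOps.tildeE1_apply H₁.K_k1 hx HR₁, QOps.tildeE1_apply H₂.K_k1 hy HR₂,
    TensorProduct.sub_tmul, TensorProduct.tmul_sub]
  exact tensor_tildeE1_aux (k := Fq) (V := M₁ ⊗[Fq] M₂) _ _ _ _ _ _ _ _ _

theorem QOps.tensor_tildeF1 : (O₁.tensor O₂).tildeF1 (x ⊗ₜ y) =
    q ^ (μ 0 + μ (0 : Fin r).succ) • (O₁.tildeF1 x ⊗ₜ[Fq] y) +
      (q ^ (μ 0 + μ (0 : Fin r).succ) * (q - q⁻¹)) • (O₁.tildeK1 x ⊗ₜ[Fq] O₂.f 0 y) +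
      O₁.σ x ⊗ₜ[Fq] O₂.tildeF1 y := by
  have HR₁ := H₁.good.isRep
  have HR₂ := H₂.good.isRep
  have hσ : O₁.f 0 (O₁.σ x) = O₁.σ (O₁.f 0 x) :=
    (congrArg (fun T : Module.End Fq M₁ => T x) (H₁.σ_f 0)).symm
  have hfxy := GlOps.tensor_f_tmul (O₁ := O₁.toGlOps) (O₂ := O₂.toGlOps) 0 hx
  have hKx := QOps.tildeK1_mem H₁.K_k1 hx
  have hσx := H₁.σ_mem hx
  have h0 := q_ne_zero
  rw [QOps.tildeF1_apply (QOps.tensor_K_k1 H₁ H₂) (tmul_mem_weightSpace hx hy)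
    (HR₁.tensor HR₂), QOps.toGlOps_tensor, hfxy, map_add, map_smul,
    QOps.tensor_tildeK1 H₁ hy, QOps.tensor_tildeK1 H₁ (HR₂.f_mem 0 hy), QOps.tensor_tildeK1 H₁ hy,
    map_add, map_smul, GlOps.tensor_f_tmul (O₁ := O₁.toGlOps) (O₂ := O₂.toGlOps) 0 hKx,
    GlOps.tensor_f_tmul (O₁ := O₁.toGlOps) (O₂ := O₂.toGlOps) 0 hσx, hσ,
    QOps.tildeF1_apply H₁.K_k1 hx HR₁, QOps.tildeF1_apply H₂.K_k1 hy HR₂,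
    TensorProduct.tmul_smul, ← TensorProduct.smul_tmul', TensorProduct.sub_tmul,
    TensorProduct.tmul_sub]
  have e1 : q ^ (2 * (μ - alpha (0 : Fin r)) 0) = q ^ (2 * μ 0 - 2) := by
    rw [Pi.sub_apply, alpha_zero_zero, mul_sub]; rfl
  rw [e1, pair_add_right, pair_hh_zero, pair_hh_zero]
  trans q ^ (1 - (lam 0 - lam (0 : Fin r).succ + (μ 0 - μ (0 : Fin r).succ))) •
    (q ^ (2 * μ 0) • (O₁.f 0 (O₁.tildeK1 x) ⊗ₜ[Fq] y) + O₁.σ (O₁.f 0 x) ⊗ₜ[Fq] O₂.tildeK1 y +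
      q ^ (lam 0 - lam (0 : Fin r).succ) • (q ^ (2 * μ 0) • (O₁.tildeK1 x ⊗ₜ[Fq] O₂.f 0 y) +
        O₁.σ x ⊗ₜ[Fq] O₂.f 0 (O₂.tildeK1 y)) -
      (q ^ (2 * μ 0) • (O₁.tildeK1 (O₁.f 0 x) ⊗ₜ[Fq] y) + O₁.σ (O₁.f 0 x) ⊗ₜ[Fq] O₂.tildeK1 y +
      q ^ (lam 0 - lam (0 : Fin r).succ) • (q ^ (2 * μ 0 - 2) • (O₁.tildeK1 x ⊗ₜ[Fq] O₂.f 0 y) +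
        O₁.σ x ⊗ₜ[Fq] O₂.tildeK1 (O₂.f 0 y))))
  · congr 2
    simp only [smul_add]
    rw [smul_comm (q ^ (2 * μ 0)) (q ^ (lam 0 - lam (0 : Fin r).succ))]
    abel
  · refine tensor_tildeF1_aux (k := Fq) (V := M₁ ⊗[Fq] M₂) _ _ _ _ _ _ _ _ _ _ _ _ _ _ ?_ ?_ ?_
    · rw [← zpow_add₀ h0, ← zpow_add₀ h0]; congr 1; ring
    · rw [mul_sub, ← zpow_neg_one, ← zpow_add_one₀ h0, ← zpow_add₀ h0, ← zpow_add₀ h0,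
        ← zpow_add₀ h0, ← zpow_add₀ h0, ← zpow_add₀ h0]
      congr 2 <;> ring
    · rw [← zpow_add₀ h0]; congr 1; ring

end tensor

end

section

variable {r : ℕ} [NeZero r]

/-! ### The odd operators modulo `q` -/

section

variable {M : Type*} [AddCommGroup M] [Module Fq M] [Module Aq M] [IsScalarTower Aq Fq M]
  {O : QOps r M} {L : Submodule Aq M} (H : O.Queer) (HL : TildeStable O.toGlOps L)
  {μ : Lat r} {y : M} (hy : y ∈ O.weightSpace μ) (hyL : y ∈ L)
include H HL hy hyL

/-- The string components of `y` lie in `L`, so `D` need only be tested on the vectors `f_1^{(k)}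
z`. The bound `k ≤ μ₂` holds because the weight `μ + k α_1` of a nonzero `z` has nonnegative second
coordinate `μ₂ - k`. -/
theorem QOps.Queer.mem_of_strings {D : Module.End Fq M} {X : Submodule Aq M}
    (h : ∀ (k : ℕ) (z : M), z ∈ L → z ∈ O.weightSpace (μ + (k : ℤ) • alpha (0 : Fin r)) →
      O.e 0 z = 0 → (k : ℤ) ≤ μ 0 - μ (0 : Fin r).succ + 2 * k → (k : ℤ) ≤ μ (0 : Fin r).succ →
      D (divPow (O.f 0) k z) ∈ X) : D y ∈ X := by
  obtain ⟨u, hu, rfl⟩ := (H.good.sl2 0).exists_str hy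
  rw [Finsupp.sum, map_sum]
  refine Submodule.sum_mem _ fun k hk => ?_
  obtain ⟨h1, h2, h3⟩ := hu k
  have hk0 : u k ≠ 0 := Finsupp.mem_support_iff.1 hk
  refine h k _ (HL.string_mem H.good hu hyL k) h1 h2 ?_ ?_
  · have := h3 hk0
    rw [pairHom_apply, pair_add_right, pair_zsmul_right, pair_hh_alpha, pair_hh_zero] at this
    omega
  · have : (0 : ℤ) ≤ (μ + (k : ℤ) • alpha (0 : Fin r)) (0 : Fin r).succ :=
      H.nonneg_of_ne_zero h1 hk0 (0 : Fin r).succ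
    rw [Pi.add_apply, Pi.smul_apply, alpha_succ, smul_eq_mul] at this
    omega

/-- For `μ₁ = 0` the two bounds force `k = μ₂ = ⟨h_1, μ + k α_1⟩`: the vector is the end of its
string, where `e_1 f_1^{(k)} z = [1] f_1^{(k-1)} z` for `k ≥ 1`. -/
theorem QOps.Queer.e_eq_tildeE (hμ : μ 0 = 0) : O.e 0 y = O.tildeE 0 y := by
  rw [← sub_eq_zero, ← LinearMap.sub_apply, ← Submodule.mem_bot Aq]
  refine H.mem_of_strings HL hy hyL fun k z hzL hz hez h1 h2 => ?_
  rw [Submodule.mem_bot, LinearMap.sub_apply]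
  have hp : pair (hh (0 : Fin r)) (μ + (k : ℤ) • alpha (0 : Fin r)) = k := by
    rw [pair_add_right, pair_zsmul_right, pair_hh_alpha, pair_hh_zero]
    omega
  cases k with
  | zero => simp [hez, H.good.tildeE_eq_zero hz hez]
  | succ k =>
    rw [(H.good.sl2 0).e_divPow hz hez, H.good.tildeE_divPow_succ hz hez (by
      rw [pairHom_apply, hp]; push_cast; omega), pairHom_apply, hp]
    push_cast
    rw [add_sub_cancel_left, qz_one, Fq_one_smul, sub_self]

/-- On `f_1^{(k+1)} z` the coefficient is `q^{2μ₁} [μ₁ - μ₂ + k + 2]`, of valuation at least `μ₁ +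
μ₂ - k - 1 ≥ μ₁`. -/
theorem QOps.Queer.qpow_e_mem_qMul (hμ : 0 < μ 0) : q ^ (2 * μ 0) • O.e 0 y ∈ qMul L := by
  rw [← LinearMap.smul_apply]
  refine H.mem_of_strings HL hy hyL fun k z hzL hz hez h1 h2 => ?_
  rw [LinearMap.smul_apply]
  have hp : pair (hh (0 : Fin r)) (μ + (k : ℤ) • alpha (0 : Fin r)) =
      μ 0 - μ (0 : Fin r).succ + 2 * k := by
    rw [pair_add_right, pair_zsmul_right, pair_hh_alpha, pair_hh_zero]
    ring
  cases k with
  | zero => simp [hez]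
  | succ k =>
    rw [(H.good.sl2 0).e_divPow hz hez, pairHom_apply, hp, smul_smul]
    push_cast at h1 h2 ⊢
    refine ValGe.smul_mem_qMul ?_ (HL.divPow_mem H.good hz hez hzL k)
    exact ((valGe_qpow _).mul (valGe_qz (by omega))).mono (by omega)

/-- As `(q - q⁻¹)[k+1] = q^{k+1} - q^{-k-1}`, the critical power is `q^{μ₁+μ₂-k-1}`. Its exponent is
nonnegative since `k ≤ μ₂`, and zero only for `μ₁ = 1`, `k = μ₂`; there it produces `-f̃_1 y` modulo
`q`, which the correction term cancels. -/
theorem QOps.Queer.qpow_f_mem_qMul (hμ : 0 < μ 0) :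
    (q ^ (μ 0 + μ (0 : Fin r).succ) * (q - q⁻¹)) • O.f 0 y +
      (if μ 0 = 1 then O.tildeF 0 y else 0) ∈ qMul L := by
  set D : Module.End Fq M := (q ^ (μ 0 + μ (0 : Fin r).succ) * (q - q⁻¹)) • O.f 0 +
      (if μ 0 = 1 then O.tildeF 0 else 0)
  have hD : ∀ y, D y = (q ^ (μ 0 + μ (0 : Fin r).succ) * (q - q⁻¹)) • O.f 0 y +
      (if μ 0 = 1 then O.tildeF 0 y else 0) := fun y => by
    simp only [D, LinearMap.add_apply, LinearMap.smul_apply]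
    split_ifs <;> rfl
  rw [← hD]
  refine H.mem_of_strings HL hy hyL fun k z hzL hz hez h1 h2 => ?_
  rw [hD, H.good.tildeF_divPow hz hez, ← divPow_succ_smul, smul_smul]
  have hm := HL.divPow_mem H.good hz hez hzL (k + 1)
  have hc : q ^ (μ 0 + μ (0 : Fin r).succ) * (q - q⁻¹) * qz (k + 1) =
      q ^ (μ 0 + μ (0 : Fin r).succ + (k + 1)) - q ^ (μ 0 + μ (0 : Fin r).succ - (k + 1)) := by
    rw [qz, mul_assoc, mul_div_cancel₀ _ q_sub_inv_ne_zero, mul_sub, ← zpow_add₀ q_ne_zero,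
      ← zpow_add₀ q_ne_zero]
    rfl
  rw [hc, sub_eq_add_neg]
  have hv : ∀ n : ℤ, 1 ≤ n → ValGe 1 (q ^ n) := fun n hn => (valGe_qpow n).mono hn
  by_cases hk : 1 ≤ μ 0 + μ (0 : Fin r).succ - (k + 1)
  · refine add_mem (ValGe.smul_mem_qMul ((hv _ (by omega)).add (hv _ hk).neg) hm) ?_
    split_ifs with h
    -- For `μ₁ = 1` and `k < μ₂` the vector `f_1^{(k+1)} z` is already past the end of the string.
    · rw [(H.good.sl2 0).divPow_eq_zero hz hez]
      · exact zero_mem _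
      · rw [pairHom_apply, pair_add_right, pair_zsmul_right, pair_hh_alpha, pair_hh_zero]
        push_cast
        omega
    · exact zero_mem _
  · rw [if_pos (by omega), show μ 0 + μ (0 : Fin r).succ - (k + 1) = 0 by omega, qpow_zero,
      add_smul, neg_smul, Fq_one_smul, neg_add_cancel_right]
    exact ValGe.smul_mem_qMul (hv _ (by omega)) hm

end

theorem lead_one_sub_qpow {n : ℤ} (hn : 1 ≤ n) : Lead 0 (1 - q ^ n) := by
  rw [sub_eq_add_neg]
  exact lead_one.add ((valGe_qpow n).mono (by omega)).neg

section red

variable {M B : Type*} [AddCommGroup M] [Module Fq M] [Module Aq M] [IsScalarTower Aq Fq M]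
  {O : QOps r M} {L : Submodule Aq M} {C : QCrystal r B} {l : B → Submodule Aq (Red L)}

theorem IsCrystalBasis.fiberCrystal (h : IsCrystalBasis O L C l) (H : O.Queer) :
    FiberCrystal O.toGlOps {μ | 0 ≤ μ} L C.toGlCrystal l where
  good := H.good
  lattice := h.lattice
  regular := h.glCrystal.regular
  ne_bot := h.ne_bot
  le_weight := h.le_weight
  directSum := h.directSum
  arrow_e := h.arrow_e
  arrow_f := h.arrow_f

variable (h : IsCrystalBasis O L C l) (H : O.Queer) {b : B} {x : Red L}
include h

theorem IsCrystalBasis.exists_rep (hx : x ∈ l b) :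
    ∃ u : L, (u : M) ∈ O.weightSpace (C.wt b) ∧ (qSub L).mkQ u = x := by
  obtain ⟨u, hu, hux⟩ := h.le_weight b hx
  exact ⟨u, hu, hux⟩

include H

theorem IsCrystalBasis.wt_nonneg (b : B) : 0 ≤ C.wt b := by
  obtain ⟨x, hx, hx0⟩ := (Submodule.ne_bot_iff _).1 (h.ne_bot b)
  obtain ⟨u, hu, rfl⟩ := h.exists_rep hx
  refine H.nonneg_of_ne_zero hu fun h0 => hx0 ?_
  rw [mkQ_eq_zero, h0]
  exact zero_mem _

theorem IsCrystalBasis.redK1_eq_zero (hx : x ∈ l b) (hb : C.wt b 0 = 0) :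
    redMap h.k1_stable x = 0 := by
  obtain ⟨u, hu, rfl⟩ := h.exists_rep hx
  rw [redMap_eq_zero, H.tildeK1_eq_zero hu hb]
  exact zero_mem _

theorem IsCrystalBasis.redK1_redK1 (hx : x ∈ l b) (hb : C.wt b 0 ≠ 0) :
    redMap h.k1_stable (redMap h.k1_stable x) = x := by
  obtain ⟨u, hu, rfl⟩ := h.exists_rep hx
  have hb' : 0 < C.wt b 0 := lt_of_le_of_ne (h.wt_nonneg H b 0) hb.symm
  rw [redMap_mkQ, redMap_eq]
  change O.tildeK1 (O.tildeK1 u) - u ∈ qMul L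
  rw [H.tildeK1_tildeK1 hu]
  refine Lead.smul_sub_mem_qMul ?_ u.2
  have h1 := (lead_one_sub_qpow (n := 4 * C.wt b 0) (by omega)).mul
    (lead_one_sub_qpow (n := 4) (by omega)).inv
  rw [neg_zero, add_zero, ← div_eq_mul_inv, ← neg_div_neg_eq, neg_sub, neg_sub] at h1
  exact h1

theorem IsCrystalBasis.redσ_redσ (x : Red L) :
    redMap h.parity_stable (redMap h.parity_stable x) = x := by
  obtain ⟨u, rfl⟩ := (qSub L).mkQ_surjective x
  rw [redMap_mkQ, redMap_mkQ]
  congr 1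
  exact Subtype.ext (H.σ_σ u)

theorem IsCrystalBasis.redσ_redK1 (x : Red L) :
    redMap h.parity_stable (redMap h.k1_stable x) =
      -redMap h.k1_stable (redMap h.parity_stable x) := by
  obtain ⟨u, rfl⟩ := (qSub L).mkQ_surjective x
  simp only [redMap_mkQ]
  rw [← map_neg]
  congr 1
  exact Subtype.ext (H.σ_tildeK1_apply u)

/-- In the commutator `k̃_{1̄} e_1 - e_1 k̃_{1̄}` the second term dies because `k̃_{1̄}` kills
weights with `μ₁ = 0`, and on such weights `e_1 = ẽ_1`. -/
theorem IsCrystalBasis.redE1_eq (hx : x ∈ l b) (hb : C.wt b 0 = 0) :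
    redMap h.e1_stable x = redMap h.k1_stable (redMap (h.lattice.e_stable 0) x) := by
  obtain ⟨u, hu, rfl⟩ := h.exists_rep hx
  simp only [redMap_mkQ]
  congr 1
  refine Subtype.ext ?_
  change O.tildeE1 u = O.tildeK1 (O.tildeE 0 u)
  rw [QOps.tildeE1_apply H.K_k1 hu H.good.isRep, H.tildeK1_eq_zero hu hb, map_zero, sub_zero,
    H.e_eq_tildeE h.lattice.tildeStable hu u.2 hb]

theorem IsCrystalBasis.redE_eq_zero (hx : x ∈ l b) (hb : C.wt b 0 = 0)
    (hb' : C.wt b (0 : Fin r).succ = 0) : redMap (h.lattice.e_stable 0) x = 0 := by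
  obtain ⟨u, hu, rfl⟩ := h.exists_rep hx
  rw [redMap_eq_zero, ← H.e_eq_tildeE h.lattice.tildeStable hu u.2 hb]
  by_cases h0 : O.e 0 (u : M) = 0
  · rw [h0]; exact zero_mem _
  · have : (0 : ℤ) ≤ (C.wt b + alpha (0 : Fin r)) (0 : Fin r).succ :=
      H.nonneg_of_ne_zero (H.good.isRep.e_mem 0 hu) h0 (0 : Fin r).succ
    rw [Pi.add_apply, alpha_succ, hb'] at this
    omega

theorem IsCrystalBasis.redF1_eq_zero (hx : x ∈ l b) (hb : C.wt b 0 = 0) :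
    redMap h.f1_stable x = 0 := by
  obtain ⟨u, hu, rfl⟩ := h.exists_rep hx
  have h1 : O.f 0 (u : M) = 0 := by
    by_contra h0
    have : (0 : ℤ) ≤ (C.wt b - alpha (0 : Fin r)) 0 :=
      H.nonneg_of_ne_zero (H.good.isRep.f_mem 0 hu) h0 0
    rw [Pi.sub_apply, alpha_zero_zero, hb] at this
    omega
  rw [redMap_eq_zero, QOps.tildeF1_apply H.K_k1 hu H.good.isRep, H.tildeK1_eq_zero hu hb, h1,
    map_zero, map_zero, sub_zero, smul_zero]
  exact zero_mem _

/-- For `μ₁ = 1` the vector `f_1 u` has first coordinate `0` and is killed by `k̃_{1̄}`. What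
remains is a multiple of `f_1 k̃_{1̄} u`, to which `qpow_f_mem_qMul` applies. -/
theorem IsCrystalBasis.redF1_eq (hx : x ∈ l b) (hb : C.wt b 0 = 1) :
    redMap h.f1_stable x = redMap (h.lattice.f_stable 0) (redMap h.k1_stable x) := by
  obtain ⟨u, hu, rfl⟩ := h.exists_rep hx
  rw [redMap_mkQ h.k1_stable, redMap_mkQ (h.lattice.f_stable 0), redMap_eq]
  change O.tildeF1 u - O.tildeF 0 (O.tildeK1 u) ∈ qMul L
  have hK := QOps.tildeK1_mem H.K_k1 hu
  have hfu : O.tildeK1 (O.f 0 (u : M)) = 0 := by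
    refine H.tildeK1_eq_zero (H.good.isRep.f_mem 0 hu) ?_
    rw [Pi.sub_apply, alpha_zero_zero, hb, sub_self]
  have h1 := H.qpow_f_mem_qMul h.lattice.tildeStable hK (h.k1_stable _ u.2) (by omega)
  rw [if_pos hb, hb] at h1
  have h2 : O.tildeF1 (u : M) =
      q ^ C.wt b (0 : Fin r).succ • O.f 0 (O.tildeK1 (u : M)) := by
    rw [QOps.tildeF1_apply H.K_k1 hu H.good.isRep, hfu, sub_zero, pair_hh_zero, hb]
    congr 2
    ring
  -- With this, `h1` reads `q² f̃_{1̄} u - f̃_{1̄} u + f̃_1 k̃_{1̄} u ∈ qL`, and the first term is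
  -- itself in `qL`.
  have h3 : (q ^ (1 + C.wt b (0 : Fin r).succ) * (q - q⁻¹)) • O.f 0 (O.tildeK1 (u : M)) =
      (q ^ (2 : ℤ)) • O.tildeF1 (u : M) - O.tildeF1 (u : M) := by
    rw [h2, smul_smul, ← sub_smul]
    congr 1
    rw [zpow_add₀ q_ne_zero, zpow_one, mul_sub, show (2 : ℤ) = 1 + 1 from rfl,
      zpow_add₀ q_ne_zero, zpow_one]
    have := mul_inv_cancel₀ q_ne_zero
    linear_combination (-q ^ C.wt b (0 : Fin r).succ) * this
  have h4 : q ^ (2 : ℤ) • O.tildeF1 (u : M) ∈ qMul L :=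
    ValGe.smul_mem_qMul ((valGe_qpow 2).mono (by norm_num)) (h.f1_stable _ u.2)
  rw [h3] at h1
  have h5 := sub_mem h4 h1
  convert h5 using 1
  abel

theorem IsCrystalBasis.bijOn_redσ (b : B) : Set.BijOn (redMap h.parity_stable) (l b) (l b) := by
  have hm : Set.MapsTo (redMap h.parity_stable) (l b) (l b) := fun x hx => h.parity_mem b x hx
  refine ⟨hm, fun x _ y _ hxy => ?_, fun x hx => ⟨_, hm hx, h.redσ_redσ H x⟩⟩
  rw [← h.redσ_redσ H x, hxy, h.redσ_redσ H]

theorem IsCrystalBasis.bijOn_redK1 (hb : C.wt b 0 ≠ 0) :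
    Set.BijOn (redMap h.k1_stable) (l b) (l b) := by
  have hm : Set.MapsTo (redMap h.k1_stable) (l b) (l b) := fun x hx => h.k1_mem b x hx
  refine ⟨hm, fun x hx y hy hxy => ?_, fun x hx => ⟨_, hm hx, h.redK1_redK1 H hx hb⟩⟩
  rw [← h.redK1_redK1 H hx hb, hxy, h.redK1_redK1 H hy hb]

omit H in
/-- An arrow is determined by the operator that induces it. -/
theorem IsCrystalBasis.arrow_unique {T T' : Module.End Fq M} {hT : Stable L T} {hT' : Stable L T'}
    {o o' : Option B} (h1 : InducesArrow hT l b o) (h2 : InducesArrow hT' l b o')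
    (h3 : Set.EqOn (redMap hT) (redMap hT') (l b)) : o = o' := by
  obtain ⟨x, hx, hx0⟩ := (Submodule.ne_bot_iff _).1 (h.ne_bot b)
  have hne : ∀ {T : Module.End Fq M} {hT : Stable L T} {b' : B},
      InducesArrow hT l b (some b') → redMap hT x ≠ 0 := by
    intro T hT b' ha h0
    exact hx0 (ha.injOn hx (zero_mem _) (by rw [h0, map_zero]))
  have hxx := h3 hx
  cases o with
  | none =>
    cases o' with
    | none => rfl
    | some b' => exact absurd ((hxx.symm.trans (h1 x hx))) (hne h2)
  | some b' =>
    cases o' with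
    | none => exact absurd ((hxx.trans (h2 x hx))) (hne h1)
    | some b'' =>
      by_contra hbb
      have hbb' : b' ≠ b'' := fun h => hbb (by rw [h])
      have h4 : redMap hT x ∈ l b' := h1.mapsTo hx
      have h5 : redMap hT x ∈ l b'' := hxx ▸ h2.mapsTo hx
      have := (h.directSum.1.pairwiseDisjoint hbb').le_bot ⟨h4, h5⟩
      exact hne h1 this

/-- On `l_b` the operator `ẽ_{1̄}` is `ẽ_1` followed by `k̃_{1̄}`, which is bijective on the target
fibre since the first weight coordinate there is `1`. Hence both arrows have the same target. -/
theorem IsCrystalBasis.e1_eq_e (hb : C.wt b 0 = 0) : C.e1 b = C.e 0 b := by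
  have ha := h.arrow_e 0 b
  have h1 : InducesArrow h.e1_stable l b (C.e 0 b) := by
    cases hb' : C.e 0 b with
    | none =>
      rw [hb'] at ha
      intro x hx
      rw [h.redE1_eq H hx hb, ha x hx, map_zero]
    | some b' =>
      rw [hb'] at ha
      have hw : C.wt b' 0 ≠ 0 := by
        rw [h.glCrystal.1.wt_e 0 b b' hb', Pi.add_apply, alpha_zero_zero, hb]
        norm_num
      refine ((h.bijOn_redK1 H hw).comp ha).congr fun x hx => ?_
      exact (h.redE1_eq H hx hb).symm
  exact h.arrow_unique (h.arrow_e1 b) h1 fun x _ => rfl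

/-- Here `k̃_{1̄}` acts first, bijectively on `l_b`, and is followed by `f̃_1`. -/
theorem IsCrystalBasis.f1_eq_f (hb : C.wt b 0 = 1) : C.f1 b = C.f 0 b := by
  have ha := h.arrow_f 0 b
  have h1 : InducesArrow h.f1_stable l b (C.f 0 b) := by
    cases hb' : C.f 0 b with
    | none =>
      rw [hb'] at ha
      intro x hx
      rw [h.redF1_eq H hx hb, ha _ (h.k1_mem b x hx)]
    | some b' =>
      rw [hb'] at ha
      refine (Set.BijOn.comp ha (h.bijOn_redK1 H (b := b) (by omega))).congr fun x hx => ?_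
      exact (h.redF1_eq H hx hb).symm
  exact h.arrow_unique (h.arrow_f1 b) h1 fun x _ => rfl

end red

end

section

variable {r : ℕ} [NeZero r]

/-! ### The odd operators on a tensor product modulo `q` -/

theorem qpow_smul_sub_ite_mem {M : Type*} [AddCommGroup M] [Module Fq M] [Module Aq M]
    [IsScalarTower Aq Fq M] {X : Submodule Aq M} {v : M} (hv : v ∈ X) {n : ℤ} (hn : 0 ≤ n)
    {P : Prop} [Decidable P] (hP : P ↔ n = 0) : q ^ n • v - (if P then v else 0) ∈ qMul X := by
  split_ifs with h
  · rw [hP.1 h, qpow_zero, Fq_one_smul, sub_self]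
    exact zero_mem _
  · rw [sub_zero]
    refine ValGe.smul_mem_qMul ((valGe_qpow n).mono ?_) hv
    have := mt hP.2 h
    omega

section

variable {M₁ M₂ B₁ B₂ : Type*} [AddCommGroup M₁] [Module Fq M₁] [Module Aq M₁]
  [IsScalarTower Aq Fq M₁] [AddCommGroup M₂] [Module Fq M₂] [Module Aq M₂] [IsScalarTower Aq Fq M₂]
  {O₁ : QOps r M₁} {O₂ : QOps r M₂} {L₁ : Submodule Aq M₁} {L₂ : Submodule Aq M₂}
  {C₁ : QCrystal r B₁} {C₂ : QCrystal r B₂}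
  {l₁ : B₁ → Submodule Aq (Red L₁)} {l₂ : B₂ → Submodule Aq (Red L₂)}
  (H₁ : O₁.Queer) (H₂ : O₂.Queer)
  (h₁ : IsCrystalBasis O₁ L₁ C₁ l₁) (h₂ : IsCrystalBasis O₂ L₂ C₂ l₂)
include H₁ H₂ h₁ h₂

section vector

variable {lam μ : Lat r} {x : M₁} {y : M₂} (hx : x ∈ O₁.weightSpace lam)
  (hy : y ∈ O₂.weightSpace μ) (hxL : x ∈ L₁) (hyL : y ∈ L₂) (hμ : 0 ≤ μ)
include hx hy hxL hyL hμ

omit H₂ h₂ hx in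
theorem tildeK1_tmul_sub_mem : (O₁.tensor O₂).tildeK1 (x ⊗ₜ y) -
    ((if μ 0 = 0 then O₁.tildeK1 x ⊗ₜ[Fq] y else 0) + O₁.σ x ⊗ₜ[Fq] O₂.tildeK1 y) ∈
      qMul (tensorLattice L₁ L₂) := by
  rw [QOps.tensor_tildeK1 H₁ hy, add_sub_add_right_eq_sub]
  have h0 : (0 : ℤ) ≤ μ 0 := hμ 0
  exact qpow_smul_sub_ite_mem (tmul_mem_tensorLattice (h₁.k1_stable x hxL) hyL) (by omega)
    (by omega)

/-- Of the exact formula, the factor `q^{μ₁+μ₂}` survives only for `μ₁ = μ₂ = 0`. The middle term is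
negligible for `μ₁ > 0` by `qpow_e_mem_qMul`; for `μ₁ = 0` its coefficient is `-1` modulo `q` and
`e_1 y = ẽ_1 y`. -/
theorem tildeE1_tmul_sub_mem : (O₁.tensor O₂).tildeE1 (x ⊗ₜ y) -
    ((if μ 0 = 0 ∧ μ (0 : Fin r).succ = 0 then O₁.tildeE1 x ⊗ₜ[Fq] y else 0) -
      (if μ 0 = 0 then O₁.tildeK1 x ⊗ₜ[Fq] O₂.tildeE 0 y else 0) +
      O₁.σ x ⊗ₜ[Fq] O₂.tildeE1 y) ∈ qMul (tensorLattice L₁ L₂) := by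
  have h0 : (0 : ℤ) ≤ μ 0 := hμ 0
  have h0' : (0 : ℤ) ≤ μ (0 : Fin r).succ := hμ _
  have hK := h₁.k1_stable x hxL
  rw [QOps.tensor_tildeE1 H₁ H₂ hx hy, add_sub_add_right_eq_sub, sub_sub_eq_add_sub,
    add_right_comm, add_assoc, add_sub_right_comm]
  refine add_mem (qpow_smul_sub_ite_mem (tmul_mem_tensorLattice (h₁.e1_stable x hxL) hyL)
    (by omega) (by omega)) ?_
  have hT := h₂.lattice.tildeStable
  split_ifs with h
  · rw [h, mul_zero, qpow_zero, mul_one, H₂.e_eq_tildeE hT hy hyL h, sub_smul, Fq_one_smul,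
      add_comm, sub_add_cancel]
    exact ValGe.smul_mem_qMul (c := q ^ 2) ((valGe_qpow 2).mono (by norm_num))
      (tmul_mem_tensorLattice hK (h₂.lattice.e_stable 0 y hyL))
  · rw [zero_add, ← smul_smul, ← TensorProduct.tmul_smul]
    refine ValGe.smul_mem ?_ (tmul_mem_qMul_right hK (H₂.qpow_e_mem_qMul hT hy hyL (by omega)))
    rw [sub_eq_add_neg]
    exact ((valGe_qpow 2).mono (by norm_num)).add lead_one.valGe.neg

/-- The middle term is governed by `qpow_f_mem_qMul` for `μ₁ > 0`; for `μ₁ = 0` it vanishes, since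
`f_1 y` would have a negative weight coordinate. -/
theorem tildeF1_tmul_sub_mem : (O₁.tensor O₂).tildeF1 (x ⊗ₜ y) -
    ((if μ 0 = 0 ∧ μ (0 : Fin r).succ = 0 then O₁.tildeF1 x ⊗ₜ[Fq] y else 0) -
      (if μ 0 = 1 then O₁.tildeK1 x ⊗ₜ[Fq] O₂.tildeF 0 y else 0) +
      O₁.σ x ⊗ₜ[Fq] O₂.tildeF1 y) ∈ qMul (tensorLattice L₁ L₂) := by
  have h0 : (0 : ℤ) ≤ μ 0 := hμ 0
  have h0' : (0 : ℤ) ≤ μ (0 : Fin r).succ := hμ _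
  have hK := h₁.k1_stable x hxL
  rw [QOps.tensor_tildeF1 H₁ H₂ hx hy, add_sub_add_right_eq_sub, sub_sub_eq_add_sub,
    add_right_comm, add_assoc, add_sub_right_comm]
  refine add_mem (qpow_smul_sub_ite_mem (tmul_mem_tensorLattice (h₁.f1_stable x hxL) hyL)
    (by omega) (by omega)) ?_
  have hT := h₂.lattice.tildeStable
  rcases h0.eq_or_lt with h | h
  · have hf : O₂.f 0 y = 0 := by
      by_contra hne
      have : (0 : ℤ) ≤ (μ - alpha (0 : Fin r)) 0 :=
        H₂.nonneg_of_ne_zero (H₂.good.isRep.f_mem 0 hy) hne 0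
      rw [Pi.sub_apply, alpha_zero_zero] at this
      omega
    rw [if_neg (by omega), hf, TensorProduct.tmul_zero, smul_zero, add_zero]
    exact zero_mem _
  · have := tmul_mem_qMul_right hK (H₂.qpow_f_mem_qMul hT hy hyL h)
    rw [TensorProduct.tmul_add, TensorProduct.tmul_smul, add_comm] at this
    convert this using 2
    split_ifs
    · rfl
    · rw [TensorProduct.tmul_zero]

end vector

theorem stable_tensor_of_sub_mem {T : Module.End Fq (M₁ ⊗[Fq] M₂)}
    (h : ∀ (lam μ : Lat r), 0 ≤ μ → ∀ x ∈ L₁, ∀ y ∈ L₂, x ∈ O₁.weightSpace lam →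
      y ∈ O₂.weightSpace μ → ∃ z ∈ tensorLattice L₁ L₂,
        T (x ⊗ₜ y) - z ∈ qMul (tensorLattice L₁ L₂)) : Stable (tensorLattice L₁ L₂) T := by
  refine tensorLattice_stable h₁.lattice.le_span h₂.lattice.le_span ?_
  rintro x ⟨hxL, lam, -, hx⟩ y ⟨hyL, μ, hμ, hy⟩
  obtain ⟨z, hz, hTz⟩ := h lam μ hμ x hxL y hyL hx hy
  have := add_mem (qMul_le _ hTz) hz
  rwa [sub_add_cancel] at this

theorem IsCrystalBasis.tensor_k1_stable :
    Stable (tensorLattice L₁ L₂) (O₁.tensor O₂).tildeK1 := by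
  refine stable_tensor_of_sub_mem H₁ H₂ h₁ h₂ fun lam μ hμ x hxL y hyL hx hy =>
    ⟨_, ?_, tildeK1_tmul_sub_mem H₁ h₁ hy hxL hyL hμ⟩
  refine add_mem ?_ (tmul_mem_tensorLattice (h₁.parity_stable x hxL) (h₂.k1_stable y hyL))
  split_ifs
  · exact tmul_mem_tensorLattice (h₁.k1_stable x hxL) hyL
  · exact zero_mem _

theorem IsCrystalBasis.tensor_e1_stable :
    Stable (tensorLattice L₁ L₂) (O₁.tensor O₂).tildeE1 := by
  refine stable_tensor_of_sub_mem H₁ H₂ h₁ h₂ fun lam μ hμ x hxL y hyL hx hy =>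
    ⟨_, ?_, tildeE1_tmul_sub_mem H₁ H₂ h₁ h₂ hx hy hxL hyL hμ⟩
  refine add_mem (sub_mem ?_ ?_)
    (tmul_mem_tensorLattice (h₁.parity_stable x hxL) (h₂.e1_stable y hyL))
  · split_ifs
    · exact tmul_mem_tensorLattice (h₁.e1_stable x hxL) hyL
    · exact zero_mem _
  · split_ifs
    · exact tmul_mem_tensorLattice (h₁.k1_stable x hxL) (h₂.lattice.e_stable 0 y hyL)
    · exact zero_mem _

theorem IsCrystalBasis.tensor_f1_stable :
    Stable (tensorLattice L₁ L₂) (O₁.tensor O₂).tildeF1 := by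
  refine stable_tensor_of_sub_mem H₁ H₂ h₁ h₂ fun lam μ hμ x hxL y hyL hx hy =>
    ⟨_, ?_, tildeF1_tmul_sub_mem H₁ H₂ h₁ h₂ hx hy hxL hyL hμ⟩
  refine add_mem (sub_mem ?_ ?_)
    (tmul_mem_tensorLattice (h₁.parity_stable x hxL) (h₂.f1_stable y hyL))
  · split_ifs
    · exact tmul_mem_tensorLattice (h₁.f1_stable x hxL) hyL
    · exact zero_mem _
  · split_ifs
    · exact tmul_mem_tensorLattice (h₁.k1_stable x hxL) (h₂.lattice.f_stable 0 y hyL)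
    · exact zero_mem _

omit H₁ H₂ in
theorem IsCrystalBasis.tensor_parity_stable :
    Stable (tensorLattice L₁ L₂) (O₁.tensor O₂).σ := by
  refine tensorLattice_stable h₁.lattice.le_span h₂.lattice.le_span ?_
  rintro x ⟨hxL, -⟩ y ⟨hyL, -⟩
  exact tmul_mem_tensorLattice (h₁.parity_stable x hxL) (h₂.parity_stable y hyL)

section red

variable {b : B₁ × B₂} {x : Red L₁} {y : Red L₂} (hx : x ∈ l₁ b.1) (hy : y ∈ l₂ b.2)

omit H₁ H₂ in
theorem redσ_redTensor (x : Red L₁) (y : Red L₂) :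
    redMap (h₁.tensor_parity_stable h₂) (redTensor L₁ L₂ x y) =
      redTensor L₁ L₂ (redMap h₁.parity_stable x) (redMap h₂.parity_stable y) := by
  obtain ⟨u, rfl⟩ := (qSub L₁).mkQ_surjective x
  obtain ⟨v, rfl⟩ := (qSub L₂).mkQ_surjective y
  rfl

include hx hy

theorem redK1_redTensor :
    redMap (IsCrystalBasis.tensor_k1_stable H₁ H₂ h₁ h₂) (redTensor L₁ L₂ x y) =
      (if C₂.wt b.2 0 = 0 then redTensor L₁ L₂ (redMap h₁.k1_stable x) y else 0) +
        redTensor L₁ L₂ (redMap h₁.parity_stable x) (redMap h₂.k1_stable y) := by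
  obtain ⟨u, hu, rfl⟩ := h₁.exists_rep hx
  obtain ⟨v, hv, rfl⟩ := h₂.exists_rep hy
  have := tildeK1_tmul_sub_mem H₁ h₁ hv u.2 v.2 (h₂.wt_nonneg H₂ b.2)
  split_ifs at this ⊢
  · exact mkQ_eq.2 this
  · rw [zero_add] at this ⊢
    exact mkQ_eq.2 this

theorem redE1_redTensor :
    redMap (IsCrystalBasis.tensor_e1_stable H₁ H₂ h₁ h₂) (redTensor L₁ L₂ x y) =
      (if C₂.wt b.2 0 = 0 ∧ C₂.wt b.2 (0 : Fin r).succ = 0 then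
        redTensor L₁ L₂ (redMap h₁.e1_stable x) y else 0) -
      (if C₂.wt b.2 0 = 0 then
        redTensor L₁ L₂ (redMap h₁.k1_stable x) (redMap (h₂.lattice.e_stable 0) y) else 0) +
      redTensor L₁ L₂ (redMap h₁.parity_stable x) (redMap h₂.e1_stable y) := by
  obtain ⟨u, hu, rfl⟩ := h₁.exists_rep hx
  obtain ⟨v, hv, rfl⟩ := h₂.exists_rep hy
  have := tildeE1_tmul_sub_mem H₁ H₂ h₁ h₂ hu hv u.2 v.2 (h₂.wt_nonneg H₂ b.2)
  split_ifs at this ⊢ <;> (try simp only [zero_add, sub_zero, zero_sub] at this ⊢) <;>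
    exact mkQ_eq.2 this

theorem redF1_redTensor :
    redMap (IsCrystalBasis.tensor_f1_stable H₁ H₂ h₁ h₂) (redTensor L₁ L₂ x y) =
      (if C₂.wt b.2 0 = 0 ∧ C₂.wt b.2 (0 : Fin r).succ = 0 then
        redTensor L₁ L₂ (redMap h₁.f1_stable x) y else 0) -
      (if C₂.wt b.2 0 = 1 then
        redTensor L₁ L₂ (redMap h₁.k1_stable x) (redMap (h₂.lattice.f_stable 0) y) else 0) +
      redTensor L₁ L₂ (redMap h₁.parity_stable x) (redMap h₂.f1_stable y) := by
  obtain ⟨u, hu, rfl⟩ := h₁.exists_rep hx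
  obtain ⟨v, hv, rfl⟩ := h₂.exists_rep hy
  have := tildeF1_tmul_sub_mem H₁ H₂ h₁ h₂ hu hv u.2 v.2 (h₂.wt_nonneg H₂ b.2)
  split_ifs at this ⊢ <;> (try simp only [zero_add, sub_zero, zero_sub] at this ⊢) <;>
    exact mkQ_eq.2 this

end red

end

end

section

variable {r : ℕ} [NeZero r]

/-! ### The odd arrows of a tensor product -/

theorem bijOn_of_apply_apply {R X : Type*} [CommRing R] [AddCommGroup X] [Module R X]
    {V : Submodule R X} {D : X →ₗ[R] X} {s : R} (hs : IsUnit s) (h : ∀ x ∈ V, D x ∈ V)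
    (h' : ∀ x ∈ V, D (D x) = s • x) : Set.BijOn D V V := by
  refine ⟨h, fun x hx y hy hxy => ?_, fun x hx => ?_⟩
  · have := (h' x hx).symm.trans ((congrArg D hxy).trans (h' y hy))
    exact hs.smul_left_cancel.1 this
  · obtain ⟨t, rfl⟩ := hs
    refine ⟨D ((↑t⁻¹ : R) • x), h _ (V.smul_mem _ hx), ?_⟩
    rw [h' _ (V.smul_mem _ hx), smul_smul, Units.mul_inv, one_smul]

section

variable {M₁ M₂ B₁ B₂ : Type*} [AddCommGroup M₁] [Module Fq M₁] [Module Aq M₁]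
  [IsScalarTower Aq Fq M₁] [AddCommGroup M₂] [Module Fq M₂] [Module Aq M₂] [IsScalarTower Aq Fq M₂]
  {O₁ : QOps r M₁} {O₂ : QOps r M₂} {L₁ : Submodule Aq M₁} {L₂ : Submodule Aq M₂}
  {C₁ : QCrystal r B₁} {C₂ : QCrystal r B₂}
  {l₁ : B₁ → Submodule Aq (Red L₁)} {l₂ : B₂ → Submodule Aq (Red L₂)}
  (H₁ : O₁.Queer) (H₂ : O₂.Queer)
  (h₁ : IsCrystalBasis O₁ L₁ C₁ l₁) (h₂ : IsCrystalBasis O₂ L₂ C₂ l₂)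
include h₁ h₂

/-- `D` is the operator `σ ⊗ k̃_{1̄} - k̃_{1̄} ⊗ 1` modulo `q`. -/
def IsTwist (D : Red (tensorLattice L₁ L₂) →ₗ[Aq] Red (tensorLattice L₁ L₂)) : Prop :=
  ∀ x y, D (redTensor L₁ L₂ x y) =
    redTensor L₁ L₂ (redMap h₁.parity_stable x) (redMap h₂.k1_stable y) -
      redTensor L₁ L₂ (redMap h₁.k1_stable x) y

theorem exists_isTwist : ∃ D, IsTwist h₁ h₂ D := by
  have := h₁.lattice.free
  have := h₂.lattice.free
  obtain ⟨G, hG⟩ := exists_redTensorMap h₁.lattice.base h₂.lattice.base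
    (redMap h₁.parity_stable) (redMap h₂.k1_stable)
  obtain ⟨G', hG'⟩ := exists_redTensorMap h₁.lattice.base h₂.lattice.base
    (redMap h₁.k1_stable) LinearMap.id
  exact ⟨G - G', fun x y => by rw [LinearMap.sub_apply, hG, hG', LinearMap.id_apply]⟩

include H₁ H₂

variable {b : B₁ × B₂}

/-- Since `σ` and `k̃_{1̄}` anticommute, the cross terms of `D²` cancel and `D² = 1 ⊗ k̃_{1̄}² +
k̃_{1̄}² ⊗ 1`. The first summand is `1` on the fibre by hypothesis, the second is `0` or `1`, and
both `1` and `2` are units of `𝐀`. -/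
theorem IsTwist.bijOn {D : Red (tensorLattice L₁ L₂) →ₗ[Aq] Red (tensorLattice L₁ L₂)}
    (hD : IsTwist h₁ h₂ D) (hb : C₂.wt b.2 0 ≠ 0) :
    Set.BijOn D (tensorFiber l₁ l₂ b) (tensorFiber l₁ l₂ b) := by
  have h2 : IsUnit (2 : Aq) := by
    have := (IsUnit.mk0 (2 : ℂ) two_ne_zero).map (PowerSeries.C (R := ℂ))
    rwa [map_ofNat] at this
  refine bijOn_of_apply_apply (s := if C₁.wt b.1 0 = 0 then 1 else 2) (by split_ifs <;> simp [h2])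
    ?_ ?_
  · refine tensorFiber_le (X := (tensorFiber l₁ l₂ b).comap D) fun x hx y hy => ?_
    rw [Submodule.mem_comap, hD]
    exact sub_mem (redTensor_mem_tensorFiber (h₁.parity_mem _ x hx) (h₂.k1_mem _ y hy))
      (redTensor_mem_tensorFiber (h₁.k1_mem _ x hx) hy)
  · suffices h : tensorFiber l₁ l₂ b ≤ LinearMap.ker
        (D ∘ₗ D - (if C₁.wt b.1 0 = 0 then 1 else 2 : Aq) • LinearMap.id) by
      intro x hx
      have := h hx
      rwa [LinearMap.mem_ker, LinearMap.sub_apply, sub_eq_zero] at this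
    refine tensorFiber_le fun x hx y hy => ?_
    rw [LinearMap.mem_ker, LinearMap.sub_apply, sub_eq_zero, LinearMap.comp_apply,
      LinearMap.smul_apply, LinearMap.id_apply]
    unfold IsTwist at hD
    simp only [hD, map_sub]
    rw [h₁.redσ_redσ H₁, h₂.redK1_redK1 H₂ hy hb, h₁.redσ_redK1 H₁, map_neg, LinearMap.neg_apply]
    split_ifs with h0
    · rw [h₁.redK1_eq_zero H₁ hx h0]
      simp
    · rw [h₁.redK1_redK1 H₁ hx h0, two_smul]
      abel

/-- Let `μ = wt b₂`. For `μ₁ = μ₂ = 0` only `ẽ_{1̄} ⊗ 1` is left, for `μ₁ > 0` only `σ ⊗ ẽ_{1̄}`.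
For `μ₁ = 0 < μ₂` the remaining terms combine to `D (1 ⊗ ẽ_1)`, and `ẽ_{1̄} b₂ = ẽ_1 b₂` in the
crystal. -/
theorem InducesArrow.tensor_e1 (b : B₁ × B₂) :
    InducesArrow (IsCrystalBasis.tensor_e1_stable H₁ H₂ h₁ h₂) (tensorFiber l₁ l₂) b
      ((C₁.tensor C₂).e1 b) := by
  have F₁ := h₁.lattice.free
  have F₂ := h₂.lattice.free
  have hr := fun x (hx : x ∈ l₁ b.1) y (hy : y ∈ l₂ b.2) =>
    redE1_redTensor H₁ H₂ h₁ h₂ (b := b) hx hy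
  simp only [QCrystal.tensor, pair_kk]
  by_cases hc : C₂.wt b.2 0 = 0 ∧ C₂.wt b.2 (0 : Fin r).succ = 0
  · rw [if_pos hc]
    refine inducesArrow_left h₁.lattice.base h₂.lattice.base h₁.directSum h₂.directSum _
      (h₁.arrow_e1 b.1) fun x hx y hy => ?_
    rw [hr x hx y hy, if_pos hc, if_pos hc.1, h₂.redE1_eq H₂ hy hc.1,
      h₂.redE_eq_zero H₂ hy hc.1 hc.2]
    simp
  rw [if_neg hc]
  by_cases h0 : C₂.wt b.2 0 = 0
  swap
  · refine inducesArrow_right h₁.lattice.base h₂.lattice.base h₁.directSum h₂.directSum _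
      (h₂.arrow_e1 b.2) (h₁.bijOn_redσ H₁ b.1) fun x hx y hy => ?_
    rw [hr x hx y hy, if_neg hc, if_neg h0, sub_zero, zero_add]
  obtain ⟨D, hD⟩ := exists_isTwist h₁ h₂
  have hr' : ∀ x ∈ l₁ b.1, ∀ y ∈ l₂ b.2,
      redMap (IsCrystalBasis.tensor_e1_stable H₁ H₂ h₁ h₂) (redTensor L₁ L₂ x y) =
        D (redTensor L₁ L₂ x (redMap (h₂.lattice.e_stable 0) y)) := fun x hx y hy => by
    rw [hr x hx y hy, if_neg hc, if_pos h0, hD, h₂.redE1_eq H₂ hy h0]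
    abel
  rw [h₂.e1_eq_e H₂ h0]
  have ha := h₂.arrow_e 0 b.2
  cases hb' : C₂.e 0 b.2 with
  | none =>
    rw [hb'] at ha
    refine tensorFiber_le (X := LinearMap.ker (redMap _)) fun x hx y hy => ?_
    rw [LinearMap.mem_ker, hr' x hx y hy, ha y hy, map_zero, map_zero]
  | some b' =>
    rw [hb'] at ha
    obtain ⟨G, hG⟩ := exists_redTensorMap h₁.lattice.base h₂.lattice.base LinearMap.id
      (redMap (h₂.lattice.e_stable 0))
    have hbij : Set.BijOn G (tensorFiber l₁ l₂ b) (tensorFiber l₁ l₂ (b.1, b')) := by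
      simp only [tensorFiber_eq_map₂]
      refine bijOn_map₂ h₁.lattice.base h₂.lattice.base (A := LinearMap.id) (Set.bijOn_id _) ha
        ?_ ?_ fun x _ y _ => hG x y
      · exact (h₁.directSum.exists_proj b.1).imp fun p hp => ⟨hp.1, hp.2.2⟩
      · exact (h₂.directSum.exists_proj b').imp fun p hp => ⟨hp.1, hp.2.2⟩
    have hw : C₂.wt b' 0 ≠ 0 := by
      rw [h₂.glCrystal.1.wt_e 0 b.2 b' hb', Pi.add_apply, alpha_zero_zero, h0]
      norm_num
    -- `D` acts on the target fibre, where the first weight coordinate of `b'` is `1`.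
    refine ((IsTwist.bijOn H₁ H₂ h₁ h₂ (b := (b.1, b')) hD hw).comp hbij).congr ?_
    have hle : tensorFiber l₁ l₂ b ≤ LinearMap.ker (D ∘ₗ G -
        redMap (IsCrystalBasis.tensor_e1_stable H₁ H₂ h₁ h₂)) :=
      tensorFiber_le fun x hx y hy => by
        rw [LinearMap.mem_ker, LinearMap.sub_apply, sub_eq_zero, LinearMap.comp_apply, hG,
          hr' x hx y hy, LinearMap.id_apply]
    exact fun x hx => sub_eq_zero.1 (hle hx)

/-- The critical case is now `μ₁ = 1`, where the operator is `(1 ⊗ f̃_1) D` and `D` acts on the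
source fibre. For `μ₁ = μ₂ = 0` the second factor contributes nothing, as `f̃_{1̄}` vanishes on it.
-/
theorem InducesArrow.tensor_f1 (b : B₁ × B₂) :
    InducesArrow (IsCrystalBasis.tensor_f1_stable H₁ H₂ h₁ h₂) (tensorFiber l₁ l₂) b
      ((C₁.tensor C₂).f1 b) := by
  have F₁ := h₁.lattice.free
  have F₂ := h₂.lattice.free
  have hr := fun x (hx : x ∈ l₁ b.1) y (hy : y ∈ l₂ b.2) =>
    redF1_redTensor H₁ H₂ h₁ h₂ (b := b) hx hy
  simp only [QCrystal.tensor, pair_kk]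
  by_cases hc : C₂.wt b.2 0 = 0 ∧ C₂.wt b.2 (0 : Fin r).succ = 0
  · rw [if_pos hc]
    refine inducesArrow_left h₁.lattice.base h₂.lattice.base h₁.directSum h₂.directSum _
      (h₁.arrow_f1 b.1) fun x hx y hy => ?_
    rw [hr x hx y hy, if_pos hc, if_neg (by omega), h₂.redF1_eq_zero H₂ hy hc.1]
    simp
  rw [if_neg hc]
  by_cases h0 : C₂.wt b.2 0 = 1
  swap
  · refine inducesArrow_right h₁.lattice.base h₂.lattice.base h₁.directSum h₂.directSum _
      (h₂.arrow_f1 b.2) (h₁.bijOn_redσ H₁ b.1) fun x hx y hy => ?_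
    rw [hr x hx y hy, if_neg hc, if_neg h0, sub_zero, zero_add]
  obtain ⟨D, hD⟩ := exists_isTwist h₁ h₂
  obtain ⟨G, hG⟩ := exists_redTensorMap h₁.lattice.base h₂.lattice.base LinearMap.id
    (redMap (h₂.lattice.f_stable 0))
  have hle : tensorFiber l₁ l₂ b ≤ LinearMap.ker (G ∘ₗ D -
      redMap (IsCrystalBasis.tensor_f1_stable H₁ H₂ h₁ h₂)) :=
    tensorFiber_le fun x hx y hy => by
      rw [LinearMap.mem_ker, LinearMap.sub_apply, sub_eq_zero, LinearMap.comp_apply,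
        hr x hx y hy, if_neg hc, if_pos h0, hD, h₂.redF1_eq H₂ hy h0, map_sub, hG, hG,
        LinearMap.id_apply, LinearMap.id_apply]
      abel
  have hle' : ∀ x ∈ tensorFiber l₁ l₂ b, G (D x) =
      redMap (IsCrystalBasis.tensor_f1_stable H₁ H₂ h₁ h₂) x := fun x hx => sub_eq_zero.1 (hle hx)
  have hDb := IsTwist.bijOn H₁ H₂ h₁ h₂ (b := b) hD (by omega)
  rw [h₂.f1_eq_f H₂ h0]
  have ha := h₂.arrow_f 0 b.2
  cases hb' : C₂.f 0 b.2 with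
  | none =>
    rw [hb'] at ha
    intro x hx
    rw [← hle' x hx]
    refine tensorFiber_le (X := LinearMap.ker G) (fun x hx y hy => ?_) (hDb.mapsTo hx)
    rw [LinearMap.mem_ker, hG, ha y hy, map_zero]
  | some b' =>
    rw [hb'] at ha
    have hbij : Set.BijOn G (tensorFiber l₁ l₂ b) (tensorFiber l₁ l₂ (b.1, b')) := by
      simp only [tensorFiber_eq_map₂]
      refine bijOn_map₂ h₁.lattice.base h₂.lattice.base (A := LinearMap.id) (Set.bijOn_id _) ha
        ?_ ?_ fun x _ y _ => hG x y
      · exact (h₁.directSum.exists_proj b.1).imp fun p hp => ⟨hp.1, hp.2.2⟩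
      · exact (h₂.directSum.exists_proj b').imp fun p hp => ⟨hp.1, hp.2.2⟩
    exact (hbij.comp hDb).congr hle'

theorem QCrystal.tensor_f1_iff_e1 (b b' : B₁ × B₂) :
    (C₁.tensor C₂).f1 b = some b' ↔ (C₁.tensor C₂).e1 b' = some b := by
  obtain ⟨x, y⟩ := b
  obtain ⟨x', y'⟩ := b'
  have hpos : ∀ y i, (0 : ℤ) ≤ C₂.wt y i := fun y i => h₂.wt_nonneg H₂ y i
  -- An odd arrow preserves `μ₁ + μ₂`, and both coordinates are nonnegative, so the condition that
  -- selects the tensor factor is the same at both ends.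
  have key : C₂.f1 y = some y' → ((C₂.wt y 0 = 0 ∧ C₂.wt y (0 : Fin r).succ = 0) ↔
      (C₂.wt y' 0 = 0 ∧ C₂.wt y' (0 : Fin r).succ = 0)) := fun hf => by
    have h3 := h₂.wt_f1 y y' hf
    have h4 := congrFun h3 0
    have h5 := congrFun h3 (0 : Fin r).succ
    rw [Pi.sub_apply, alpha_zero_zero] at h4
    rw [Pi.sub_apply, alpha_succ] at h5
    have := hpos y 0
    have := hpos y (0 : Fin r).succ
    have := hpos y' 0
    have := hpos y' (0 : Fin r).succ
    omega
  simp only [QCrystal.tensor, pair_kk]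
  by_cases hc : C₂.wt y 0 = 0 ∧ C₂.wt y (0 : Fin r).succ = 0 <;>
    by_cases hc' : C₂.wt y' 0 = 0 ∧ C₂.wt y' (0 : Fin r).succ = 0
  · rw [if_pos hc, if_pos hc']
    simp only [Option.map_eq_some_iff, Prod.mk.injEq]
    constructor
    · rintro ⟨z, hz, rfl, rfl⟩
      exact ⟨x, (h₁.f1_iff_e1 _ _).1 hz, rfl, rfl⟩
    · rintro ⟨z, hz, rfl, rfl⟩
      exact ⟨x', (h₁.f1_iff_e1 _ _).2 hz, rfl, rfl⟩
  · rw [if_pos hc, if_neg hc']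
    simp only [Option.map_eq_some_iff, Prod.mk.injEq]
    constructor
    · rintro ⟨_, -, -, rfl⟩
      exact absurd hc hc'
    · rintro ⟨z, hz, -, rfl⟩
      exact absurd ((key ((h₂.f1_iff_e1 _ _).2 hz)).1 hc) hc'
  · rw [if_neg hc, if_pos hc']
    simp only [Option.map_eq_some_iff, Prod.mk.injEq]
    constructor
    · rintro ⟨z, hz, -, rfl⟩
      exact absurd ((key hz).2 hc') hc
    · rintro ⟨_, -, -, rfl⟩
      exact absurd hc' hc
  · rw [if_neg hc, if_neg hc']
    simp only [Option.map_eq_some_iff, Prod.mk.injEq]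
    constructor
    · rintro ⟨z, hz, rfl, rfl⟩
      exact ⟨y, (h₂.f1_iff_e1 _ _).1 hz, rfl, rfl⟩
    · rintro ⟨z, hz, rfl, rfl⟩
      exact ⟨y', (h₂.f1_iff_e1 _ _).2 hz, rfl, rfl⟩

omit H₁ H₂ in
theorem QCrystal.tensor_wt_e1 (b b' : B₁ × B₂) (h : (C₁.tensor C₂).e1 b = some b') :
    (C₁.tensor C₂).wt b' = (C₁.tensor C₂).wt b + alpha 0 := by
  simp only [QCrystal.tensor] at h
  simp only [QCrystal.tensor, GlCrystal.tensor]
  split_ifs at h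
  · obtain ⟨z, hz, rfl⟩ := Option.map_eq_some_iff.1 h
    rw [h₁.wt_e1 _ _ hz]
    abel
  · obtain ⟨z, hz, rfl⟩ := Option.map_eq_some_iff.1 h
    rw [h₂.wt_e1 _ _ hz]
    abel

theorem IsCrystalBasis.tensor :
    IsCrystalBasis (O₁.tensor O₂) (tensorLattice L₁ L₂) (C₁.tensor C₂) (tensorFiber l₁ l₂) :=
  have hF := (h₁.fiberCrystal H₁).tensor (h₂.fiberCrystal H₂) fun μ hμ ν hν =>
    show 0 ≤ μ + ν from add_nonneg hμ hν
  { lattice := hF.lattice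
    k1_stable := IsCrystalBasis.tensor_k1_stable H₁ H₂ h₁ h₂
    e1_stable := IsCrystalBasis.tensor_e1_stable H₁ H₂ h₁ h₂
    f1_stable := IsCrystalBasis.tensor_f1_stable H₁ H₂ h₁ h₂
    parity_stable := h₁.tensor_parity_stable h₂
    glCrystal := h₁.glCrystal.tensor h₂.glCrystal
    wt_e1 := QCrystal.tensor_wt_e1 h₁ h₂
    wt_f1 := fun b b' h => by
      rw [QCrystal.tensor_wt_e1 h₁ h₂ b' b ((QCrystal.tensor_f1_iff_e1 H₁ H₂ h₁ h₂ b b').1 h),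
        add_sub_cancel_right]
    f1_iff_e1 := QCrystal.tensor_f1_iff_e1 H₁ H₂ h₁ h₂
    ne_bot := hF.ne_bot
    le_weight := hF.le_weight
    directSum := hF.directSum
    parity_mem := fun b => tensorFiber_le (X := (tensorFiber l₁ l₂ b).comap (redMap _))
      fun x hx y hy => by
        rw [Submodule.mem_comap, redσ_redTensor h₁ h₂]
        exact redTensor_mem_tensorFiber (h₁.parity_mem _ x hx) (h₂.parity_mem _ y hy)
    k1_mem := fun b => tensorFiber_le (X := (tensorFiber l₁ l₂ b).comap (redMap _))
      fun x hx y hy => by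
        rw [Submodule.mem_comap, redK1_redTensor H₁ H₂ h₁ h₂ hx hy]
        refine add_mem ?_ (redTensor_mem_tensorFiber (h₁.parity_mem _ x hx) (h₂.k1_mem _ y hy))
        split_ifs
        · exact redTensor_mem_tensorFiber (h₁.k1_mem _ x hx) hy
        · exact zero_mem _
    arrow_e := hF.arrow_e
    arrow_f := hF.arrow_f
    arrow_e1 := InducesArrow.tensor_e1 H₁ H₂ h₁ h₂
    arrow_f1 := InducesArrow.tensor_f1 H₁ H₂ h₁ h₂ }

end

end

section

variable {r : ℕ} [NeZero r]

/-! ### Tensor products in `𝒪_int^{≥0}` -/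

omit [NeZero r] in
theorem qz_succ (n : ℤ) : qz (n + 1) = q * qz n + q ^ (-n) := by
  have h0 := q_ne_zero
  have h1 := q_sub_inv_ne_zero
  rw [qz, qz, ← mul_div_assoc, div_add' _ _ _ h1]
  congr 1
  rw [mul_sub, mul_sub, zpow_add_one₀ h0, neg_add, zpow_add₀ h0 (-n), zpow_neg_one]
  ring

section

variable {M : Type*} [AddCommGroup M] [Module Fq M]

omit [NeZero r] in
/-- The operators `k_{j̄}` vanish on the weight spaces on which they have to vanish as soon as
`k_{1̄}` does. -/
theorem SuperRep.kbar_eq_zero {R : SuperRep r M} (H : R.ops.toGlOps.Good)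
    (hpos : ∀ μ, R.ops.weightSpace μ ≠ ⊥ → 0 ≤ μ)
    (h1 : ∀ μ : Lat r, μ 0 = 0 → ∀ u ∈ R.ops.weightSpace μ, R.ops.k1 u = 0) (j : Fin (r + 1)) :
    ∀ μ : Lat r, μ j = 0 → ∀ u ∈ R.ops.weightSpace μ, R.ρ (Uq.gen (.kbar j)) u = 0 := by
  have hneg : ∀ {μ : Lat r} {u : M} (j : Fin (r + 1)), u ∈ R.ops.weightSpace μ → μ j < 0 →
      u = 0 := fun {μ u} j hu hj => by
    by_contra h0
    have : (0 : ℤ) ≤ μ j := hpos μ (fun h => h0 (by rwa [h, Submodule.mem_bot] at hu)) j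
    omega
  have hk : ∀ {μ : Lat r} {u : M} (j : Fin (r + 1)), u ∈ R.ops.weightSpace μ →
      R.ρ (Uq.gen (.kbar j)) u ∈ R.ops.weightSpace μ := fun {μ u} j hu => by
    rw [GlOps.mem_weightSpace] at hu ⊢
    intro h
    have : R.ops.K h * R.ρ (Uq.gen (.kbar j)) = R.ρ (Uq.gen (.kbar j)) * R.ops.K h := by
      simpa [SuperRep.ops, QGen.Q, QGen.Kb] using R.rel (QRel.q_kbar h j)
    rw [← Module.End.mul_apply, this, Module.End.mul_apply, hu, map_smul]
  induction j using Fin.induction with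
  | zero => exact h1
  | succ i ih =>
    intro μ hμ u hu
    have hcomm : R.ops.e i * R.ρ (Uq.gen (.ebar i)) = R.ρ (Uq.gen (.ebar i)) * R.ops.e i := by
      rw [← sub_eq_zero]
      simpa [SuperRep.ops, QGen.E, QGen.Eb] using R.rel (QRel.e_ebar i)
    have hke : R.ρ (Uq.gen (.kbar i.castSucc)) * R.ops.e i -
        q • (R.ops.e i * R.ρ (Uq.gen (.kbar i.castSucc))) =
        R.ρ (Uq.gen (.ebar i)) * R.ops.K (-kk i.castSucc) := by
      simpa [SuperRep.ops, QGen.E, QGen.Eb, QGen.Q, QGen.Kb] using R.rel (QRel.kbar_e i)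
    have hef : R.ρ (Uq.gen (.ebar i)) * R.ops.f i - R.ops.f i * R.ρ (Uq.gen (.ebar i)) =
        R.ρ (Uq.gen (.kbar i.castSucc)) * R.ops.K (kk i.succ) -
          R.ρ (Uq.gen (.kbar i.succ)) * R.ops.K (kk i.castSucc) := by
      simpa [SuperRep.ops, QGen.F, QGen.Eb, QGen.Q, QGen.Kb] using R.rel (QRel.ebar_f i i)
    set k := R.ρ (Uq.gen (.kbar i.castSucc))
    set k' := R.ρ (Uq.gen (.kbar i.succ))
    set eb := R.ρ (Uq.gen (.ebar i))
    set e := R.ops.e i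
    set f := R.ops.f i
    have S := H.sl2 i
    have hke' : ∀ {ν : Lat r} {z : M}, z ∈ R.ops.weightSpace ν →
        k (e z) = q • e (k z) + q ^ (-ν i.castSucc) • eb z := fun {ν z} hz => by
      have := congrArg (fun T : Module.End Fq M => T z) hke
      simp only [LinearMap.sub_apply, Module.End.mul_apply, LinearMap.smul_apply,
        GlOps.mem_weightSpace.1 hz, pair_neg_left, pair_kk, map_smul] at this
      rw [sub_eq_iff_eq_add'] at this
      exact this
    have hezero : ∀ {z : M}, z ∈ R.ops.weightSpace μ → e z = 0 := fun {z} hz =>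
      hneg i.succ (H.isRep.e_mem i hz) (by rw [Pi.add_apply, alpha_succ, hμ]; norm_num)
    -- `e_i` kills `u` and `k_{ī} u`, since it would make the coordinate at `i + 1` equal to `-1`;
    -- the relation for `k_{ī} e_i` then leaves only `e_{ī} u`.
    have heb : eb u = 0 := by
      have := hke' hu
      rw [hezero hu, hezero (hk _ hu), map_zero, smul_zero, zero_add] at this
      exact (smul_eq_zero.1 this.symm).resolve_left (zpow_ne_zero _ q_ne_zero)
    have hk' : q ^ μ i.castSucc • k' u = k u - eb (f u) := by
      have := congrArg (fun T : Module.End Fq M => T u) hef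
      simp only [LinearMap.sub_apply, Module.End.mul_apply,
        GlOps.mem_weightSpace.1 hu, pair_kk, map_smul, heb, map_zero, sub_zero, hμ, qpow_zero,
        Fq_one_smul] at this
      rw [this, sub_sub_cancel]
    -- By the relation between `e_{ī}` and `f_i`, the vanishing of `k_{i+1}` barred on `u` amounts
    -- to `k_{ī} u = e_{ī} f_i u`.
    suffices h : k u = eb (f u) by
      rw [h, sub_self] at hk'
      exact (smul_eq_zero.1 hk').resolve_left (zpow_ne_zero _ q_ne_zero)
    rcases lt_or_ge (μ i.castSucc) 0 with hm | hm
    · rw [hneg _ hu hm]; simp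
    obtain ⟨N, hN⟩ := Int.eq_ofNat_of_zero_le hm
    have hp : pairHom (hh i) μ = N := by
      rw [pairHom_apply, pair_hh, hμ, hN]; simp
    have hfw := S.divPow_mem hu N
    have hv0 : (μ - (N : ℤ) • alpha i) i.castSucc = 0 := by
      rw [Pi.sub_apply, Pi.smul_apply, alpha_castSucc, hN]; simp
    have hkv := ih _ hv0 _ hfw
    cases N with
    | zero =>
      have hfu : f u = 0 := hneg i.castSucc (H.isRep.f_mem i hu) (by
        rw [Pi.sub_apply, alpha_castSucc, hN]; norm_num)
      rw [hfu, map_zero, ih μ hN u hu]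
    | succ N =>
      -- The bottom `v` of the string of `u` has coordinate `0` at `i`, so `k_{ī} v = 0` by
      -- induction. Both `u` and `f_i u` are recovered from `v` by divided powers of `e_i`.
      set v := divPow f (N + 1) u
      have hv1 : divPow e (N + 1) v = u := by
        have := S.divPow_e_divPow_f hu (hezero hu) hp le_rfl
        simpa using this
      have hv2 : divPow e N v = f u := by
        have := S.divPow_e_divPow_f hu (hezero hu) hp (Nat.le_succ N)
        rwa [Nat.add_sub_cancel_left, divPow_one] at this
      have key : ∀ j : ℕ, k (divPow e (j + 1) v) = eb (divPow e j v) := by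
        intro j
        induction j with
        | zero =>
          rw [zero_add, divPow_one, hke' hfw, hkv, map_zero, smul_zero, zero_add, hv0, neg_zero,
            qpow_zero, Fq_one_smul, divPow_zero, Module.End.one_apply]
        | succ j ihj =>
          have hz := S.flip.divPow_mem hfw (j + 1)
          have hw : (μ - ((N + 1 : ℕ) : ℤ) • alpha i - ((j + 1 : ℕ) : ℤ) • -alpha i) i.castSucc =
              (j : ℤ) + 1 := by
            rw [Pi.sub_apply, hv0, Pi.smul_apply, Pi.neg_apply, alpha_castSucc]; simp
          have hee : e (eb (divPow e j v)) = eb (e (divPow e j v)) :=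
            congrArg (fun T : Module.End Fq M => T (divPow e j v)) hcomm
          -- The two contributions of `k_{ī} e_i = q e_i k_{ī} + e_{ī} q^{-k_i}` add up by `[j+2] =
          -- q [j+1] + q^{-(j+1)}`.
          rw [divPow_succ e (j + 1), map_smul, hke' hz, hw, ihj, hee, ← divPow_succ_smul, map_smul,
            smul_smul, ← add_smul, ← qz_succ, smul_smul]
          push_cast
          rw [inv_mul_cancel₀ (qz_ne_zero (by positivity)), Fq_one_smul]
      rw [← hv2, ← key N, hv1]

end

section

variable {M₁ M₂ : Type*} [AddCommGroup M₁] [Module Fq M₁] [AddCommGroup M₂] [Module Fq M₂]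
  {O₁ : QOps r M₁} {O₂ : QOps r M₂} (H₁ : O₁.Queer) (H₂ : O₂.Queer)
include H₁ H₂

/-- Tensors of weight vectors span the product, and the projection onto the weight `μ` kills those
of other weights. Nonzero weight vectors have nonnegative weights, which accounts for the extra
hypotheses in `h`. -/
theorem QOps.Queer.tensor_weightSpace_le {μ : Lat r} {X : Submodule Fq (M₁ ⊗[Fq] M₂)}
    (h : ∀ (lam ν : Lat r) (x : M₁) (y : M₂), 0 ≤ lam → 0 ≤ ν → lam + ν = μ →
      x ∈ O₁.weightSpace lam → y ∈ O₂.weightSpace ν → x ⊗ₜ[Fq] y ∈ X) :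
    (O₁.tensor O₂).weightSpace μ ≤ X := by
  obtain ⟨p, h1, h2, -⟩ := (H₁.good.tensor H₂.good).weight.exists_proj μ
  have htop : (⊤ : Submodule Fq (M₁ ⊗[Fq] M₂)) ≤ X.comap p := by
    rw [← TensorProduct.map₂_mk_top_top_eq_top, ← H₁.good.weight.2, ← H₂.good.weight.2,
      Submodule.iSup_eq_span, Submodule.iSup_eq_span, Submodule.map₂_span_span, Submodule.span_le]
    rintro _ ⟨x, hx, y, hy, rfl⟩
    obtain ⟨lam, hx⟩ := Set.mem_iUnion.1 hx
    obtain ⟨ν, hy⟩ := Set.mem_iUnion.1 hy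
    have hxy := tmul_mem_weightSpace (O₁ := O₁.toGlOps) (O₂ := O₂.toGlOps) hx hy
    change p (x ⊗ₜ y) ∈ X
    by_cases hμ : lam + ν = μ
    · rw [h1 _ (hμ ▸ hxy)]
      by_cases hx0 : x = 0
      · rw [hx0, TensorProduct.zero_tmul]; exact zero_mem _
      by_cases hy0 : y = 0
      · rw [hy0, TensorProduct.tmul_zero]; exact zero_mem _
      exact h lam ν x y (H₁.nonneg_of_ne_zero hx hx0) (H₂.nonneg_of_ne_zero hy hy0) hμ hx hy
    · rw [h2 _ hμ _ hxy]; exact zero_mem _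
  intro w hw
  rw [← h1 w hw]
  exact htop (Submodule.mem_top (x := w))

theorem QOps.Queer.tensor_nonneg (μ : Lat r) (hμ : (O₁.tensor O₂).weightSpace μ ≠ ⊥) : 0 ≤ μ := by
  by_contra h0
  refine hμ (le_bot_iff.1 (H₁.tensor_weightSpace_le H₂ fun lam ν x y hlam hν hadd _ _ => ?_))
  exact absurd (hadd ▸ add_nonneg hlam hν) h0

/-- Nonnegative first coordinates with sum zero are both zero, so `k_{1̄}` kills both factors and
hence each term of the coproduct. -/
theorem QOps.Queer.tensor_k1_eq_zero (μ : Lat r) (hμ : μ 0 = 0) (u : M₁ ⊗[Fq] M₂)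
    (hu : u ∈ (O₁.tensor O₂).weightSpace μ) : (O₁.tensor O₂).k1 u = 0 := by
  refine H₁.tensor_weightSpace_le H₂ (X := LinearMap.ker (O₁.tensor O₂).k1)
    (fun lam ν x y hlam hν hadd hx hy => ?_) hu
  have h1 : (0 : ℤ) ≤ lam 0 := hlam 0
  have h2 : (0 : ℤ) ≤ ν 0 := hν 0
  rw [← hadd, Pi.add_apply] at hμ
  rw [LinearMap.mem_ker, QOps.tensor, LinearMap.add_apply, TensorProduct.map_tmul,
    TensorProduct.map_tmul, H₁.k1_eq_zero lam (by omega) x hx, H₂.k1_eq_zero ν (by omega) y hy,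
    TensorProduct.zero_tmul, TensorProduct.tmul_zero, add_zero]

/-- Of the operators `k_{j̄}` only `k_{1̄}` is given explicitly by `hR`; the others are reached
through `SuperRep.kbar_eq_zero`. -/
theorem QOps.Queer.inOint_of_ops_eq_tensor {R : SuperRep r (M₁ ⊗[Fq] M₂)}
    (hR : R.ops = O₁.tensor O₂) : R.InOint := by
  have hg : R.ops.toGlOps.Good := hR ▸ H₁.good.tensor H₂.good
  have hpos : ∀ μ, R.ops.weightSpace μ ≠ ⊥ → 0 ≤ μ := hR ▸ H₁.tensor_nonneg H₂
  refine ⟨hg.finite, hg.weight, hpos, fun μ _ j hj u hu => ?_⟩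
  rw [pair_kk] at hj
  exact SuperRep.kbar_eq_zero hg hpos (hR ▸ H₁.tensor_k1_eq_zero H₂) j μ hj u hu

end

end

end QueerCrystal

end

open QueerCrystal TensorProduct in
/-- Tensor product rule for crystal bases of `U_q(𝔮(n))`-modules in `𝒪_int^{≥0}`, `n = r + 1 ≥ 2`.
The generators act on `M₁ ⊗ M₂` through the comultiplication (`QOps.tensor`).  The last clause says
that the `U_q(𝔮(n))`-supermodule `M₁ ⊗ M₂` lies in `𝒪_int^{≥0}`; as `q^h, e_i, f_i, k_{1̄}`
generate `U_q(𝔮(n))`, at most one supermodule structure `R` induces these operators. -/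
theorem mainTheorem3 (r : ℕ) [NeZero r]
    {M₁ M₂ B₁ B₂ : Type*}
    [AddCommGroup M₁] [Module Fq M₁] [Module Aq M₁] [IsScalarTower Aq Fq M₁]
    [AddCommGroup M₂] [Module Fq M₂] [Module Aq M₂] [IsScalarTower Aq Fq M₂]
    (R₁ : SuperRep r M₁) (R₂ : SuperRep r M₂) (h₁ : R₁.InOint) (h₂ : R₂.InOint)
    (L₁ : Submodule Aq M₁) (L₂ : Submodule Aq M₂)
    (C₁ : QCrystal r B₁) (C₂ : QCrystal r B₂)
    (l₁ : B₁ → Submodule Aq (Red L₁)) (l₂ : B₂ → Submodule Aq (Red L₂))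
    (hb₁ : IsCrystalBasis R₁.ops L₁ C₁ l₁) (hb₂ : IsCrystalBasis R₂.ops L₂ C₂ l₂) :
    IsCrystalBasis (R₁.ops.tensor R₂.ops) (tensorLattice L₁ L₂) (C₁.tensor C₂)
        (tensorFiber l₁ l₂) ∧
      ∀ R : SuperRep r (M₁ ⊗[Fq] M₂), R.ops = R₁.ops.tensor R₂.ops → R.InOint := by
  exact ⟨hb₁.tensor h₁.queer h₂.queer hb₂, fun R hR => h₁.queer.inOint_of_ops_eq_tensor h₂.queer hR⟩
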